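/- Let $n\ge 2$, let $B=\{y\in\mathbb R^n:|y|<1\}$, $S=\partial B$, and let $B_{x,r}$, $S_{x,r}$ denote the open ball and the sphere with center $x$ and radius $r>0$. Two balls $B_{x,r}\subset B$ and $B_{\bar x,\bar r}\subset B$, and likewise the spheres $S_{x,r}$ and $S_{\bar x,\bar r}$, are called correlated if $x,\bar x$ are codirected (one of them is $0$, or $x=\lambda\bar x$ with $\lambda>0$) and $$(1+|x|^2-r^2)\,|\bar x|=|x|\,(1+|\bar x|^2-\bar r^2).$$ Let $h^2(B)$ be the space of complex-valued harmonic functions $f$ on $B$ with $\sup_{0\le\rho<1}\int_S|f(\rho\zeta)|^2\,ds(\zeta)<\infty$, where $s$ denotes surface-area measure on spheres. Such an $f$ has a radial limit $f(\zeta)=\lim_{\rho\to1^-}f(\rho\zeta)$ at $s$-almost every $\zeta\in S$, this boundary function is square integrable on $S$, and $f$ is extended to $S$ in this way. **Theorem 1.** Let $S_{x,r}$ and $S_{\bar x,\bar r}$ be correlated spheres with $x\ne0$, $0<r<1-|x|$ and $|\bar x|\le|x|$. Then there is exactly one point $a$ with $|a|>1$, $a=|a|\,|x|^{-1}x$ and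 $$\frac{|a|^2+1}{|a|}=\frac{1+|x|^2-r^2}{|x|},$$ and exactly one real number $\alpha$ with $$\frac{1-|a||\bar x|}{\bar r}=\left(\frac{1-|a||x|}{r}\right)^{\alpha}.$$ With the measure $$ds_a=\frac{|y-a|^2+1-|y|^2}{|y-a|^4}\,ds,$$ every $f\in h^2(B)$ satisfies, for every $\beta\in(0,\alpha]$, $$\bar r\int_{S_{\bar x,\bar r}}|f|^2\,ds_a\le\left(r\int_{S_{x,r}}|f|^2\,ds_a\right)^{\beta}\left(\int_{S}|f|^2\,ds_a\right)^{1-\beta}.$$ In particular the inequality holds with $$\beta=\omega:=|\bar x|^2\,\frac{1-|x|-r}{\log\frac{1-|x|^2}{r}},$$ and $\omega\in(0,\alpha]$ if $\bar x\neq0$. (If $\bar x=0$, then $\bar r=1$ and $\alpha=\omega=0$; the inequality with $\beta=0$, where $0^0=1$, is an equality.) -/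

import Mathlib

open MeasureTheory Set Filter Topology Metric

/-- Lebesgue surface-area measure on the sphere with center `x` and radius `r` in `ℝⁿ`, as a measure
on `ℝⁿ`: the image of the surface measure of the unit sphere under `ζ ↦ x + r ζ`, times `r ^ (n-1)`. -/
noncomputable def surfaceMeasure {n : ℕ} (x : EuclideanSpace ℝ (Fin n)) (r : ℝ) :
    Measure (EuclideanSpace ℝ (Fin n)) :=
  ENNReal.ofReal (r ^ (n - 1)) •
    (volume : Measure (EuclideanSpace ℝ (Fin n))).toSphere.map
      (fun ζ : sphere (0 : EuclideanSpace ℝ (Fin n)) 1 => x + r • (ζ : EuclideanSpace ℝ (Fin n)))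

/-- The weighted surface measure
`ds_a = (|y - a|² + 1 - |y|²) / |y - a|⁴ ds` on the sphere with center `x` and radius `r`. -/
noncomputable def weightedSurfaceMeasure {n : ℕ} (a x : EuclideanSpace ℝ (Fin n)) (r : ℝ) :
    Measure (EuclideanSpace ℝ (Fin n)) :=
  (surfaceMeasure x r).withDensity
    (fun y => ENNReal.ofReal ((‖y - a‖ ^ 2 + 1 - ‖y‖ ^ 2) / ‖y - a‖ ^ 4))

/-- The Hardy space `h²(B)` of complex valued harmonic functions in the open unit ball of `ℝⁿ`
(the values of `f` outside the open unit ball play no role). -/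
def MemHarmonicHardyTwo {n : ℕ} (f : EuclideanSpace ℝ (Fin n) → ℂ) : Prop :=
  InnerProductSpace.HarmonicOnNhd f (ball 0 1) ∧
  ∃ C : ℝ, ∀ ρ ∈ Ico (0 : ℝ) 1,
    ∫ ζ : sphere (0 : EuclideanSpace ℝ (Fin n)) 1,
      ‖f (ρ • (ζ : EuclideanSpace ℝ (Fin n)))‖ ^ 2
        ∂(volume : Measure (EuclideanSpace ℝ (Fin n))).toSphere ≤ C

open Classical in
/-- The function `f` on the open unit ball, extended to the unit sphere by its radial limits. -/
noncomputable def boundaryExtension {n : ℕ} (f : EuclideanSpace ℝ (Fin n) → ℂ)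
    (y : EuclideanSpace ℝ (Fin n)) : ℂ :=
  if ‖y‖ < 1 then f y else limUnder (𝓝[<] (1 : ℝ)) (fun ρ : ℝ => f (ρ • y))

/-- Two balls (or the spheres bounding them) contained in the open unit ball are correlated:
the centers are codirected (one of them vanishes, or they are positive multiples of each other)
and `(1 + |x|² - r²) |x'| = |x| (1 + |x'|² - r'²)`. -/
structure Correlated {n : ℕ} (x : EuclideanSpace ℝ (Fin n)) (r : ℝ)
    (x' : EuclideanSpace ℝ (Fin n)) (r' : ℝ) : Prop where
  radius_pos : 0 < r
  radius_pos' : 0 < r'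
  ball_subset : ball x r ⊆ ball 0 1
  ball_subset' : ball x' r' ⊆ ball 0 1
  codirected : SameRay ℝ x x'
  correlation : (1 + ‖x‖ ^ 2 - r ^ 2) * ‖x'‖ = ‖x‖ * (1 + ‖x'‖ ^ 2 - r' ^ 2)

/-- `a` is the point codirected with `x`, of norm `> 1`, with
`(|a|² + 1) / |a| = (1 + |x|² - r²) / |x|`. -/
structure IsInversionCenter {n : ℕ} (x : EuclideanSpace ℝ (Fin n)) (r : ℝ)
    (a : EuclideanSpace ℝ (Fin n)) : Prop where
  one_lt_norm : 1 < ‖a‖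
  eq_smul : a = (‖a‖ * ‖x‖⁻¹) • x
  equation : (‖a‖ ^ 2 + 1) / ‖a‖ = (1 + ‖x‖ ^ 2 - r ^ 2) / ‖x‖

/-- The equation that determines the exponent `α`. -/
def IsThreeSpheresExponent {n : ℕ} (a x : EuclideanSpace ℝ (Fin n)) (r : ℝ)
    (x' : EuclideanSpace ℝ (Fin n)) (r' : ℝ) (α : ℝ) : Prop :=
  (1 - ‖a‖ * ‖x'‖) / r' = ((1 - ‖a‖ * ‖x‖) / r) ^ α

/-- The integral of `|f|²` with respect to `s_a` over the sphere with center `x` and radius `r`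
(on the unit sphere, `f` stands for its radial boundary values). -/
noncomputable def weightedSphereIntegral {n : ℕ} (f : EuclideanSpace ℝ (Fin n) → ℂ)
    (a x : EuclideanSpace ℝ (Fin n)) (r : ℝ) : ℝ :=
  ∫ y, ‖boundaryExtension f y‖ ^ 2 ∂(weightedSurfaceMeasure a x r)

/-- The three-spheres inequality with exponent `β`. -/
def ThreeSpheresInequality {n : ℕ} (f : EuclideanSpace ℝ (Fin n) → ℂ)
    (a x : EuclideanSpace ℝ (Fin n)) (r : ℝ) (x' : EuclideanSpace ℝ (Fin n)) (r' β : ℝ) : Prop :=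
  r' * weightedSphereIntegral f a x' r' ≤
    (r * weightedSphereIntegral f a x r) ^ β * (weightedSphereIntegral f a 0 1) ^ (1 - β)

/-! Write I for the inversion with center a that preserves the unit sphere. Since |a| > 1, I also
preserves the unit ball. It carries the spheres |y| = R, 0 < R ≤ 1, onto the spheres correlated with
S_{x,r}. The one with center x and radius r has R = (1 - |a||x|) / r, and the equation for α says R'
= R^α. The Kelvin transform u(y) = k(y)^(n-2) f(I y), with k(y)² = (|a|² - 1) / |y - a|², is again
the Poisson integral of a square integrable function. The weight in ds_a is exactly the one for
which r ∫ |f|² ds_a over S_{x,r} equals R^n M(R) / (|a|² - 1), where M(R) is the integral of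
|u(Rζ)|² over the unit sphere (`mul_weightedSphereIntegral_eq`). For R = 1, M(1) is formed with the
boundary values.

The theorem thus reduces to the concentric case M(R^α) ≤ M(R)^α M(1)^(1-α), which is logarithmic
convexity of M in log R (`integral_norm_poissonDilation_sq_le_rpow`). No expansion in spherical
harmonics is needed. The Poisson operators P_R are self-adjoint and satisfy P_R P_S = P_{RS}, so for
ρ² = RS one has M(ρ) = ⟨φ, P_{RS} φ⟩ = ⟨P_R φ, P_S φ⟩. Cauchy–Schwarz then gives midpoint convexity
of log M, and continuity gives convexity. The passage from α to a smaller β uses R^n M(R) ≤ M(1).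

The Poisson theory of the ball is built up for this purpose: harmonicity of Poisson integrals, the
maximum principle, uniqueness, the L² representation of h² and Fatou's theorem. Harmonicity is used
only as a sum of second derivatives along coordinate lines. This suffices for the maximum principle,
and a Poisson integral satisfies it by one-parameter differentiation under the integral.

The claim ω ≤ α = log R' / log R follows from two elementary estimates: a lower bound for -log R' in
terms of the numerator of ω and an upper bound for -log R by its denominator. -/

/-- The sum of the second derivatives of `u` at `y` along the coordinate lines exists and is `L`. -/
def HasLineLaplacian {n : ℕ} {F : Type*} [NormedAddCommGroup F] [NormedSpace ℝ F]
    (u : EuclideanSpace ℝ (Fin n) → F) (y : EuclideanSpace ℝ (Fin n)) (L : F) : Prop :=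
  ∃ (u₁ : Fin n → ℝ → F) (u₂ : Fin n → F),
    (∀ i, (∀ᶠ t in 𝓝 (0 : ℝ),
        HasDerivAt (fun t : ℝ => u (y + t • EuclideanSpace.single i (1 : ℝ))) (u₁ i t) t) ∧
      HasDerivAt (u₁ i) (u₂ i) 0) ∧ ∑ i, u₂ i = L

/-! ### Harmonicity along coordinate lines and the maximum principle. -/

section LineLaplacian

variable {n : ℕ} {F : Type*} [NormedAddCommGroup F] [NormedSpace ℝ F]
  {G : Type*} [NormedAddCommGroup G] [NormedSpace ℝ G]
  {u v : EuclideanSpace ℝ (Fin n) → F} {y : EuclideanSpace ℝ (Fin n)} {L L' : F}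

theorem HasLineLaplacian.add (hu : HasLineLaplacian u y L) (hv : HasLineLaplacian v y L') :
    HasLineLaplacian (fun z => u z + v z) y (L + L') := by
  obtain ⟨u₁, u₂, hu, rfl⟩ := hu
  obtain ⟨v₁, v₂, hv, rfl⟩ := hv
  refine ⟨fun i t => u₁ i t + v₁ i t, fun i => u₂ i + v₂ i, fun i => ⟨?_, ?_⟩,
    Finset.sum_add_distrib⟩
  · filter_upwards [(hu i).1, (hv i).1] with t h1 h2 using h1.add h2
  · exact (hu i).2.add (hv i).2

theorem HasLineLaplacian.clm_comp (l : F →L[ℝ] G) (hu : HasLineLaplacian u y L) :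
    HasLineLaplacian (fun z => l (u z)) y (l L) := by
  obtain ⟨u₁, u₂, hu, rfl⟩ := hu
  refine ⟨fun i t => l (u₁ i t), fun i => l (u₂ i), fun i => ⟨?_, ?_⟩, by simp⟩
  · filter_upwards [(hu i).1] with t h1 using l.hasFDerivAt.comp_hasDerivAt t h1
  · exact l.hasFDerivAt.comp_hasDerivAt 0 (hu i).2

theorem HasLineLaplacian.sub (hu : HasLineLaplacian u y L) (hv : HasLineLaplacian v y L') :
    HasLineLaplacian (fun z => u z - v z) y (L - L') := by
  simpa [sub_eq_add_neg] using hu.add (hv.clm_comp (-(ContinuousLinearMap.id ℝ F)))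

theorem HasLineLaplacian.comp_smul (ρ : ℝ) (hu : HasLineLaplacian u (ρ • y) 0) :
    HasLineLaplacian (fun z => u (ρ • z)) y 0 := by
  obtain ⟨u₁, u₂, hu, hs⟩ := hu
  have hlin : ∀ t : ℝ, HasDerivAt (fun t : ℝ => ρ * t) ρ t := fun t => by
    simpa using (hasDerivAt_id t).const_mul ρ
  refine ⟨fun i t => ρ • u₁ i (ρ * t), fun i => ρ • ρ • u₂ i, fun i => ⟨?_, ?_⟩, ?_⟩
  · have h0 : Tendsto (fun t : ℝ => ρ * t) (𝓝 0) (𝓝 0) := by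
      simpa using (hlin 0).continuousAt.tendsto
    filter_upwards [h0.eventually (hu i).1] with t h1
    have := h1.scomp t (hlin t)
    refine this.congr_of_eventuallyEq (Eventually.of_forall fun s => ?_)
    simp [smul_add, smul_smul]
  · refine HasDerivAt.const_smul ρ ?_
    have h1 : HasDerivAt (u₁ i) (u₂ i) (ρ * 0) := by simpa using (hu i).2
    exact h1.scomp 0 (hlin 0)
  · rw [← Finset.smul_sum, ← Finset.smul_sum, hs]; simp

theorem hasLineLaplacian_norm_sq : HasLineLaplacian (fun z => ‖z‖ ^ 2) y (2 * (n : ℝ)) := by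
  refine ⟨fun i t => 2 * (y i + t), fun i => 2, fun i => ⟨Eventually.of_forall fun t => ?_, ?_⟩,
    by simp [mul_comm]⟩
  · have : (fun t : ℝ => ‖y + t • EuclideanSpace.single i (1 : ℝ)‖ ^ 2)
        = fun t => ‖y‖ ^ 2 + 2 * (t * y i) + t ^ 2 := by
      funext t
      rw [norm_add_sq_real, inner_smul_right, norm_smul, EuclideanSpace.inner_single_right]
      simp
    rw [this]
    have h := (((hasDerivAt_id t).mul_const (y i)).const_mul 2).const_add (‖y‖ ^ 2)
    refine (h.add (hasDerivAt_pow 2 t)).congr_deriv ?_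
    simp only [Nat.cast_ofNat]
    ring
  · simpa using ((hasDerivAt_id (0 : ℝ)).const_add (y i)).const_mul 2

/-- The Laplacian is the trace of the second Fréchet derivative in the standard orthonormal basis,
and the diagonal entries are the second derivatives along the coordinate lines. -/
theorem HasLineLaplacian.of_harmonicAt (hu : InnerProductSpace.HarmonicAt u y) :
    HasLineLaplacian u y 0 := by
  have hlap := hu.2.eq_of_nhds
  have hc := hu.1
  rw [InnerProductSpace.laplacian_eq_iteratedFDeriv_orthonormalBasis u
    (EuclideanSpace.basisFun (Fin n) ℝ)] at hlap
  refine ⟨fun i t => fderiv ℝ u (y + t • EuclideanSpace.single i (1 : ℝ))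
      (EuclideanSpace.single i (1 : ℝ)),
    fun i => iteratedFDeriv ℝ 2 u y ![EuclideanSpace.single i (1 : ℝ),
      EuclideanSpace.single i (1 : ℝ)], fun i => ?_, by simpa using hlap⟩
  have hline : ∀ t : ℝ, HasDerivAt (fun t : ℝ => y + t • EuclideanSpace.single i (1 : ℝ))
      (EuclideanSpace.single i (1 : ℝ)) t := fun t => by
    simpa using ((hasDerivAt_id t).smul_const (EuclideanSpace.single i (1 : ℝ))).const_add y
  constructor
  · have h0 : Tendsto (fun t : ℝ => y + t • EuclideanSpace.single i (1 : ℝ)) (𝓝 0) (𝓝 y) := by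
      simpa using (hline 0).continuousAt.tendsto
    filter_upwards [h0.eventually (hc.eventually (by simp))] with t h1
    exact (h1.differentiableAt (by simp)).hasFDerivAt.comp_hasDerivAt t (hline t)
  · have h1 : DifferentiableAt ℝ (fderiv ℝ u) (y + (0 : ℝ) • EuclideanSpace.single i (1 : ℝ)) := by
      simpa using (hc.fderiv_right (m := 1) (by norm_num)).differentiableAt (by simp)
    have h2 := h1.hasFDerivAt.comp_hasDerivAt (0 : ℝ) (hline 0)
    have h3 := h2.clm_apply (hasDerivAt_const (0 : ℝ) (EuclideanSpace.single i (1 : ℝ)))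
    refine h3.congr_deriv ?_
    simp only [iteratedFDeriv_two_apply]
    simp

/-- At an interior maximum the second derivative is nonpositive. -/
theorem IsLocalMax.second_deriv_nonpos {g g₁ : ℝ → ℝ} {c : ℝ} (hmax : IsLocalMax g 0)
    (h1 : ∀ᶠ t in 𝓝 (0 : ℝ), HasDerivAt g (g₁ t) t) (h2 : HasDerivAt g₁ c 0) : c ≤ 0 := by
  by_contra! hc
  have he : deriv g =ᶠ[𝓝 0] g₁ := h1.mono fun t ht => ht.deriv
  have hdd : deriv (deriv g) 0 = c := by rw [he.deriv_eq, h2.deriv]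
  -- A positive second derivative would make 0 a local minimum as well, so `g` would be locally
  -- constant and its second derivative zero.
  have hmin : IsLocalMin g 0 := isLocalMin_of_deriv_deriv_pos (by rw [hdd]; exact hc)
    hmax.deriv_eq_zero h1.self_of_nhds.continuousAt
  have hconst : g =ᶠ[𝓝 0] fun _ => g 0 := by
    filter_upwards [hmax, hmin] with t h3 h4 using le_antisymm h3 h4
  have hz : deriv g =ᶠ[𝓝 0] fun _ => 0 := by
    have := hconst.deriv
    simpa using this
  have : deriv (deriv g) 0 = 0 := by rw [hz.deriv_eq]; simp
  linarith

/-- The weak maximum principle on a ball. -/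
theorem HasLineLaplacian.le_of_le_on_sphere {u : EuclideanSpace ℝ (Fin n) → ℝ} (hn : 0 < n)
    {R M : ℝ} (hc : ContinuousOn u (closedBall 0 R))
    (hu : ∀ y ∈ ball (0 : EuclideanSpace ℝ (Fin n)) R, HasLineLaplacian u y 0)
    (hM : ∀ y ∈ sphere (0 : EuclideanSpace ℝ (Fin n)) R, u y ≤ M)
    {y : EuclideanSpace ℝ (Fin n)} (hy : y ∈ closedBall (0 : EuclideanSpace ℝ (Fin n)) R) :
    u y ≤ M := by
  -- Adding ε‖z‖² makes the Laplacian equal to 2nε > 0, so the maximum of the perturbed function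
  -- cannot be interior.
  have key : ∀ ε : ℝ, 0 < ε → u y ≤ M + ε * R ^ 2 := by
    intro ε hε
    have hc' : ContinuousOn (fun z => u z + ε * ‖z‖ ^ 2) (closedBall 0 R) := by fun_prop
    obtain ⟨z, hz, hzmax⟩ := (isCompact_closedBall (0 : EuclideanSpace ℝ (Fin n)) R).exists_isMaxOn
      ⟨y, hy⟩ hc'
    have hzs : z ∈ sphere (0 : EuclideanSpace ℝ (Fin n)) R := by
      by_contra hzs
      have hzb : z ∈ ball (0 : EuclideanSpace ℝ (Fin n)) R := by
        rw [← closedBall_sdiff_sphere]; exact ⟨hz, hzs⟩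
      obtain ⟨u₁, u₂, h, hsum⟩ := (hu z hzb).add
        ((hasLineLaplacian_norm_sq (y := z)).clm_comp (ε • ContinuousLinearMap.id ℝ ℝ))
      have hle : ∀ i, u₂ i ≤ 0 := by
        intro i
        refine IsLocalMax.second_deriv_nonpos ?_ (h i).1 (h i).2
        have h0 : Tendsto (fun t : ℝ => z + t • EuclideanSpace.single i (1 : ℝ)) (𝓝 0) (𝓝 z) := by
          have : Continuous (fun t : ℝ => z + t • EuclideanSpace.single i (1 : ℝ)) := by fun_prop
          simpa using this.tendsto 0
        filter_upwards [h0.eventually (isOpen_ball.mem_nhds hzb)] with t ht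
        simpa using hzmax (ball_subset_closedBall ht)
      have h3 : ∑ i, u₂ i ≤ 0 := Finset.sum_nonpos fun i _ => hle i
      rw [hsum] at h3
      have : (0 : ℝ) < n := by exact_mod_cast hn
      simp at h3
      nlinarith [mul_pos hε this]
    have h1 : u y + ε * ‖y‖ ^ 2 ≤ u z + ε * ‖z‖ ^ 2 := hzmax hy
    have h2 := hM z hzs
    have h3 : ‖z‖ = R := by simpa using hzs
    rw [h3] at h1
    nlinarith [mul_nonneg hε.le (sq_nonneg ‖y‖)]
  refine le_of_forall_pos_le_add fun δ hδ => ?_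
  have := key (δ / (R ^ 2 + 1)) (by positivity)
  have h4 : δ / (R ^ 2 + 1) * R ^ 2 ≤ δ := by
    rw [div_mul_eq_mul_div, div_le_iff₀ (by positivity)]; nlinarith [sq_nonneg R]
  linarith

end LineLaplacian

/-! ### Differentiation under an integral over a compact space. -/

section ParametricIntegral

variable {X F : Type*} [TopologicalSpace X] [CompactSpace X] [MeasurableSpace X] [BorelSpace X]
  {μ : Measure X}
  [NormedAddCommGroup F] [NormedSpace ℝ F]

theorem Continuous.integrable_smul_of_compactSpace [SecondCountableTopology X] {g : X → ℝ}
    {φ : X → F} (hg : Continuous g) (hφ : Integrable φ μ) :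
    Integrable (fun x => g x • φ x) μ := by
  obtain ⟨C, hC⟩ := isCompact_univ.exists_bound_of_continuousOn hg.continuousOn
  exact hφ.bdd_smul C hg.aestronglyMeasurable (Eventually.of_forall fun x => hC x (mem_univ x))

omit [CompactSpace X] [MeasurableSpace X] [BorelSpace X] in
theorem continuous_slice_of_continuousOn {g : ℝ → X → ℝ} {s : Set ℝ}
    (hg : ContinuousOn (fun p : ℝ × X => g p.1 p.2) (s ×ˢ univ)) {t : ℝ} (ht : t ∈ s) :
    Continuous (g t) := by
  have : Continuous fun x : X => (t, x) := by fun_prop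
  exact continuousOn_univ.1 (hg.comp this.continuousOn fun x _ => ⟨ht, mem_univ _⟩)

/-- On the compact set [-δ, δ] × X the derivative `g'` is bounded, so a multiple of `‖φ‖` dominates
the difference quotients. Only integrability of `φ` is needed. -/
theorem hasDerivAt_integral_smul_of_continuousOn [SecondCountableTopology X]
    {g g' : ℝ → X → ℝ} {δ : ℝ} {φ : X → F}
    (hφ : Integrable φ μ)
    (hg : ∀ t ∈ Icc (-δ) δ, Continuous (g t))
    (hg' : ContinuousOn (fun p : ℝ × X => g' p.1 p.2) (Icc (-δ) δ ×ˢ univ))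
    (hd : ∀ t ∈ Ioo (-δ) δ, ∀ x, HasDerivAt (fun t => g t x) (g' t x) t)
    {t : ℝ} (ht : t ∈ Ioo (-δ) δ) :
    HasDerivAt (fun t => ∫ x, g t x • φ x ∂μ) (∫ x, g' t x • φ x ∂μ) t := by
  obtain ⟨C, hC⟩ := (isCompact_Icc.prod isCompact_univ).exists_bound_of_continuousOn hg'
  have hnhds : Ioo (-δ) δ ∈ 𝓝 t := isOpen_Ioo.mem_nhds ht
  have hgt' : Continuous (g' t) :=
    continuous_slice_of_continuousOn hg' (Ioo_subset_Icc_self ht)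
  refine (hasDerivAt_integral_of_dominated_loc_of_deriv_le (bound := fun x => C * ‖φ x‖)
    (F := fun t x => g t x • φ x) (F' := fun t x => g' t x • φ x) hnhds ?_ ?_ ?_ ?_ ?_ ?_).2
  · filter_upwards [hnhds] with s hs
    exact ((hg s (Ioo_subset_Icc_self hs)).integrable_smul_of_compactSpace
      hφ).aestronglyMeasurable
  · exact (hg t (Ioo_subset_Icc_self ht)).integrable_smul_of_compactSpace hφ
  · exact (hgt'.integrable_smul_of_compactSpace hφ).aestronglyMeasurable
  · refine Eventually.of_forall fun x s hs => ?_
    rw [norm_smul]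
    exact mul_le_mul_of_nonneg_right (hC (s, x) ⟨Ioo_subset_Icc_self hs, mem_univ _⟩)
      (norm_nonneg _)
  · exact hφ.norm.const_mul C
  · exact Eventually.of_forall fun x s hs => (hd s hs x).smul_const (φ x)

end ParametricIntegral

/-! ### Derivatives of the Poisson kernel along a line. -/

section QuadraticPower

variable (p₀ p₁ q₀ q₁ s : ℝ)

/-- This is the shape of the Poisson kernel on a coordinate line: 1 - ‖y + t eᵢ‖² and ‖y + t eᵢ -
ζ‖² are quadratics in t with leading coefficients -1 and 1, and s = -n/2. -/
theorem hasDerivAt_quadratic_mul_rpow {t : ℝ} (hq : 0 < q₀ + q₁ * t + t ^ 2) :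
    HasDerivAt (fun t => (p₀ + p₁ * t - t ^ 2) * (q₀ + q₁ * t + t ^ 2) ^ s)
      ((p₁ - 2 * t) * (q₀ + q₁ * t + t ^ 2) ^ s
        + (p₀ + p₁ * t - t ^ 2) * (s * (q₁ + 2 * t) * (q₀ + q₁ * t + t ^ 2) ^ (s - 1))) t := by
  have hl : ∀ c d : ℝ, HasDerivAt (fun t : ℝ => c + d * t) d t := fun c d => by
    simpa using ((hasDerivAt_id t).const_mul d).const_add c
  have hp := (hl p₀ p₁).sub (hasDerivAt_pow 2 t)
  have hq' := (hl q₀ q₁).add (hasDerivAt_pow 2 t)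
  refine (hp.mul (hq'.rpow_const (p := s) (Or.inl hq.ne'))).congr_deriv ?_
  simp only [Nat.cast_ofNat, Pi.add_apply, Pi.sub_apply]
  ring

theorem hasDerivAt_deriv_quadratic_mul_rpow {t : ℝ} (hq : 0 < q₀ + q₁ * t + t ^ 2) :
    HasDerivAt (fun t => (p₁ - 2 * t) * (q₀ + q₁ * t + t ^ 2) ^ s
        + (p₀ + p₁ * t - t ^ 2) * (s * (q₁ + 2 * t) * (q₀ + q₁ * t + t ^ 2) ^ (s - 1)))
      (-2 * (q₀ + q₁ * t + t ^ 2) ^ s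
        + 2 * s * (p₁ - 2 * t) * (q₁ + 2 * t) * (q₀ + q₁ * t + t ^ 2) ^ (s - 1)
        + 2 * s * (p₀ + p₁ * t - t ^ 2) * (q₀ + q₁ * t + t ^ 2) ^ (s - 1)
        + s * (s - 1) * (p₀ + p₁ * t - t ^ 2) * (q₁ + 2 * t) ^ 2
          * (q₀ + q₁ * t + t ^ 2) ^ (s - 2)) t := by
  have hl : ∀ c d : ℝ, HasDerivAt (fun t : ℝ => c + d * t) d t := fun c d => by
    simpa using ((hasDerivAt_id t).const_mul d).const_add c
  have hp := (hl p₀ p₁).sub (hasDerivAt_pow 2 t)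
  have hq' := (hl q₀ q₁).add (hasDerivAt_pow 2 t)
  have hp1 : HasDerivAt (fun t : ℝ => p₁ - 2 * t) (-2) t := by
    simpa [sub_eq_add_neg] using hl p₁ (-2)
  have hq1 := (hl q₁ 2).const_mul s
  refine ((hp1.mul (hq'.rpow_const (p := s) (Or.inl hq.ne'))).add
    (hp.mul (hq1.mul (hq'.rpow_const (p := s - 1) (Or.inl hq.ne'))))).congr_deriv ?_
  simp only [Nat.cast_ofNat, Pi.add_apply, Pi.sub_apply, Pi.mul_apply]
  rw [show s - 1 - 1 = s - 2 by ring]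
  ring

end QuadraticPower

/-! ### The Poisson kernel and harmonicity of Poisson integrals. -/

/-- The Poisson kernel of the unit ball, normalized for the surface measure of the unit sphere. -/
noncomputable def ballKernel {n : ℕ} (y ζ : EuclideanSpace ℝ (Fin n)) : ℝ :=
  ((volume : Measure (EuclideanSpace ℝ (Fin n))).toSphere.real univ)⁻¹ *
    ((1 - ‖y‖ ^ 2) / ‖y - ζ‖ ^ n)

/-- The Poisson integral of a function on the unit sphere. -/
noncomputable def ballPoissonIntegral {n : ℕ} {F : Type*} [NormedAddCommGroup F] [NormedSpace ℝ F]
    (φ : sphere (0 : EuclideanSpace ℝ (Fin n)) 1 → F) (y : EuclideanSpace ℝ (Fin n)) : F :=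
  ∫ ζ, ballKernel y (ζ : EuclideanSpace ℝ (Fin n)) • φ ζ
    ∂(volume : Measure (EuclideanSpace ℝ (Fin n))).toSphere

section Kernel

variable {n : ℕ} {F : Type*} [NormedAddCommGroup F] [NormedSpace ℝ F]

theorem one_sub_norm_le_norm_sub {y ζ : EuclideanSpace ℝ (Fin n)} (hζ : ‖ζ‖ = 1) :
    1 - ‖y‖ ≤ ‖y - ζ‖ := by
  have := norm_sub_norm_le ζ y
  rw [norm_sub_rev] at this
  linarith

theorem norm_sub_pos_of_norm_lt_one {y ζ : EuclideanSpace ℝ (Fin n)} (hy : ‖y‖ < 1)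
    (hζ : ‖ζ‖ = 1) : 0 < ‖y - ζ‖ :=
  (sub_pos.2 hy).trans_le (one_sub_norm_le_norm_sub hζ)

theorem ballKernel_nonneg {y ζ : EuclideanSpace ℝ (Fin n)} (hy : ‖y‖ ≤ 1) : 0 ≤ ballKernel y ζ := by
  have : 0 ≤ 1 - ‖y‖ ^ 2 := by nlinarith [norm_nonneg y]
  unfold ballKernel
  positivity

theorem continuous_ballKernel_right {y : EuclideanSpace ℝ (Fin n)} (hy : ‖y‖ < 1) :
    Continuous fun ζ : sphere (0 : EuclideanSpace ℝ (Fin n)) 1 => ballKernel y ζ := by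
  unfold ballKernel
  refine continuous_const.mul (continuous_const.div (by fun_prop) fun ζ => ?_)
  exact (pow_pos (norm_sub_pos_of_norm_lt_one hy (by simp)) n).ne'

theorem norm_sq_add_smul_single (y : EuclideanSpace ℝ (Fin n)) (i : Fin n) (t : ℝ) :
    ‖y + t • EuclideanSpace.single i (1 : ℝ)‖ ^ 2 = ‖y‖ ^ 2 + 2 * y i * t + t ^ 2 := by
  rw [norm_add_sq_real, inner_smul_right, norm_smul, EuclideanSpace.inner_single_right]
  simp
  ring

theorem sq_rpow_half_natCast {d : ℝ} (hd : 0 ≤ d) (n : ℕ) :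
    (d ^ 2) ^ ((n : ℝ) / 2) = d ^ n := by
  rw [← Real.rpow_natCast d 2, ← Real.rpow_mul hd, ← Real.rpow_natCast d n]
  congr 1
  push_cast
  ring

/-- Harmonicity of the kernel. The summands are the second derivatives from
`hasDerivAt_deriv_quadratic_mul_rpow` at t = 0. With the factor Q^(s-2) taken out, Q = ‖y - ζ‖², the
sum is a polynomial in ‖y‖² and ⟨y, ζ⟩ that vanishes for s = -n/2. -/
theorem sum_second_deriv_kernel_eq_zero {y ζ : EuclideanSpace ℝ (Fin n)} (hy : ‖y‖ < 1)
    (hζ : ‖ζ‖ = 1) :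
    ∑ i, (-2 * (‖y - ζ‖ ^ 2) ^ (-(n / 2) : ℝ)
      + 2 * (-(n / 2) : ℝ) * (-2 * y i) * (2 * (y i - ζ i)) * (‖y - ζ‖ ^ 2) ^ (-(n / 2) - 1 : ℝ)
      + 2 * (-(n / 2) : ℝ) * (1 - ‖y‖ ^ 2) * (‖y - ζ‖ ^ 2) ^ (-(n / 2) - 1 : ℝ)
      + (-(n / 2) : ℝ) * (-(n / 2) - 1) * (1 - ‖y‖ ^ 2) * (2 * (y i - ζ i)) ^ 2
          * (‖y - ζ‖ ^ 2) ^ (-(n / 2) - 2 : ℝ)) = 0 := by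
  have hζ2 : ∑ i, ζ i ^ 2 = 1 := by
    rw [← EuclideanSpace.real_norm_sq_eq, hζ, one_pow]
  have hY : ∑ i, y i ^ 2 = ‖y‖ ^ 2 := (EuclideanSpace.real_norm_sq_eq y).symm
  have hQ : ‖y - ζ‖ ^ 2 = ‖y‖ ^ 2 - 2 * (∑ i, y i * ζ i) + 1 := by
    rw [EuclideanSpace.real_norm_sq_eq, ← hY, ← hζ2, Finset.mul_sum, ← Finset.sum_sub_distrib,
      ← Finset.sum_add_distrib]
    exact Finset.sum_congr rfl fun i _ => by simp; ring
  have hQpos : 0 < ‖y - ζ‖ ^ 2 := pow_pos (norm_sub_pos_of_norm_lt_one hy hζ) 2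
  generalize ‖y - ζ‖ ^ 2 = Q at *
  generalize ‖y‖ ^ 2 = Y at *
  generalize hD : ∑ i, y i * ζ i = D at *
  generalize hs : (-(n / 2) : ℝ) = s at *
  have e1 : Q ^ s = Q ^ (s - 2) * Q ^ 2 := by
    rw [← Real.rpow_natCast Q 2, ← Real.rpow_add hQpos]; congr 1; push_cast; ring
  have e2 : Q ^ (s - 1) = Q ^ (s - 2) * Q := by
    rw [← Real.rpow_add_one hQpos.ne']; congr 1; ring
  rw [e1, e2]
  generalize Q ^ (s - 2) = E
  have h1 : ∀ i, -2 * (E * Q ^ 2) + 2 * s * (-2 * y i) * (2 * (y i - ζ i)) * (E * Q)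
      + 2 * s * (1 - Y) * (E * Q) + s * (s - 1) * (1 - Y) * (2 * (y i - ζ i)) ^ 2 * E
      = E * (-2 * Q ^ 2 + 2 * s * (1 - Y) * Q)
        + E * (-8 * s * Q + 4 * s * (s - 1) * (1 - Y)) * (y i ^ 2)
        + E * (8 * s * Q - 8 * s * (s - 1) * (1 - Y)) * (y i * ζ i)
        + E * (4 * s * (s - 1) * (1 - Y)) * ζ i ^ 2 := fun i => by ring
  simp_rw [h1]
  simp only [Finset.sum_add_distrib, ← Finset.mul_sum, Finset.sum_const, Finset.card_univ,
    Fintype.card_fin, nsmul_eq_mul, hY, hζ2, hD]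
  rw [hQ, ← hs]
  ring

theorem hasLineLaplacian_ballPoissonIntegral {φ : sphere (0 : EuclideanSpace ℝ (Fin n)) 1 → F}
    (hφ : Integrable φ (volume : Measure (EuclideanSpace ℝ (Fin n))).toSphere)
    {y : EuclideanSpace ℝ (Fin n)} (hy : ‖y‖ < 1) :
    HasLineLaplacian (ballPoissonIntegral φ) y 0 := by
  set c : ℝ := ((volume : Measure (EuclideanSpace ℝ (Fin n))).toSphere.real univ)⁻¹ with hc
  set s : ℝ := -(n / 2) with hs
  -- Half the distance to the sphere, so that the segments |t| ≤ δ stay inside the ball and the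
  -- kernel is smooth along them.
  set δ : ℝ := (1 - ‖y‖) / 2 with hδ
  have hδ0 : 0 < δ := by rw [hδ]; linarith
  set q : Fin n → ℝ → sphere (0 : EuclideanSpace ℝ (Fin n)) 1 → ℝ :=
    fun i t ζ => ‖y - ζ‖ ^ 2 + 2 * (y i - (ζ : EuclideanSpace ℝ (Fin n)) i) * t + t ^ 2 with hq
  set p : Fin n → ℝ → ℝ := fun i t => 1 - ‖y‖ ^ 2 + (-2 * y i) * t - t ^ 2 with hp
  have hqn : ∀ i t ζ, q i t ζ = ‖y + t • EuclideanSpace.single i (1 : ℝ) - ζ‖ ^ 2 := fun i t ζ => by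
    rw [add_sub_right_comm, norm_sq_add_smul_single]; simp [hq]
  have hpn : ∀ i t, p i t = 1 - ‖y + t • EuclideanSpace.single i (1 : ℝ)‖ ^ 2 := fun i t => by
    rw [norm_sq_add_smul_single]; simp [hp]; ring
  have hlt : ∀ i, ∀ t ∈ Icc (-δ) δ, ‖y + t • EuclideanSpace.single i (1 : ℝ)‖ < 1 := by
    intro i t ht
    have h1 := norm_add_le y (t • EuclideanSpace.single i (1 : ℝ))
    rw [norm_smul] at h1
    have h2 : |t| ≤ δ := abs_le.2 ht
    simp at h1
    linarith
  have hqpos : ∀ i, ∀ t ∈ Icc (-δ) δ, ∀ ζ, 0 < q i t ζ := fun i t ht ζ => by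
    rw [hqn]
    exact pow_pos (norm_sub_pos_of_norm_lt_one (hlt i t ht) (by simp)) 2
  have hK : ∀ i, ∀ t ∈ Icc (-δ) δ, ∀ ζ : sphere (0 : EuclideanSpace ℝ (Fin n)) 1,
      ballKernel (y + t • EuclideanSpace.single i (1 : ℝ)) ζ = c * (p i t * q i t ζ ^ s) := by
    intro i t ht ζ
    have h1 := norm_sub_pos_of_norm_lt_one (hlt i t ht) (norm_eq_of_mem_sphere ζ)
    rw [ballKernel, hqn, hpn, hs, Real.rpow_neg (by positivity), sq_rpow_half_natCast h1.le,
      div_eq_mul_inv]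
  have hqc : ∀ i, Continuous fun x : ℝ × sphere (0 : EuclideanSpace ℝ (Fin n)) 1 => q i x.1 x.2 := by
    intro i; simp only [hq]; fun_prop
  have hqr : ∀ i (r : ℝ), ContinuousOn (fun x : ℝ × sphere (0 : EuclideanSpace ℝ (Fin n)) 1 =>
      q i x.1 x.2 ^ r) (Icc (-δ) δ ×ˢ univ) := fun i r =>
    (hqc i).continuousOn.rpow_const fun x hx => Or.inl (hqpos i x.1 hx.1 x.2).ne'
  set g₁ : Fin n → ℝ → sphere (0 : EuclideanSpace ℝ (Fin n)) 1 → ℝ := fun i t ζ =>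
    (-2 * y i - 2 * t) * q i t ζ ^ s + p i t *
      (s * (2 * (y i - (ζ : EuclideanSpace ℝ (Fin n)) i) + 2 * t) * q i t ζ ^ (s - 1)) with hg₁
  set g₂ : Fin n → ℝ → sphere (0 : EuclideanSpace ℝ (Fin n)) 1 → ℝ := fun i t ζ =>
    -2 * q i t ζ ^ s
      + 2 * s * (-2 * y i - 2 * t) * (2 * (y i - (ζ : EuclideanSpace ℝ (Fin n)) i) + 2 * t)
        * q i t ζ ^ (s - 1)
      + 2 * s * p i t * q i t ζ ^ (s - 1)
      + s * (s - 1) * p i t * (2 * (y i - (ζ : EuclideanSpace ℝ (Fin n)) i) + 2 * t) ^ 2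
          * q i t ζ ^ (s - 2) with hg₂
  have hpc : ∀ i, Continuous (p i) := fun i => by simp only [hp]; fun_prop
  have hg₁c : ∀ i, ContinuousOn (fun x : ℝ × sphere (0 : EuclideanSpace ℝ (Fin n)) 1 =>
      c * g₁ i x.1 x.2) (Icc (-δ) δ ×ˢ univ) := by
    intro i
    have h1 := hqr i s
    have h2 := hqr i (s - 1)
    have h3 := hpc i
    simp only [hg₁]
    fun_prop
  have hg₂c : ∀ i, ContinuousOn (fun x : ℝ × sphere (0 : EuclideanSpace ℝ (Fin n)) 1 =>
      c * g₂ i x.1 x.2) (Icc (-δ) δ ×ˢ univ) := by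
    intro i
    have h1 := hqr i s
    have h2 := hqr i (s - 1)
    have h4 := hqr i (s - 2)
    have h3 := hpc i
    simp only [hg₂]
    fun_prop
  have h0 : (0 : ℝ) ∈ Ioo (-δ) δ := ⟨by linarith, hδ0⟩
  refine ⟨fun i t => ∫ ζ, (c * g₁ i t ζ) • φ ζ
      ∂(volume : Measure (EuclideanSpace ℝ (Fin n))).toSphere,
    fun i => ∫ ζ, (c * g₂ i 0 ζ) • φ ζ ∂(volume : Measure (EuclideanSpace ℝ (Fin n))).toSphere,
    fun i => ⟨?_, ?_⟩, ?_⟩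
  · filter_upwards [isOpen_Ioo.mem_nhds h0] with t ht
    refine hasDerivAt_integral_smul_of_continuousOn hφ
      (g := fun t (ζ : sphere (0 : EuclideanSpace ℝ (Fin n)) 1) =>
        ballKernel (y + t • EuclideanSpace.single i (1 : ℝ)) ζ)
      (g' := fun t ζ => c * g₁ i t ζ)
      (fun t ht => continuous_ballKernel_right (hlt i t ht)) (hg₁c i) ?_ ht
    intro t ht ζ
    refine ((hasDerivAt_quadratic_mul_rpow _ _ _ _ s
      (hqpos i t (Ioo_subset_Icc_self ht) ζ)).const_mul c).congr_of_eventuallyEq ?_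
    filter_upwards [isOpen_Ioo.mem_nhds ht] with r hr
    exact hK i r (Ioo_subset_Icc_self hr) ζ
  · refine hasDerivAt_integral_smul_of_continuousOn hφ (g := fun t ζ => c * g₁ i t ζ)
      (g' := fun t ζ => c * g₂ i t ζ) (fun t ht => ?_) (hg₂c i) ?_ h0
    · exact continuous_slice_of_continuousOn (g := fun t ζ => c * g₁ i t ζ) (hg₁c i) ht
    · intro t ht ζ
      exact (hasDerivAt_deriv_quadratic_mul_rpow _ _ _ _ s
        (hqpos i t (Ioo_subset_Icc_self ht) ζ)).const_mul c
  · rw [← integral_finsetSum]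
    · refine integral_eq_zero_of_ae (Eventually.of_forall fun ζ => ?_)
      simp only [Pi.zero_apply]
      rw [← Finset.sum_smul, ← Finset.mul_sum]
      have hζ : ‖(ζ : EuclideanSpace ℝ (Fin n))‖ = 1 := norm_eq_of_mem_sphere ζ
      have hsum : ∑ i, g₂ i 0 ζ = 0 := by
        refine Eq.trans (Finset.sum_congr rfl fun i _ => ?_)
          (sum_second_deriv_kernel_eq_zero hy hζ)
        simp only [hg₂, hq, hp, hs, mul_zero, add_zero, sub_zero, ne_eq, OfNat.ofNat_ne_zero,
          not_false_eq_true, zero_pow]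
      rw [hsum, mul_zero, zero_smul]
    · intro i _
      exact (continuous_slice_of_continuousOn (g := fun t ζ => c * g₂ i t ζ) (hg₂c i)
        (Ioo_subset_Icc_self h0)).integrable_smul_of_compactSpace hφ

end Kernel

/-! ### Surface measure as a radial projection of Lebesgue measure. -/

section SphereMeasure

variable {n : ℕ}

/-- The cone over a set on the sphere is its preimage under radial projection. In this form,
isometry invariance and change of variables for Lebesgue measure pass to the sphere. -/
theorem map_coe_toSphere : (volume : Measure (EuclideanSpace ℝ (Fin n))).toSphere.map (↑) =
    (n : ENNReal) • (volume.restrict (ball (0 : EuclideanSpace ℝ (Fin n)) 1 \ {0})).map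
      (fun y => ‖y‖⁻¹ • y) := by
  have hN : Measurable fun y : EuclideanSpace ℝ (Fin n) => ‖y‖⁻¹ • y := by fun_prop
  ext s hs
  rw [Measure.map_apply measurable_subtype_coe hs, Measure.toSphere_apply' _
    (measurable_subtype_coe hs), Measure.smul_apply, Measure.map_apply hN hs,
    Measure.restrict_apply (hN hs), finrank_euclideanSpace_fin, smul_eq_mul]
  congr 2
  ext y
  constructor
  · rintro ⟨t, ht, ζ, ⟨ζ, hζ, rfl⟩, rfl⟩
    have h1 : ‖(ζ : EuclideanSpace ℝ (Fin n))‖ = 1 := norm_eq_of_mem_sphere ζ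
    have h2 : ‖t • (ζ : EuclideanSpace ℝ (Fin n))‖ = t := by
      rw [norm_smul, h1, mul_one, Real.norm_of_nonneg ht.1.le]
    refine ⟨?_, ?_, ?_⟩
    · simp only [mem_preimage] at hζ ⊢
      rw [h2, smul_smul, inv_mul_cancel₀ ht.1.ne', one_smul]
      exact hζ
    · rw [mem_ball_zero_iff]
      exact h2.trans_lt ht.2
    · intro h
      rw [mem_singleton_iff] at h
      simp only [h, norm_zero] at h2
      exact ht.1.ne h2
  · rintro ⟨hy, hy1, hy0⟩
    have h0 : 0 < ‖y‖ := norm_pos_iff.2 hy0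
    refine ⟨‖y‖, ⟨h0, by simpa using hy1⟩, ‖y‖⁻¹ • y, ⟨⟨‖y‖⁻¹ • y, ?_⟩, hy, rfl⟩, ?_⟩
    · simp [norm_smul, h0.ne']
    · simp [smul_smul, h0.ne']

theorem map_coe_toSphere_linearIsometryEquiv
    (L : EuclideanSpace ℝ (Fin n) ≃ₗᵢ[ℝ] EuclideanSpace ℝ (Fin n)) :
    ((volume : Measure (EuclideanSpace ℝ (Fin n))).toSphere.map (↑)).map L =
      (volume : Measure (EuclideanSpace ℝ (Fin n))).toSphere.map (↑) := by
  have hN : Measurable fun y : EuclideanSpace ℝ (Fin n) => ‖y‖⁻¹ • y := by fun_prop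
  have hL : Measurable L := L.continuous.measurable
  have hpre : L ⁻¹' (ball (0 : EuclideanSpace ℝ (Fin n)) 1 \ {0}) = ball 0 1 \ {0} := by
    ext y; simp
  have hmp := L.measurePreserving.restrict_preimage
    (s := ball (0 : EuclideanSpace ℝ (Fin n)) 1 \ {0})
    (measurableSet_ball.diff (measurableSet_singleton _))
  rw [hpre] at hmp
  rw [map_coe_toSphere, Measure.map_smul, Measure.map_map hL hN]
  conv_rhs => rw [← hmp.map_eq, Measure.map_map hN hL]
  congr 2
  funext y
  simp

theorem toSphere_real_univ_pos (hn : 0 < n) :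
    0 < (volume : Measure (EuclideanSpace ℝ (Fin n))).toSphere.real univ := by
  have : Nonempty (Fin n) := ⟨⟨0, hn⟩⟩
  have : NeZero (volume : Measure (EuclideanSpace ℝ (Fin n))).toSphere :=
    ⟨Measure.toSphere_ne_zero _⟩
  exact measureReal_univ_pos

end SphereMeasure

/-! ### The Poisson formula for harmonic functions. -/

section PoissonFormula

variable {n : ℕ} {F : Type*} [NormedAddCommGroup F] [NormedSpace ℝ F]

theorem ballKernel_le {y ζ : EuclideanSpace ℝ (Fin n)} {R : ℝ} (hy : ‖y‖ ≤ R) (hR : R < 1)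
    (hζ : ‖ζ‖ = 1) : ballKernel y ζ ≤
      ((volume : Measure (EuclideanSpace ℝ (Fin n))).toSphere.real univ)⁻¹ * (1 / (1 - R) ^ n) := by
  have h1 : 1 - R ≤ ‖y - ζ‖ := by linarith [one_sub_norm_le_norm_sub (y := y) hζ]
  have h2 : 0 < 1 - R := by linarith
  unfold ballKernel
  gcongr
  nlinarith [norm_nonneg y]

theorem integrable_ballKernel_smul {φ : sphere (0 : EuclideanSpace ℝ (Fin n)) 1 → F}
    (hφ : Integrable φ (volume : Measure (EuclideanSpace ℝ (Fin n))).toSphere)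
    {y : EuclideanSpace ℝ (Fin n)} (hy : ‖y‖ < 1) :
    Integrable (fun ζ : sphere (0 : EuclideanSpace ℝ (Fin n)) 1 => ballKernel y ζ • φ ζ)
      (volume : Measure (EuclideanSpace ℝ (Fin n))).toSphere :=
  (continuous_ballKernel_right hy).integrable_smul_of_compactSpace hφ

theorem integrable_ballKernel {y : EuclideanSpace ℝ (Fin n)} (hy : ‖y‖ < 1) :
    Integrable (fun ζ : sphere (0 : EuclideanSpace ℝ (Fin n)) 1 => ballKernel y ζ)
      (volume : Measure (EuclideanSpace ℝ (Fin n))).toSphere := by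
  simpa using integrable_ballKernel_smul (integrable_const (1 : ℝ)) hy

theorem continuousOn_ballPoissonIntegral {φ : sphere (0 : EuclideanSpace ℝ (Fin n)) 1 → F}
    (hφ : Integrable φ (volume : Measure (EuclideanSpace ℝ (Fin n))).toSphere)
    {R : ℝ} (hR : R < 1) : ContinuousOn (ballPoissonIntegral φ) (closedBall 0 R) := by
  unfold ballPoissonIntegral
  refine continuousOn_of_dominated (bound := fun ζ =>
    ((volume : Measure (EuclideanSpace ℝ (Fin n))).toSphere.real univ)⁻¹ * (1 / (1 - R) ^ n) * ‖φ ζ‖)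
    ?_ ?_ (hφ.norm.const_mul _) ?_
  · intro y hy
    have hy' : ‖y‖ ≤ R := by simpa using hy
    exact (integrable_ballKernel_smul hφ (hy'.trans_lt hR)).aestronglyMeasurable
  · intro y hy
    have hy' : ‖y‖ ≤ R := by simpa using hy
    refine Eventually.of_forall fun ζ => ?_
    rw [norm_smul, Real.norm_of_nonneg (ballKernel_nonneg (hy'.trans hR.le))]
    gcongr
    exact ballKernel_le hy' hR (norm_eq_of_mem_sphere ζ)
  · refine Eventually.of_forall fun ζ => ?_
    refine ContinuousOn.smul ?_ continuousOn_const
    unfold ballKernel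
    refine continuousOn_const.mul (ContinuousOn.div (by fun_prop) (by fun_prop) fun y hy => ?_)
    have hy' : ‖y‖ ≤ R := by simpa using hy
    exact (pow_pos (norm_sub_pos_of_norm_lt_one (hy'.trans_lt hR) (norm_eq_of_mem_sphere ζ)) n).ne'

theorem ballKernel_linearIsometryEquiv
    (L : EuclideanSpace ℝ (Fin n) ≃ₗᵢ[ℝ] EuclideanSpace ℝ (Fin n))
    (y ζ : EuclideanSpace ℝ (Fin n)) : ballKernel (L y) (L ζ) = ballKernel y ζ := by
  simp [ballKernel, ← map_sub]

/-- As a function of y the integral is harmonic and rotation invariant, hence constant on the sphere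
through y. The maximum principle for it and its negative makes it equal to its value at 0, which is
1 by the normalization. -/
theorem integral_ballKernel (hn : 0 < n) {y : EuclideanSpace ℝ (Fin n)} (hy : ‖y‖ < 1) :
    ∫ ζ : sphere (0 : EuclideanSpace ℝ (Fin n)) 1, ballKernel y ζ
      ∂(volume : Measure (EuclideanSpace ℝ (Fin n))).toSphere = 1 := by
  set v : EuclideanSpace ℝ (Fin n) → ℝ := ballPoissonIntegral
    (fun _ : sphere (0 : EuclideanSpace ℝ (Fin n)) 1 => (1 : ℝ)) with hv
  have hvk : ∀ z, v z = ∫ ζ : sphere (0 : EuclideanSpace ℝ (Fin n)) 1, ballKernel z ζ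
      ∂(volume : Measure (EuclideanSpace ℝ (Fin n))).toSphere := fun z => by
    simp [hv, ballPoissonIntegral]
  have hvm : ∀ z, v z = ∫ ζ, ballKernel z ζ
      ∂((volume : Measure (EuclideanSpace ℝ (Fin n))).toSphere.map (↑)) := fun z => by
    rw [hvk, (MeasurableEmbedding.subtype_coe isClosed_sphere.measurableSet).integral_map]
  have hinv : ∀ z w : EuclideanSpace ℝ (Fin n), ‖z‖ = ‖w‖ → v z = v w := by
    intro z w hzw
    -- The reflection in the hyperplane orthogonal to z - w exchanges two points of equal norm.
    set L : EuclideanSpace ℝ (Fin n) ≃ₗᵢ[ℝ] EuclideanSpace ℝ (Fin n) :=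
      (Submodule.span ℝ {z - w})ᗮ.reflection
    have hL : L z = w := Submodule.reflection_sub hzw
    rw [hvm, hvm, ← hL]
    conv_rhs => rw [← map_coe_toSphere_linearIsometryEquiv L]
    have hemb : MeasurableEmbedding L := L.toHomeomorph.measurableEmbedding
    rw [hemb.integral_map]
    simp [ballKernel_linearIsometryEquiv]
  have hint := integrable_const (μ := (volume : Measure (EuclideanSpace ℝ (Fin n))).toSphere) (1 : ℝ)
  have hc := continuousOn_ballPoissonIntegral hint hy
  have hlap : ∀ z ∈ ball (0 : EuclideanSpace ℝ (Fin n)) ‖y‖, HasLineLaplacian v z 0 := fun z hz =>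
    hasLineLaplacian_ballPoissonIntegral hint ((mem_ball_zero_iff.1 hz).trans hy)
  have h0 : (0 : EuclideanSpace ℝ (Fin n)) ∈ closedBall (0 : EuclideanSpace ℝ (Fin n)) ‖y‖ := by
    simp
  have h1 : v 0 ≤ v y := HasLineLaplacian.le_of_le_on_sphere hn hc hlap
    (fun z hz => (hinv z y (by simpa using hz)).le) h0
  have h2 : -v 0 ≤ -v y := HasLineLaplacian.le_of_le_on_sphere (u := fun z => -v z) hn hc.neg
    (fun z hz => by simpa using (hlap z hz).clm_comp (-(ContinuousLinearMap.id ℝ ℝ)))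
    (fun z hz => (neg_le_neg (hinv z y (by simpa using hz)).ge)) h0
  have h3 : v 0 = 1 := by
    have : ∀ ζ : sphere (0 : EuclideanSpace ℝ (Fin n)) 1,
        ballKernel (0 : EuclideanSpace ℝ (Fin n)) (ζ : EuclideanSpace ℝ (Fin n))
          = ((volume : Measure (EuclideanSpace ℝ (Fin n))).toSphere.real univ)⁻¹ := fun ζ => by
      simp [ballKernel]
    rw [hvk]
    simp_rw [this]
    rw [integral_const, smul_eq_mul, mul_inv_cancel₀ (toSphere_real_univ_pos hn).ne']
  rw [← hvk]
  linarith

/-- The kernel is an approximate identity: near ξ uniform continuity of φ controls the integrand,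
and away from ξ the kernel is O(1 - R), uniformly in ξ. -/
theorem ballPoissonIntegral_tendstoUniformly [CompleteSpace F] (hn : 0 < n)
    {φ : sphere (0 : EuclideanSpace ℝ (Fin n)) 1 → F} (hφ : Continuous φ) {ε : ℝ} (hε : 0 < ε) :
    ∀ᶠ R in 𝓝[<] (1 : ℝ), ∀ ξ : sphere (0 : EuclideanSpace ℝ (Fin n)) 1,
      ‖ballPoissonIntegral φ (R • (ξ : EuclideanSpace ℝ (Fin n))) - φ ξ‖ ≤ ε := by
  obtain ⟨C, hC⟩ := isCompact_univ.exists_bound_of_continuousOn hφ.continuousOn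
  obtain ⟨δ, hδ, hδφ⟩ := Metric.uniformContinuous_iff.1
    (CompactSpace.uniformContinuous_of_continuous hφ) (ε / 2) (half_pos hε)
  set σ := (volume : Measure (EuclideanSpace ℝ (Fin n))).toSphere with hσ
  have hSpos := toSphere_real_univ_pos hn
  have hφi : Integrable φ σ := hφ.integrable_of_hasCompactSupport (HasCompactSupport.of_compactSpace φ)
  -- This is the far contribution: 2(1 - R) bounds 1 - R², δ/2 bounds the distance to Rξ from below,
  -- 2C bounds the oscillation of φ, and the factor 1 is the total mass times its inverse.
  have hlim : Tendsto (fun R : ℝ => 1 * (2 * (1 - R) / (δ / 2) ^ n) * (2 * C)) (𝓝[<] 1) (𝓝 0) := by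
    have : Continuous (fun R : ℝ => 1 * (2 * (1 - R) / (δ / 2) ^ n) * (2 * C)) := by fun_prop
    exact tendsto_nhdsWithin_of_tendsto_nhds (by simpa using this.tendsto 1)
  filter_upwards [hlim.eventually (gt_mem_nhds (half_pos hε)), self_mem_nhdsWithin,
    Ioo_mem_nhdsLT (show max 0 (1 - δ / 2) < 1 by simp [hδ])] with R hR hR1 hRδ ξ
  have hR0 : 0 < R := (le_max_left _ _).trans_lt hRδ.1
  have hRδ' : 1 - δ / 2 < R := (le_max_right _ _).trans_lt hRδ.1
  have hξ : ‖(ξ : EuclideanSpace ℝ (Fin n))‖ = 1 := norm_eq_of_mem_sphere ξ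
  have hnorm : ‖R • (ξ : EuclideanSpace ℝ (Fin n))‖ = R := by
    rw [norm_smul, hξ, mul_one, Real.norm_of_nonneg hR0.le]
  have hlt : ‖R • (ξ : EuclideanSpace ℝ (Fin n))‖ < 1 := by rw [hnorm]; exact hR1
  have hsub : ballPoissonIntegral φ (R • (ξ : EuclideanSpace ℝ (Fin n))) - φ ξ =
      ∫ ζ : sphere (0 : EuclideanSpace ℝ (Fin n)) 1,
        ballKernel (R • (ξ : EuclideanSpace ℝ (Fin n))) ζ • (φ ζ - φ ξ) ∂σ := by
    simp_rw [smul_sub]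
    rw [integral_sub (integrable_ballKernel_smul hφi hlt)
      (integrable_ballKernel_smul (integrable_const _) hlt), integral_smul_const,
      integral_ballKernel hn hlt, one_smul]
    rfl
  rw [hsub]
  have hK := integrable_ballKernel hlt
  calc _ ≤ ∫ ζ : sphere (0 : EuclideanSpace ℝ (Fin n)) 1,
        (ballKernel (R • (ξ : EuclideanSpace ℝ (Fin n))) ζ * (ε / 2) +
          (σ.real univ)⁻¹ * (2 * (1 - R) / (δ / 2) ^ n) * (2 * C)) ∂σ := by
        refine norm_integral_le_of_norm_le ((hK.mul_const _).add (integrable_const _))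
          (Eventually.of_forall fun ζ => ?_)
        have hk0 := ballKernel_nonneg (ζ := (ζ : EuclideanSpace ℝ (Fin n))) hlt.le
        have hC0 : 0 ≤ C := (norm_nonneg _).trans (hC ξ (mem_univ _))
        rw [norm_smul, Real.norm_of_nonneg hk0]
        rcases lt_or_ge (dist ζ ξ) δ with hd | hd
        · have h1 : ‖φ ζ - φ ξ‖ ≤ ε / 2 := by rw [← dist_eq_norm]; exact (hδφ hd).le
          have h2 : 0 ≤ (σ.real univ)⁻¹ * (2 * (1 - R) / (δ / 2) ^ n) * (2 * C) := by
            have : 0 ≤ 1 - R := by linarith [show R < 1 from hR1]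
            positivity
          nlinarith
        · have h1 : ‖φ ζ - φ ξ‖ ≤ 2 * C := by
            linarith [norm_sub_le (φ ζ) (φ ξ), hC ζ (mem_univ _), hC ξ (mem_univ _)]
          have h2 : ballKernel (R • (ξ : EuclideanSpace ℝ (Fin n))) ζ ≤
              (σ.real univ)⁻¹ * (2 * (1 - R) / (δ / 2) ^ n) := by
            have h3 : δ / 2 ≤ ‖R • (ξ : EuclideanSpace ℝ (Fin n)) - ζ‖ := by
              have h4 : δ ≤ ‖(ξ : EuclideanSpace ℝ (Fin n)) - ζ‖ := by
                rw [← dist_eq_norm, dist_comm]; exact hd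
              have h5 : ‖(ξ : EuclideanSpace ℝ (Fin n)) - R • (ξ : EuclideanSpace ℝ (Fin n))‖
                  = 1 - R := by
                rw [show (ξ : EuclideanSpace ℝ (Fin n)) - R • (ξ : EuclideanSpace ℝ (Fin n))
                  = (1 - R) • (ξ : EuclideanSpace ℝ (Fin n)) by rw [sub_smul, one_smul], norm_smul,
                  hξ, mul_one, Real.norm_of_nonneg (by linarith [show R < 1 from hR1])]
              have h6 := norm_sub_le_norm_sub_add_norm_sub (ξ : EuclideanSpace ℝ (Fin n))
                (R • (ξ : EuclideanSpace ℝ (Fin n))) ζ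
              linarith
            unfold ballKernel
            rw [hnorm]
            have : R < 1 := hR1
            gcongr
            nlinarith
          have h3 := mul_le_mul h2 h1 (norm_nonneg _) (hk0.trans h2)
          have h4 := mul_nonneg hk0 (half_pos hε).le
          linarith
    _ = ε / 2 + 1 * (2 * (1 - R) / (δ / 2) ^ n) * (2 * C) := by
        rw [integral_add (hK.mul_const _) (integrable_const _), integral_mul_const,
          integral_ballKernel hn hlt, integral_const, smul_eq_mul]
        rw [hσ]
        field_simp
    _ ≤ ε := by linarith

/-- On spheres of radius R close to 1 both u and its Poisson integral are uniformly close to the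
boundary values. The maximum principle on the smaller ball carries the bound for the difference
inside, so the Poisson integral never has to be extended to the closed ball. -/
theorem eq_ballPoissonIntegral_of_continuousOn_closedBall (hn : 0 < n)
    {u : EuclideanSpace ℝ (Fin n) → ℝ} (hc : ContinuousOn u (closedBall 0 1))
    (hu : ∀ y ∈ ball (0 : EuclideanSpace ℝ (Fin n)) 1, HasLineLaplacian u y 0)
    {y : EuclideanSpace ℝ (Fin n)} (hy : ‖y‖ < 1) :
    u y = ballPoissonIntegral (fun ζ : sphere (0 : EuclideanSpace ℝ (Fin n)) 1 => u ζ) y := by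
  set φ : sphere (0 : EuclideanSpace ℝ (Fin n)) 1 → ℝ := fun ζ => u ζ with hφd
  have hφ : Continuous φ := continuousOn_univ.1 (hc.comp continuous_subtype_val.continuousOn
    fun ζ _ => sphere_subset_closedBall ζ.2)
  have hφi : Integrable φ (volume : Measure (EuclideanSpace ℝ (Fin n))).toSphere :=
    hφ.integrable_of_hasCompactSupport (HasCompactSupport.of_compactSpace φ)
  have huc := (isCompact_closedBall (0 : EuclideanSpace ℝ (Fin n)) 1).uniformContinuousOn_of_continuous hc
  have key : ∀ ε : ℝ, 0 < ε → |u y - ballPoissonIntegral φ y| ≤ ε := by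
    intro ε hε
    obtain ⟨δ, hδ, hδu⟩ := Metric.uniformContinuousOn_iff.1 huc (ε / 2) (half_pos hε)
    obtain ⟨R, hRe, hRy, hR1⟩ := ((ballPoissonIntegral_tendstoUniformly hn hφ (half_pos hε)).and
      (Ioo_mem_nhdsLT (show max ‖y‖ (1 - δ) < 1 by simp [hδ, hy]))).exists
    have hyR : ‖y‖ < R := (le_max_left _ _).trans_lt hRy
    have hδR : 1 - δ < R := (le_max_right _ _).trans_lt hRy
    have hR0 : 0 < R := (norm_nonneg y).trans_lt hyR
    have hcw : ContinuousOn (fun z => u z - ballPoissonIntegral φ z) (closedBall 0 R) :=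
      (hc.mono (closedBall_subset_closedBall hR1.le)).sub (continuousOn_ballPoissonIntegral hφi hR1)
    have hlap : ∀ z ∈ ball (0 : EuclideanSpace ℝ (Fin n)) R,
        HasLineLaplacian (fun z => u z - ballPoissonIntegral φ z) z 0 := fun z hz => by
      have hz1 : ‖z‖ < 1 := (mem_ball_zero_iff.1 hz).trans hR1
      simpa using (hu z (mem_ball_zero_iff.2 hz1)).sub
        (hasLineLaplacian_ballPoissonIntegral hφi hz1)
    have hsph : ∀ z ∈ sphere (0 : EuclideanSpace ℝ (Fin n)) R,
        |u z - ballPoissonIntegral φ z| ≤ ε := by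
      intro z hz
      have hzR : ‖z‖ = R := by simpa using hz
      have hξ : ‖R⁻¹ • z‖ = 1 := by
        rw [norm_smul, hzR, Real.norm_of_nonneg (inv_nonneg.2 hR0.le), inv_mul_cancel₀ hR0.ne']
      have hzξ : R • (R⁻¹ • z) = z := by rw [smul_smul, mul_inv_cancel₀ hR0.ne', one_smul]
      have h1 := hRe ⟨R⁻¹ • z, by simpa using hξ⟩
      simp only [hzξ, hφd] at h1
      have h2 : dist (u z) (u (R⁻¹ • z)) < ε / 2 := by
        refine hδu z (by simp [hzR, hR1.le]) _ (by simp [hξ]) ?_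
        rw [dist_eq_norm]
        have : z - R⁻¹ • z = (R - 1) • (R⁻¹ • z) := by
          rw [sub_smul, hzξ, one_smul]
        rw [this, norm_smul, hξ, mul_one, Real.norm_eq_abs, abs_lt]
        constructor <;> linarith
      rw [Real.dist_eq] at h2
      rw [Real.norm_eq_abs] at h1
      rw [abs_le] at h1 ⊢
      rw [abs_lt] at h2
      constructor <;> linarith
    have hyc : y ∈ closedBall (0 : EuclideanSpace ℝ (Fin n)) R := by simp [hyR.le]
    rw [abs_le]
    constructor
    · have := HasLineLaplacian.le_of_le_on_sphere hn hcw.neg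
        (fun z hz => by
          have := (hlap z hz).clm_comp (-(ContinuousLinearMap.id ℝ ℝ))
          rwa [map_zero] at this)
        (fun z hz => neg_le.1 (abs_le.1 (hsph z hz)).1) hyc
      simp only [Pi.neg_apply] at this
      linarith
    · exact HasLineLaplacian.le_of_le_on_sphere hn hcw hlap
        (fun z hz => (abs_le.1 (hsph z hz)).2) hyc
  have h0 : |u y - ballPoissonIntegral φ y| ≤ 0 := le_of_forall_pos_le_add fun ε hε => by
    simpa using key ε hε
  exact sub_eq_zero.1 (abs_eq_zero.1 (le_antisymm h0 (abs_nonneg _)))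

/-- The Poisson formula on a ball of radius `ρ < 1`. -/
theorem eq_ballPoissonIntegral_dilation {F : Type*} [NormedAddCommGroup F]
    [InnerProductSpace ℝ F] [CompleteSpace F] (hn : 0 < n)
    {u : EuclideanSpace ℝ (Fin n) → F} (hc : ContinuousOn u (ball 0 1))
    (hu : ∀ y ∈ ball (0 : EuclideanSpace ℝ (Fin n)) 1, HasLineLaplacian u y 0)
    {ρ : ℝ} (hρ0 : 0 ≤ ρ) (hρ : ρ < 1) {y : EuclideanSpace ℝ (Fin n)} (hy : ‖y‖ < 1) :
    u (ρ • y) = ballPoissonIntegral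
      (fun ζ : sphere (0 : EuclideanSpace ℝ (Fin n)) 1 => u (ρ • (ζ : EuclideanSpace ℝ (Fin n)))) y := by
  have hmem : ∀ z ∈ closedBall (0 : EuclideanSpace ℝ (Fin n)) 1, ρ • z ∈ ball (0 : EuclideanSpace ℝ (Fin n)) 1 := by
    intro z hz
    rw [mem_closedBall_zero_iff] at hz
    rw [mem_ball_zero_iff, norm_smul, Real.norm_of_nonneg hρ0]
    nlinarith [norm_nonneg z]
  have hcρ : ContinuousOn (fun z => u (ρ • z)) (closedBall 0 1) :=
    hc.comp (by fun_prop) hmem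
  have hφ : Continuous fun ζ : sphere (0 : EuclideanSpace ℝ (Fin n)) 1 =>
      u (ρ • (ζ : EuclideanSpace ℝ (Fin n))) :=
    continuousOn_univ.1 (hcρ.comp continuous_subtype_val.continuousOn
      fun ζ _ => sphere_subset_closedBall ζ.2)
  have hφi := hφ.integrable_of_hasCompactSupport (HasCompactSupport.of_compactSpace _)
    (μ := (volume : Measure (EuclideanSpace ℝ (Fin n))).toSphere)
  -- The maximum principle is about real functions; pairing with an arbitrary v reduces the
  -- vector-valued case to it.
  refine ext_inner_left ℝ fun v => ?_
  rw [eq_ballPoissonIntegral_of_continuousOn_closedBall hn (u := fun z => inner ℝ v (u (ρ • z)))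
    (continuousOn_const.inner hcρ) (fun z hz => ?_) hy]
  · unfold ballPoissonIntegral
    rw [← integral_inner (integrable_ballKernel_smul hφi hy)]
    simp [inner_smul_right]
  · simpa using ((hu _ (hmem z (ball_subset_closedBall hz))).comp_smul ρ).clm_comp (innerSL ℝ v)

end PoissonFormula

/-! ### From midpoint log-convexity to the interpolation inequality. -/

section MidpointConvexity

/-- If the maximum were positive, its leftmost point d would be interior. The midpoint inequality at
d ± r then forces the maximum to be attained at d - r too, a contradiction. -/
theorem nonpos_of_midpoint_convex {g : ℝ → ℝ} {a b : ℝ} (hg : ContinuousOn g (Icc a b))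
    (hmid : ∀ s ∈ Icc a b, ∀ t ∈ Icc a b, g ((s + t) / 2) ≤ (g s + g t) / 2)
    (ha : g a ≤ 0) (hb : g b ≤ 0) {c : ℝ} (hc : c ∈ Icc a b) : g c ≤ 0 := by
  obtain ⟨m, hm, hmax⟩ := isCompact_Icc.exists_isMaxOn ⟨c, hc⟩ hg
  by_contra! hpos
  have hgm : 0 < g m := hpos.trans_le (hmax hc)
  set K := Icc a b ∩ g ⁻¹' {g m} with hK
  have hKc : IsCompact K := by
    have : IsClosed K := hg.preimage_isClosed_of_isClosed isClosed_Icc isClosed_singleton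
    exact isCompact_Icc.of_isClosed_subset this inter_subset_left
  obtain ⟨d, hdK, hdmin⟩ := hKc.exists_isLeast ⟨m, hm, rfl⟩
  have hgd : g d = g m := hdK.2
  have had : a < d := lt_of_le_of_ne hdK.1.1 (by rintro rfl; linarith)
  have hdb : d < b := lt_of_le_of_ne hdK.1.2 (by rintro rfl; linarith)
  set r := min (d - a) (b - d) with hr
  have hr0 : 0 < r := lt_min (by linarith) (by linarith)
  have h1 : r ≤ d - a := min_le_left _ _
  have h2 : r ≤ b - d := min_le_right _ _
  have hl : d - r ∈ Icc a b := ⟨by linarith, by linarith⟩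
  have hu : d + r ∈ Icc a b := ⟨by linarith, by linarith⟩
  have h3 := hmid _ hl _ hu
  rw [show (d - r + (d + r)) / 2 = d by ring] at h3
  have h4 : g (d + r) ≤ g m := hmax hu
  have h5 : g (d - r) ≤ g m := hmax hl
  have h6 : d - r ∈ K := ⟨hl, by simp only [mem_preimage, mem_singleton_iff]; linarith⟩
  have := hdmin h6
  linarith

/-- On [δ, t] the function log h lies below the chord with end values log B and log (h t). Since h
is not assumed to extend to 0, only the bound B is used at the left end, and δ tends to 0
afterwards. -/
theorem le_rpow_mul_rpow_of_midpoint_logConvex_of_pos {h : ℝ → ℝ} {B : ℝ}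
    (hc : ContinuousOn h (Ioi 0)) (hpos : ∀ t > 0, 0 < h t) (hB : ∀ t > 0, h t ≤ B)
    (hmid : ∀ s > 0, ∀ t > 0, h ((s + t) / 2) ^ 2 ≤ h s * h t)
    {t α : ℝ} (ht : 0 < t) (hα0 : 0 < α) (hα1 : α ≤ 1) :
    h (α * t) ≤ h t ^ α * B ^ (1 - α) := by
  have hBpos : 0 < B := (hpos t ht).trans_le (hB t ht)
  have hαt : 0 < α * t := mul_pos hα0 ht
  have key : ∀ δ ∈ Ioo 0 (α * t), Real.log (h (α * t)) * (t - δ) ≤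
      (α * t - δ) * Real.log (h t) + (t - α * t) * Real.log B := by
    intro δ hδ
    have hδt : δ < t := hδ.2.trans_le (by nlinarith)
    have hsub : Icc δ t ⊆ Ioi 0 := fun s hs => hδ.1.trans_le hs.1
    have hd : 0 < t - δ := by linarith
    have := nonpos_of_midpoint_convex (a := δ) (b := t) (c := α * t)
      (g := fun s => Real.log (h s) * (t - δ) -
        ((s - δ) * Real.log (h t) + (t - s) * Real.log B)) ?_ ?_ ?_ ?_ ⟨hδ.2.le, by nlinarith⟩
    · linarith
    · refine ContinuousOn.sub (ContinuousOn.mul ?_ continuousOn_const) (by fun_prop)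
      exact (hc.mono hsub).log fun s hs => (hpos s (hsub hs)).ne'
    · intro s hs r hr
      have h1 := hmid s (hsub hs) r (hsub hr)
      have hs0 := hpos s (hsub hs)
      have hr0 := hpos r (hsub hr)
      have hm0 := hpos ((s + r) / 2) (by have := hsub hs; have := hsub hr; simp at *; linarith)
      have h2 := Real.log_le_log (by positivity) h1
      rw [Real.log_pow, Real.log_mul hs0.ne' hr0.ne'] at h2
      push_cast at h2
      nlinarith
    · have := Real.log_le_log (hpos δ hδ.1) (hB δ hδ.1)
      nlinarith
    · nlinarith
  have hlim : Real.log (h (α * t)) * (t - 0) ≤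
      (α * t - 0) * Real.log (h t) + (t - α * t) * Real.log B := by
    have hc1 : Continuous fun δ : ℝ => Real.log (h (α * t)) * (t - δ) := by fun_prop
    have hc2 : Continuous fun δ : ℝ => (α * t - δ) * Real.log (h t) + (t - α * t) * Real.log B := by
      fun_prop
    refine le_of_tendsto_of_tendsto (b := 𝓝[>] (0 : ℝ))
      ((hc1.tendsto 0).mono_left nhdsWithin_le_nhds)
      ((hc2.tendsto 0).mono_left nhdsWithin_le_nhds) ?_
    filter_upwards [Ioo_mem_nhdsGT hαt] with δ hδ using key δ hδ
  have h3 : Real.log (h (α * t)) ≤ α * Real.log (h t) + (1 - α) * Real.log B := by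
    refine le_of_mul_le_mul_right ?_ ht
    linarith
  have h4 := hpos t ht
  rw [← Real.log_le_log_iff (hpos _ hαt) (by positivity),
    Real.log_mul (by positivity) (by positivity), Real.log_rpow h4, Real.log_rpow hBpos]
  exact h3

/-- Zeros of h are removed by adding ε; the inequality of arithmetic and geometric means shows that
h + ε keeps the midpoint inequality. -/
theorem le_rpow_mul_rpow_of_midpoint_logConvex {h : ℝ → ℝ} {B : ℝ}
    (hc : ContinuousOn h (Ioi 0)) (hpos : ∀ t > 0, 0 ≤ h t) (hB : ∀ t > 0, h t ≤ B)
    (hmid : ∀ s > 0, ∀ t > 0, h ((s + t) / 2) ^ 2 ≤ h s * h t)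
    {t α : ℝ} (ht : 0 < t) (hα0 : 0 < α) (hα1 : α ≤ 1) :
    h (α * t) ≤ h t ^ α * B ^ (1 - α) := by
  have key : ∀ ε > 0, h (α * t) + ε ≤ (h t + ε) ^ α * (B + ε) ^ (1 - α) := by
    intro ε hε
    refine le_rpow_mul_rpow_of_midpoint_logConvex_of_pos (h := fun s => h s + ε)
      (hc.add continuousOn_const) (fun s hs => by linarith [hpos s hs])
      (fun s hs => by linarith [hB s hs]) (fun s hs r hr => ?_) ht hα0 hα1
    have h1 := hmid s hs r hr
    have hs0 := hpos s hs
    have hr0 := hpos r hr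
    have h2 : h ((s + r) / 2) ≤ (h s + h r) / 2 := by
      refine abs_le_of_sq_le_sq' ?_ (by linarith) |>.2
      nlinarith [sq_nonneg (h s - h r)]
    nlinarith
  have hc1 : Continuous fun ε : ℝ => h (α * t) + ε := by fun_prop
  have hc2 : Continuous fun ε : ℝ => (h t + ε) ^ α * (B + ε) ^ (1 - α) :=
    ((continuous_const.add continuous_id).rpow_const fun _ => Or.inr hα0.le).mul
      ((continuous_const.add continuous_id).rpow_const fun _ => Or.inr (by linarith))
  have := le_of_tendsto_of_tendsto (b := 𝓝[>] (0 : ℝ))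
      ((hc1.tendsto 0).mono_left nhdsWithin_le_nhds)
      ((hc2.tendsto 0).mono_left nhdsWithin_le_nhds)
      (by filter_upwards [self_mem_nhdsWithin] with ε hε using key ε hε)
  simpa using this

end MidpointConvexity

/-! ### The self-adjoint Poisson semigroup and the concentric three-spheres inequality. -/

section PoissonSemigroup

variable {n : ℕ} {F : Type*} [NormedAddCommGroup F] [InnerProductSpace ℝ F] [CompleteSpace F]
  {φ ψ : sphere (0 : EuclideanSpace ℝ (Fin n)) 1 → F} {R S : ℝ}

/-- The Poisson integral on the sphere of radius `R`, as a function on the unit sphere. -/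
noncomputable def poissonDilation (R : ℝ) (φ : sphere (0 : EuclideanSpace ℝ (Fin n)) 1 → F)
    (ζ : sphere (0 : EuclideanSpace ℝ (Fin n)) 1) : F :=
  ballPoissonIntegral φ (R • (ζ : EuclideanSpace ℝ (Fin n)))

theorem norm_smul_sphere (hR : 0 ≤ R) (ζ : sphere (0 : EuclideanSpace ℝ (Fin n)) 1) :
    ‖R • (ζ : EuclideanSpace ℝ (Fin n))‖ = R := by
  rw [norm_smul, norm_eq_of_mem_sphere ζ, mul_one, Real.norm_of_nonneg hR]

/-- For unit vectors |Rζ - η| = |Rη - ζ|. This symmetry makes the Poisson operators self-adjoint. -/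
theorem ballKernel_smul_comm (hR : 0 ≤ R) (ζ η : sphere (0 : EuclideanSpace ℝ (Fin n)) 1) :
    ballKernel (R • (ζ : EuclideanSpace ℝ (Fin n))) η
      = ballKernel (R • (η : EuclideanSpace ℝ (Fin n))) ζ := by
  have h : ‖R • (ζ : EuclideanSpace ℝ (Fin n)) - η‖ = ‖R • (η : EuclideanSpace ℝ (Fin n)) - ζ‖ := by
    rw [← sq_eq_sq₀ (norm_nonneg _) (norm_nonneg _), norm_sub_sq_real, norm_sub_sq_real,
      norm_smul_sphere hR, norm_smul_sphere hR, inner_smul_left, inner_smul_left,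
      real_inner_comm, norm_eq_of_mem_sphere, norm_eq_of_mem_sphere]
  rw [ballKernel, ballKernel, h, norm_smul_sphere hR, norm_smul_sphere hR]

omit [CompleteSpace F] in
theorem continuousOn_ball_ballPoissonIntegral
    (hφ : Integrable φ (volume : Measure (EuclideanSpace ℝ (Fin n))).toSphere) :
    ContinuousOn (ballPoissonIntegral φ) (ball 0 1) := by
  intro y hy
  rw [mem_ball_zero_iff] at hy
  obtain ⟨R, hyR, hR⟩ := exists_between hy
  refine ((continuousOn_ballPoissonIntegral hφ hR).continuousAt ?_).continuousWithinAt
  exact mem_of_superset (isOpen_ball.mem_nhds (mem_ball_zero_iff.2 hyR)) ball_subset_closedBall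

omit [CompleteSpace F] in
theorem continuous_poissonDilation
    (hφ : Integrable φ (volume : Measure (EuclideanSpace ℝ (Fin n))).toSphere)
    (hR : 0 ≤ R) (hR1 : R < 1) : Continuous (poissonDilation R φ) :=
  continuousOn_univ.1 ((continuousOn_ball_ballPoissonIntegral hφ).comp
    (Continuous.continuousOn (by fun_prop)) fun ζ _ => by
      rw [mem_ball_zero_iff, norm_smul_sphere hR]; exact hR1)

theorem Continuous.integrable_toSphere {G : Type*} [NormedAddCommGroup G]
    {f : sphere (0 : EuclideanSpace ℝ (Fin n)) 1 → G} (hf : Continuous f) :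
    Integrable f (volume : Measure (EuclideanSpace ℝ (Fin n))).toSphere :=
  hf.integrable_of_hasCompactSupport (HasCompactSupport.of_compactSpace f)

theorem Continuous.memLp_toSphere {G : Type*} [NormedAddCommGroup G]
    {f : sphere (0 : EuclideanSpace ℝ (Fin n)) 1 → G} (hf : Continuous f) (p : ENNReal) :
    MemLp f p (volume : Measure (EuclideanSpace ℝ (Fin n))).toSphere :=
  hf.memLp_of_hasCompactSupport (HasCompactSupport.of_compactSpace f)

/-- The semigroup law is the Poisson formula on the ball of radius S, applied to the Poisson
integral of φ. -/
theorem poissonDilation_poissonDilation (hn : 0 < n)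
    (hφ : Integrable φ (volume : Measure (EuclideanSpace ℝ (Fin n))).toSphere)
    (hR : 0 ≤ R) (hR1 : R < 1) (hS : 0 ≤ S) (hS1 : S < 1) :
    poissonDilation R (poissonDilation S φ) = poissonDilation (S * R) φ := by
  funext ζ
  have h := eq_ballPoissonIntegral_dilation hn (continuousOn_ball_ballPoissonIntegral hφ)
    (fun y hy => hasLineLaplacian_ballPoissonIntegral hφ (mem_ball_zero_iff.1 hy)) hS hS1
    (y := R • (ζ : EuclideanSpace ℝ (Fin n))) (by rw [norm_smul_sphere hR]; exact hR1)
  rw [smul_smul] at h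
  exact h.symm

theorem continuous_ballKernel_smul (hR : 0 ≤ R) (hR1 : R < 1) :
    Continuous fun p : sphere (0 : EuclideanSpace ℝ (Fin n)) 1 ×
      sphere (0 : EuclideanSpace ℝ (Fin n)) 1 =>
        ballKernel (R • (p.1 : EuclideanSpace ℝ (Fin n))) p.2 := by
  unfold ballKernel
  refine continuous_const.mul (Continuous.div (by fun_prop) (by fun_prop) fun p => ?_)
  exact (pow_pos (norm_sub_pos_of_norm_lt_one (by rw [norm_smul_sphere hR]; exact hR1)
    (norm_eq_of_mem_sphere p.2)) n).ne'

omit [CompleteSpace F] in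
theorem integrable_ballKernel_mul_inner
    (hφ : Integrable φ (volume : Measure (EuclideanSpace ℝ (Fin n))).toSphere)
    (hψ : Integrable ψ (volume : Measure (EuclideanSpace ℝ (Fin n))).toSphere)
    (hR : 0 ≤ R) (hR1 : R < 1) :
    Integrable (fun p : sphere (0 : EuclideanSpace ℝ (Fin n)) 1 ×
      sphere (0 : EuclideanSpace ℝ (Fin n)) 1 =>
        ballKernel (R • (p.1 : EuclideanSpace ℝ (Fin n))) p.2 * inner ℝ (φ p.2) (ψ p.1))
      ((volume : Measure (EuclideanSpace ℝ (Fin n))).toSphere.prod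
        (volume : Measure (EuclideanSpace ℝ (Fin n))).toSphere) := by
  refine (continuous_ballKernel_smul hR hR1).integrable_smul_of_compactSpace ?_
  refine (hψ.norm.mul_prod hφ.norm).mono' ?_ (Eventually.of_forall fun p => ?_)
  · exact hφ.1.comp_snd.inner hψ.1.comp_fst
  · rw [mul_comm]
    exact norm_inner_le_norm _ _

/-- Fubini's theorem and the symmetry of the kernel. -/
theorem integral_inner_poissonDilation
    (hφ : Integrable φ (volume : Measure (EuclideanSpace ℝ (Fin n))).toSphere)
    (hψ : Integrable ψ (volume : Measure (EuclideanSpace ℝ (Fin n))).toSphere)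
    (hR : 0 ≤ R) (hR1 : R < 1) :
    ∫ ζ, inner ℝ (poissonDilation R φ ζ) (ψ ζ)
      ∂(volume : Measure (EuclideanSpace ℝ (Fin n))).toSphere =
    ∫ ζ, inner ℝ (φ ζ) (poissonDilation R ψ ζ)
      ∂(volume : Measure (EuclideanSpace ℝ (Fin n))).toSphere := by
  have hlt : ∀ ζ : sphere (0 : EuclideanSpace ℝ (Fin n)) 1,
      ‖R • (ζ : EuclideanSpace ℝ (Fin n))‖ < 1 := fun ζ => by rw [norm_smul_sphere hR]; exact hR1
  have h1 : ∀ ζ, inner ℝ (poissonDilation R φ ζ) (ψ ζ) =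
      ∫ η : sphere (0 : EuclideanSpace ℝ (Fin n)) 1,
        ballKernel (R • (ζ : EuclideanSpace ℝ (Fin n))) η * inner ℝ (φ η) (ψ ζ)
        ∂(volume : Measure (EuclideanSpace ℝ (Fin n))).toSphere := by
    intro ζ
    rw [real_inner_comm, poissonDilation, ballPoissonIntegral,
      ← integral_inner (integrable_ballKernel_smul hφ (hlt ζ))]
    refine integral_congr_ae (Eventually.of_forall fun η => ?_)
    simp only
    rw [inner_smul_right, real_inner_comm]
  have h2 : ∀ η, inner ℝ (φ η) (poissonDilation R ψ η) =
      ∫ ζ : sphere (0 : EuclideanSpace ℝ (Fin n)) 1,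
        ballKernel (R • (ζ : EuclideanSpace ℝ (Fin n))) η * inner ℝ (φ η) (ψ ζ)
        ∂(volume : Measure (EuclideanSpace ℝ (Fin n))).toSphere := by
    intro η
    rw [poissonDilation, ballPoissonIntegral,
      ← integral_inner (integrable_ballKernel_smul hψ (hlt η))]
    refine integral_congr_ae (Eventually.of_forall fun ζ => ?_)
    simp only
    rw [inner_smul_right, ballKernel_smul_comm hR]
  simp_rw [h1, h2]
  exact integral_integral_swap (integrable_ballKernel_mul_inner hφ hψ hR hR1)

theorem integral_poissonDilation (hn : 0 < n) {g : sphere (0 : EuclideanSpace ℝ (Fin n)) 1 → ℝ}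
    (hg : Integrable g (volume : Measure (EuclideanSpace ℝ (Fin n))).toSphere)
    (hR : 0 ≤ R) (hR1 : R < 1) :
    ∫ ζ, poissonDilation R g ζ ∂(volume : Measure (EuclideanSpace ℝ (Fin n))).toSphere =
    ∫ ζ, g ζ ∂(volume : Measure (EuclideanSpace ℝ (Fin n))).toSphere := by
  have h := integral_inner_poissonDilation hg (integrable_const (1 : ℝ)) hR hR1
  have h1 : ∀ ζ : sphere (0 : EuclideanSpace ℝ (Fin n)) 1,
      poissonDilation R (fun _ : sphere (0 : EuclideanSpace ℝ (Fin n)) 1 => (1 : ℝ)) ζ = 1 := by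
    intro ζ
    have := integral_ballKernel hn (y := R • (ζ : EuclideanSpace ℝ (Fin n)))
      (by rw [norm_smul_sphere hR]; exact hR1)
    simpa [poissonDilation, ballPoissonIntegral] using this
  simpa [h1] using h

/-- The kernel is a probability density, and the variance of φ with respect to it is nonnegative. -/
theorem norm_poissonDilation_sq_le (hn : 0 < n)
    (hφ : MemLp φ 2 (volume : Measure (EuclideanSpace ℝ (Fin n))).toSphere)
    (hR : 0 ≤ R) (hR1 : R < 1) (ζ : sphere (0 : EuclideanSpace ℝ (Fin n)) 1) :
    ‖poissonDilation R φ ζ‖ ^ 2 ≤ poissonDilation R (fun η => ‖φ η‖ ^ 2) ζ := by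
  have hlt : ‖R • (ζ : EuclideanSpace ℝ (Fin n))‖ < 1 := by rw [norm_smul_sphere hR]; exact hR1
  have hφi := hφ.integrable (by norm_num)
  have hφ2 : Integrable (fun η => ‖φ η‖ ^ 2)
    (volume : Measure (EuclideanSpace ℝ (Fin n))).toSphere := hφ.norm.integrable_sq
  set c := poissonDilation R φ ζ with hc
  have h0 : 0 ≤ ∫ η : sphere (0 : EuclideanSpace ℝ (Fin n)) 1,
      ballKernel (R • (ζ : EuclideanSpace ℝ (Fin n))) η * ‖φ η - c‖ ^ 2
      ∂(volume : Measure (EuclideanSpace ℝ (Fin n))).toSphere :=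
    integral_nonneg fun η => mul_nonneg (ballKernel_nonneg hlt.le) (sq_nonneg _)
  have hi1 := integrable_ballKernel_smul hφ2 hlt
  have hi2 := (integrable_ballKernel_smul hφi hlt).const_inner (𝕜 := ℝ) c
  have hi3 := (integrable_ballKernel (n := n) hlt)
  have h1 : ∀ η : sphere (0 : EuclideanSpace ℝ (Fin n)) 1,
      ballKernel (R • (ζ : EuclideanSpace ℝ (Fin n))) η * ‖φ η - c‖ ^ 2 =
      ballKernel (R • (ζ : EuclideanSpace ℝ (Fin n))) η • ‖φ η‖ ^ 2
        - 2 * inner ℝ c (ballKernel (R • (ζ : EuclideanSpace ℝ (Fin n))) η • φ η)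
        + ballKernel (R • (ζ : EuclideanSpace ℝ (Fin n))) η * ‖c‖ ^ 2 := by
    intro η
    rw [norm_sub_sq_real, inner_smul_right, smul_eq_mul, real_inner_comm]
    ring
  simp_rw [h1] at h0
  have hi4 : Integrable (fun η : sphere (0 : EuclideanSpace ℝ (Fin n)) 1 =>
      ballKernel (R • (ζ : EuclideanSpace ℝ (Fin n))) η • ‖φ η‖ ^ 2
        - 2 * inner ℝ c (ballKernel (R • (ζ : EuclideanSpace ℝ (Fin n))) η • φ η))
      (volume : Measure (EuclideanSpace ℝ (Fin n))).toSphere := hi1.sub (hi2.const_mul 2)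
  rw [integral_add hi4 (hi3.mul_const _), integral_sub hi1 (hi2.const_mul 2), integral_const_mul, integral_mul_const,
    integral_inner (integrable_ballKernel_smul hφi hlt), integral_ballKernel hn hlt] at h0
  have h2 : ∫ η : sphere (0 : EuclideanSpace ℝ (Fin n)) 1,
      ballKernel (R • (ζ : EuclideanSpace ℝ (Fin n))) η • φ η
      ∂(volume : Measure (EuclideanSpace ℝ (Fin n))).toSphere = c := rfl
  rw [h2, real_inner_self_eq_norm_sq] at h0
  have h3 : poissonDilation R (fun η => ‖φ η‖ ^ 2) ζ = ∫ η : sphere (0 : EuclideanSpace ℝ (Fin n)) 1,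
      ballKernel (R • (ζ : EuclideanSpace ℝ (Fin n))) η • ‖φ η‖ ^ 2
      ∂(volume : Measure (EuclideanSpace ℝ (Fin n))).toSphere := rfl
  rw [h3]
  linarith

theorem integral_norm_poissonDilation_sq_le (hn : 0 < n)
    (hφ : MemLp φ 2 (volume : Measure (EuclideanSpace ℝ (Fin n))).toSphere)
    (hR : 0 ≤ R) (hR1 : R < 1) :
    ∫ ζ, ‖poissonDilation R φ ζ‖ ^ 2 ∂(volume : Measure (EuclideanSpace ℝ (Fin n))).toSphere ≤
    ∫ ζ, ‖φ ζ‖ ^ 2 ∂(volume : Measure (EuclideanSpace ℝ (Fin n))).toSphere := by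
  have hφi := hφ.integrable (by norm_num)
  have hφ2 : Integrable (fun η => ‖φ η‖ ^ 2)
    (volume : Measure (EuclideanSpace ℝ (Fin n))).toSphere := hφ.norm.integrable_sq
  rw [← integral_poissonDilation hn hφ2 hR hR1]
  exact integral_mono
    ((continuous_poissonDilation hφi hR hR1).norm.pow 2).integrable_toSphere
    (continuous_poissonDilation hφ2 hR hR1).integrable_toSphere
    (norm_poissonDilation_sq_le hn hφ hR hR1)

omit [CompleteSpace F] in
theorem integrable_inner_of_memLp_two {X : Type*} [MeasurableSpace X] {μ : Measure X} {f g : X → F}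
    (hf : MemLp f 2 μ) (hg : MemLp g 2 μ) : Integrable (fun x => inner ℝ (f x) (g x)) μ := by
  refine (hf.norm.integrable_sq.add hg.norm.integrable_sq).mono' (hf.1.inner hg.1)
    (Eventually.of_forall fun x => ?_)
  refine (norm_inner_le_norm _ _).trans ?_
  simp only [Pi.add_apply]
  nlinarith [sq_nonneg (‖f x‖ - ‖g x‖), sq_nonneg ‖f x‖, sq_nonneg ‖g x‖]

omit [CompleteSpace F] in
theorem sq_integral_inner_le {X : Type*} [MeasurableSpace X] {μ : Measure X} {f g : X → F}
    (hf : MemLp f 2 μ) (hg : MemLp g 2 μ) :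
    (∫ x, inner ℝ (f x) (g x) ∂μ) ^ 2 ≤ (∫ x, ‖f x‖ ^ 2 ∂μ) * ∫ x, ‖g x‖ ^ 2 ∂μ := by
  have hf2 : Integrable (fun x => ‖f x‖ ^ 2) μ := hf.norm.integrable_sq
  have hg2 : Integrable (fun x => ‖g x‖ ^ 2) μ := hg.norm.integrable_sq
  have hfg := integrable_inner_of_memLp_two hf hg
  have key : ∀ t : ℝ, 0 ≤ (∫ x, ‖f x‖ ^ 2 ∂μ) * (t * t) + (2 * ∫ x, inner ℝ (f x) (g x) ∂μ) * t
      + ∫ x, ‖g x‖ ^ 2 ∂μ := by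
    intro t
    have h0 : 0 ≤ ∫ x, ‖t • f x + g x‖ ^ 2 ∂μ := integral_nonneg fun x => sq_nonneg _
    have h1 : ∀ x, ‖t • f x + g x‖ ^ 2 = (t * t) * ‖f x‖ ^ 2 + (2 * t) * inner ℝ (f x) (g x)
        + ‖g x‖ ^ 2 := fun x => by
      rw [norm_add_sq_real, norm_smul, inner_smul_left, mul_pow, Real.norm_eq_abs, sq_abs]
      simp only [conj_trivial]
      ring
    simp_rw [h1] at h0
    have hs : Integrable (fun x => (t * t) * ‖f x‖ ^ 2 + (2 * t) * inner ℝ (f x) (g x)) μ :=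
      (hf2.const_mul _).add (hfg.const_mul _)
    rw [integral_add hs hg2,
      integral_add (hf2.const_mul _) (hfg.const_mul _), integral_const_mul,
      integral_const_mul] at h0
    linarith
  have := discrim_le_zero key
  rw [discrim] at this
  nlinarith

theorem integral_inner_poissonDilation_poissonDilation (hn : 0 < n)
    (hφ : Integrable φ (volume : Measure (EuclideanSpace ℝ (Fin n))).toSphere)
    (hR : 0 ≤ R) (hR1 : R < 1) (hS : 0 ≤ S) (hS1 : S < 1) :
    ∫ ζ, inner ℝ (poissonDilation R φ ζ) (poissonDilation S φ ζ)
      ∂(volume : Measure (EuclideanSpace ℝ (Fin n))).toSphere =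
    ∫ ζ, inner ℝ (φ ζ) (poissonDilation (R * S) φ ζ)
      ∂(volume : Measure (EuclideanSpace ℝ (Fin n))).toSphere := by
  rw [integral_inner_poissonDilation hφ
    (continuous_poissonDilation hφ hS hS1).integrable_toSphere hR hR1,
    poissonDilation_poissonDilation hn hφ hR hR1 hS hS1, mul_comm S]

theorem integral_norm_poissonDilation_sq (hn : 0 < n)
    (hφ : Integrable φ (volume : Measure (EuclideanSpace ℝ (Fin n))).toSphere)
    (hR : 0 ≤ R) (hR1 : R < 1) :
    ∫ ζ, ‖poissonDilation R φ ζ‖ ^ 2 ∂(volume : Measure (EuclideanSpace ℝ (Fin n))).toSphere =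
    ∫ ζ, inner ℝ (φ ζ) (poissonDilation (R ^ 2) φ ζ)
      ∂(volume : Measure (EuclideanSpace ℝ (Fin n))).toSphere := by
  rw [sq R, ← integral_inner_poissonDilation_poissonDilation hn hφ hR hR1 hR hR1]
  simp

/-- By self-adjointness and the semigroup law the left integral is ⟨φ, P_{RS} φ⟩ = ⟨P_R φ, P_S φ⟩,
to which Cauchy–Schwarz applies. -/
theorem sq_integral_norm_poissonDilation_sq_le (hn : 0 < n)
    (hφ : Integrable φ (volume : Measure (EuclideanSpace ℝ (Fin n))).toSphere)
    (hR : 0 ≤ R) (hR1 : R < 1) (hS : 0 ≤ S) (hS1 : S < 1) {ρ : ℝ} (hρ : 0 ≤ ρ) (hρ1 : ρ < 1)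
    (hRS : ρ ^ 2 = R * S) :
    (∫ ζ, ‖poissonDilation ρ φ ζ‖ ^ 2
        ∂(volume : Measure (EuclideanSpace ℝ (Fin n))).toSphere) ^ 2 ≤
    (∫ ζ, ‖poissonDilation R φ ζ‖ ^ 2 ∂(volume : Measure (EuclideanSpace ℝ (Fin n))).toSphere) *
    ∫ ζ, ‖poissonDilation S φ ζ‖ ^ 2 ∂(volume : Measure (EuclideanSpace ℝ (Fin n))).toSphere := by
  rw [integral_norm_poissonDilation_sq hn hφ hρ hρ1, hRS,
    ← integral_inner_poissonDilation_poissonDilation hn hφ hR hR1 hS hS1]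
  exact sq_integral_inner_le ((continuous_poissonDilation hφ hR hR1).memLp_toSphere 2)
    ((continuous_poissonDilation hφ hS hS1).memLp_toSphere 2)

omit [CompleteSpace F] in
theorem continuousOn_integral_norm_poissonDilation_sq
    (hφ : Integrable φ (volume : Measure (EuclideanSpace ℝ (Fin n))).toSphere) :
    ContinuousOn (fun R => ∫ ζ, ‖poissonDilation R φ ζ‖ ^ 2
      ∂(volume : Measure (EuclideanSpace ℝ (Fin n))).toSphere) (Ico 0 1) := by
  have hc : ContinuousOn (fun p : ℝ × sphere (0 : EuclideanSpace ℝ (Fin n)) 1 =>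
      ‖poissonDilation p.1 φ p.2‖ ^ 2) (Ico 0 1 ×ˢ univ) := by
    refine ContinuousOn.pow (ContinuousOn.norm ?_) 2
    refine (continuousOn_ball_ballPoissonIntegral hφ).comp
      (Continuous.continuousOn (by fun_prop)) fun p hp => ?_
    rw [mem_ball_zero_iff, norm_smul_sphere hp.1.1]
    exact hp.1.2
  refine continuousOn_integral_of_compact_support (k := univ) isCompact_univ hc ?_
  intro p x _ hx
  exact absurd (mem_univ x) hx

/-- Three circles: logarithmic convexity of the square means of a Poisson integral. -/
theorem integral_norm_poissonDilation_sq_le_rpow (hn : 0 < n)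
    (hφ : MemLp φ 2 (volume : Measure (EuclideanSpace ℝ (Fin n))).toSphere)
    (hR : 0 < R) (hR1 : R < 1) {α : ℝ} (hα0 : 0 < α) (hα1 : α ≤ 1) :
    ∫ ζ, ‖poissonDilation (R ^ α) φ ζ‖ ^ 2
        ∂(volume : Measure (EuclideanSpace ℝ (Fin n))).toSphere ≤
    (∫ ζ, ‖poissonDilation R φ ζ‖ ^ 2
        ∂(volume : Measure (EuclideanSpace ℝ (Fin n))).toSphere) ^ α *
    (∫ ζ, ‖φ ζ‖ ^ 2 ∂(volume : Measure (EuclideanSpace ℝ (Fin n))).toSphere) ^ (1 - α) := by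
  have hφi := hφ.integrable (by norm_num)
  set M : ℝ → ℝ := fun R => ∫ ζ, ‖poissonDilation R φ ζ‖ ^ 2
    ∂(volume : Measure (EuclideanSpace ℝ (Fin n))).toSphere with hM
  have hexp : ∀ t > 0, Real.exp (-t) ∈ Ico (0 : ℝ) 1 := fun t ht =>
    ⟨(Real.exp_pos _).le, by rw [Real.exp_lt_one_iff]; linarith⟩
  -- In the variable t = -log R geometric means of radii become midpoints, and R^α corresponds to
  -- αt.
  have h := le_rpow_mul_rpow_of_midpoint_logConvex (h := fun t => M (Real.exp (-t)))
    (B := ∫ ζ, ‖φ ζ‖ ^ 2 ∂(volume : Measure (EuclideanSpace ℝ (Fin n))).toSphere)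
    ((continuousOn_integral_norm_poissonDilation_sq hφi).comp (by fun_prop) hexp)
    (fun t _ => integral_nonneg fun ζ => sq_nonneg _)
    (fun t ht => integral_norm_poissonDilation_sq_le hn hφ (hexp t ht).1 (hexp t ht).2)
    (fun s hs t ht => sq_integral_norm_poissonDilation_sq_le hn hφi (hexp s hs).1 (hexp s hs).2
      (hexp t ht).1 (hexp t ht).2 (Real.exp_pos _).le (hexp _ (by linarith)).2 ?_)
    (t := -Real.log R) (neg_pos.2 (Real.log_neg hR hR1)) hα0 hα1
  · simp only [neg_neg, Real.exp_log hR, mul_neg] at h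
    rwa [mul_comm, ← Real.rpow_def_of_pos hR] at h
  · rw [← Real.exp_add, sq, ← Real.exp_add]
    congr 1
    ring

end PoissonSemigroup

/-! ### Square integrable boundary values of functions with bounded square means. -/

section HardySpace

variable {n : ℕ} {F : Type*} [NormedAddCommGroup F] [InnerProductSpace ℝ F] [CompleteSpace F]

omit [CompleteSpace F] in
theorem integral_norm_sub_sq {X : Type*} [MeasurableSpace X] {μ : Measure X} {f g : X → F}
    (hf : MemLp f 2 μ) (hg : MemLp g 2 μ) :
    ∫ x, ‖f x - g x‖ ^ 2 ∂μ =
      (∫ x, ‖f x‖ ^ 2 ∂μ) - 2 * (∫ x, inner ℝ (f x) (g x) ∂μ) + ∫ x, ‖g x‖ ^ 2 ∂μ := by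
  have hf2 : Integrable (fun x => ‖f x‖ ^ 2) μ := hf.norm.integrable_sq
  have hg2 : Integrable (fun x => ‖g x‖ ^ 2) μ := hg.norm.integrable_sq
  have hfg := integrable_inner_of_memLp_two hf hg
  have hs : Integrable (fun x => ‖f x‖ ^ 2 - 2 * inner ℝ (f x) (g x)) μ :=
    hf2.sub (hfg.const_mul 2)
  simp_rw [norm_sub_sq_real]
  rw [integral_add hs hg2, integral_sub hf2 (hfg.const_mul 2), integral_const_mul]

omit [CompleteSpace F] in
theorem norm_toLp_sq {X : Type*} [MeasurableSpace X] {μ : Measure X} {f : X → F}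
    (hf : MemLp f 2 μ) : ‖hf.toLp f‖ ^ 2 = ∫ x, ‖f x‖ ^ 2 ∂μ := by
  rw [← real_inner_self_eq_norm_sq, L2.inner_def]
  refine integral_congr_ae ?_
  filter_upwards [hf.coeFn_toLp] with x hx
  rw [hx, real_inner_self_eq_norm_sq]

/-- Point values of a Poisson integral are L² pairings, hence pass to L² limits of the boundary
functions. -/
theorem inner_ballPoissonIntegral {φ : sphere (0 : EuclideanSpace ℝ (Fin n)) 1 → F}
    (hφ : MemLp φ 2 (volume : Measure (EuclideanSpace ℝ (Fin n))).toSphere)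
    {y : EuclideanSpace ℝ (Fin n)} (hy : ‖y‖ < 1) (v : F)
    (hv : MemLp (fun ζ : sphere (0 : EuclideanSpace ℝ (Fin n)) 1 => ballKernel y ζ • v) 2
      (volume : Measure (EuclideanSpace ℝ (Fin n))).toSphere) :
    inner ℝ v (ballPoissonIntegral φ y) = inner ℝ (hv.toLp _) (hφ.toLp φ) := by
  rw [L2.inner_def, ballPoissonIntegral, ← integral_inner
    (integrable_ballKernel_smul (hφ.integrable (by norm_num)) hy)]
  refine integral_congr_ae ?_
  filter_upwards [hφ.coeFn_toLp, hv.coeFn_toLp] with ζ h1 h2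
  rw [h1, h2, inner_smul_left, inner_smul_right]
  simp

variable {u : EuclideanSpace ℝ (Fin n) → F}

theorem continuous_comp_smul_sphere {G : Type*} [TopologicalSpace G]
    {u : EuclideanSpace ℝ (Fin n) → G} (hc : ContinuousOn u (ball 0 1)) {ρ : ℝ} (hρ : 0 ≤ ρ)
    (hρ1 : ρ < 1) : Continuous fun ζ : sphere (0 : EuclideanSpace ℝ (Fin n)) 1 =>
      u (ρ • (ζ : EuclideanSpace ℝ (Fin n))) :=
  continuousOn_univ.1 (hc.comp (Continuous.continuousOn (by fun_prop)) fun ζ _ => by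
    rw [mem_ball_zero_iff, norm_smul_sphere hρ]; exact hρ1)

theorem poissonDilation_comp_smul (hn : 0 < n) (hc : ContinuousOn u (ball 0 1))
    (hu : ∀ y ∈ ball (0 : EuclideanSpace ℝ (Fin n)) 1, HasLineLaplacian u y 0)
    {ρ : ℝ} (hρ : 0 ≤ ρ) (hρ1 : ρ < 1) {s : ℝ} (hs : 0 ≤ s) (hs1 : s < 1) :
    poissonDilation s (fun ζ : sphere (0 : EuclideanSpace ℝ (Fin n)) 1 =>
      u (ρ • (ζ : EuclideanSpace ℝ (Fin n)))) = fun ζ : sphere (0 : EuclideanSpace ℝ (Fin n)) 1 =>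
        u ((ρ * s) • (ζ : EuclideanSpace ℝ (Fin n))) := by
  funext ζ
  rw [poissonDilation, ← eq_ballPoissonIntegral_dilation hn hc hu hρ hρ1
    (by rw [norm_smul_sphere hs]; exact hs1), smul_smul]

theorem integral_norm_comp_smul_sq_mono (hn : 0 < n) (hc : ContinuousOn u (ball 0 1))
    (hu : ∀ y ∈ ball (0 : EuclideanSpace ℝ (Fin n)) 1, HasLineLaplacian u y 0)
    {ρ ρ' : ℝ} (hρ : 0 ≤ ρ) (hρρ' : ρ ≤ ρ') (hρ1 : ρ' < 1) :
    ∫ ζ : sphere (0 : EuclideanSpace ℝ (Fin n)) 1, ‖u (ρ • (ζ : EuclideanSpace ℝ (Fin n)))‖ ^ 2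
      ∂(volume : Measure (EuclideanSpace ℝ (Fin n))).toSphere ≤
    ∫ ζ : sphere (0 : EuclideanSpace ℝ (Fin n)) 1, ‖u (ρ' • (ζ : EuclideanSpace ℝ (Fin n)))‖ ^ 2
      ∂(volume : Measure (EuclideanSpace ℝ (Fin n))).toSphere := by
  rcases hρρ'.eq_or_lt with rfl | hlt
  · rfl
  have hρ'0 : 0 < ρ' := hρ.trans_lt hlt
  have hs0 : 0 ≤ ρ / ρ' := by positivity
  have hs1 : ρ / ρ' < 1 := (div_lt_one hρ'0).2 hlt
  have h := integral_norm_poissonDilation_sq_le hn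
    ((continuous_comp_smul_sphere hc hρ'0.le hρ1).memLp_toSphere 2) hs0 hs1
  rwa [poissonDilation_comp_smul hn hc hu hρ'0.le hρ1 hs0 hs1, mul_div_cancel₀ _ hρ'0.ne'] at h

/-- Writing u(ρ·) = P_s u(ρ'·) with s = ρ/ρ', the cross term is ‖P_{√s} u(ρ'·)‖², the square mean at
radius √(ρρ') ≥ ρ, so it is at least the square mean at ρ. Dilations are thus Cauchy in L² once the
means converge, and no weak compactness is needed. -/
theorem integral_norm_comp_smul_sub_sq_le (hn : 0 < n) (hc : ContinuousOn u (ball 0 1))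
    (hu : ∀ y ∈ ball (0 : EuclideanSpace ℝ (Fin n)) 1, HasLineLaplacian u y 0)
    {ρ ρ' : ℝ} (hρ : 0 ≤ ρ) (hρρ' : ρ ≤ ρ') (hρ1 : ρ' < 1) :
    ∫ ζ : sphere (0 : EuclideanSpace ℝ (Fin n)) 1,
      ‖u (ρ' • (ζ : EuclideanSpace ℝ (Fin n))) - u (ρ • (ζ : EuclideanSpace ℝ (Fin n)))‖ ^ 2
      ∂(volume : Measure (EuclideanSpace ℝ (Fin n))).toSphere ≤
    (∫ ζ : sphere (0 : EuclideanSpace ℝ (Fin n)) 1, ‖u (ρ' • (ζ : EuclideanSpace ℝ (Fin n)))‖ ^ 2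
      ∂(volume : Measure (EuclideanSpace ℝ (Fin n))).toSphere) -
    ∫ ζ : sphere (0 : EuclideanSpace ℝ (Fin n)) 1, ‖u (ρ • (ζ : EuclideanSpace ℝ (Fin n)))‖ ^ 2
      ∂(volume : Measure (EuclideanSpace ℝ (Fin n))).toSphere := by
  rcases hρρ'.eq_or_lt with rfl | hlt
  · simp
  have hρ'0 : 0 < ρ' := hρ.trans_lt hlt
  have hs0 : 0 ≤ ρ / ρ' := by positivity
  have hs1 : ρ / ρ' < 1 := (div_lt_one hρ'0).2 hlt
  set r := Real.sqrt (ρ / ρ') with hr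
  have hr0 : 0 ≤ r := Real.sqrt_nonneg _
  have hr2 : r ^ 2 = ρ / ρ' := Real.sq_sqrt hs0
  have hr1 : r < 1 := by nlinarith
  have hc' := continuous_comp_smul_sphere hc hρ'0.le hρ1
  have hcρ := continuous_comp_smul_sphere hc hρ (hlt.trans hρ1)
  have hinner := integral_norm_poissonDilation_sq hn hc'.integrable_toSphere hr0 hr1
  rw [hr2, poissonDilation_comp_smul hn hc hu hρ'0.le hρ1 hs0 hs1,
    poissonDilation_comp_smul hn hc hu hρ'0.le hρ1 hr0 hr1, mul_div_cancel₀ _ hρ'0.ne'] at hinner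
  have hmono := integral_norm_comp_smul_sq_mono hn hc hu hρ (ρ' := ρ' * r)
    (by
      have : ρ' * r ^ 2 = ρ := by rw [hr2]; field_simp
      nlinarith [mul_nonneg hρ'0.le (mul_nonneg hr0 (sub_nonneg.2 hr1.le))]) (by nlinarith)
  rw [hinner] at hmono
  rw [integral_norm_sub_sq (hc'.memLp_toSphere 2) (hcρ.memLp_toSphere 2)]
  linarith

/-- A harmonic function with bounded square means is the Poisson integral of a square integrable
function. -/
theorem exists_eq_ballPoissonIntegral (hn : 0 < n) (hc : ContinuousOn u (ball 0 1))
    (hu : ∀ y ∈ ball (0 : EuclideanSpace ℝ (Fin n)) 1, HasLineLaplacian u y 0) {C : ℝ}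
    (hC : ∀ ρ ∈ Ico (0 : ℝ) 1, ∫ ζ : sphere (0 : EuclideanSpace ℝ (Fin n)) 1,
      ‖u (ρ • (ζ : EuclideanSpace ℝ (Fin n)))‖ ^ 2
        ∂(volume : Measure (EuclideanSpace ℝ (Fin n))).toSphere ≤ C) :
    ∃ φ : sphere (0 : EuclideanSpace ℝ (Fin n)) 1 → F,
      MemLp φ 2 (volume : Measure (EuclideanSpace ℝ (Fin n))).toSphere ∧
      ∀ y : EuclideanSpace ℝ (Fin n), ‖y‖ < 1 → u y = ballPoissonIntegral φ y := by
  set ρ : ℕ → ℝ := fun k => 1 - 1 / ((k : ℝ) + 1) with hρ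
  have hρ0 : ∀ k, 0 ≤ ρ k := fun k => by
    simp only [hρ, sub_nonneg]
    rw [div_le_one (by positivity)]
    linarith [Nat.cast_nonneg (α := ℝ) k]
  have hρ1 : ∀ k, ρ k < 1 := fun k => by
    simp only [hρ]
    have : (0 : ℝ) < 1 / ((k : ℝ) + 1) := by positivity
    linarith
  have hρm : Monotone ρ := fun k l hkl => by
    simp only [hρ]
    have : (k : ℝ) ≤ l := by exact_mod_cast hkl
    gcongr
  have hρt : Tendsto ρ atTop (𝓝 1) := by
    simpa [hρ] using tendsto_one_div_add_atTop_nhds_zero_nat.const_sub (1 : ℝ)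
  set f : ℕ → sphere (0 : EuclideanSpace ℝ (Fin n)) 1 → F := fun k ζ =>
    u (ρ k • (ζ : EuclideanSpace ℝ (Fin n))) with hf
  have hfL : ∀ k, MemLp (f k) 2 (volume : Measure (EuclideanSpace ℝ (Fin n))).toSphere := fun k =>
    (continuous_comp_smul_sphere hc (hρ0 k) (hρ1 k)).memLp_toSphere 2
  set M : ℕ → ℝ := fun k => ∫ ζ, ‖f k ζ‖ ^ 2
    ∂(volume : Measure (EuclideanSpace ℝ (Fin n))).toSphere with hM
  have hMm : Monotone M := fun k l hkl =>
    integral_norm_comp_smul_sq_mono hn hc hu (hρ0 k) (hρm hkl) (hρ1 l)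
  have hMb : BddAbove (range M) := ⟨C, by
    rintro _ ⟨k, rfl⟩
    exact hC (ρ k) ⟨hρ0 k, hρ1 k⟩⟩
  have hMt := (tendsto_atTop_ciSup hMm hMb).cauchySeq
  -- The square means increase and are bounded, and their increments dominate the squared L²
  -- distances.
  have hcau : CauchySeq fun k => (hfL k).toLp (f k) := by
    rw [Metric.cauchySeq_iff'] at hMt ⊢
    intro ε hε
    obtain ⟨N, hN⟩ := hMt (ε ^ 2) (by positivity)
    refine ⟨N, fun k hk => ?_⟩
    rw [dist_eq_norm, ← MemLp.toLp_sub]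
    refine lt_of_pow_lt_pow_left₀ 2 hε.le ?_
    rw [norm_toLp_sq]
    have h1 := integral_norm_comp_smul_sub_sq_le hn hc hu (hρ0 N) (hρm hk) (hρ1 k)
    have h2 := hN k hk
    rw [Real.dist_eq] at h2
    exact h1.trans_lt ((le_abs_self _).trans_lt h2)
  obtain ⟨Φ, hΦ⟩ := cauchySeq_tendsto_of_complete hcau
  refine ⟨Φ, Lp.memLp Φ, fun y hy => ext_inner_left ℝ fun v => ?_⟩
  have hv : MemLp (fun ζ : sphere (0 : EuclideanSpace ℝ (Fin n)) 1 => ballKernel y ζ • v) 2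
      (volume : Measure (EuclideanSpace ℝ (Fin n))).toSphere :=
    ((continuous_ballKernel_right hy).smul continuous_const).memLp_toSphere 2
  rw [inner_ballPoissonIntegral (Lp.memLp Φ) hy v hv, Lp.toLp_coeFn]
  have h1 : Tendsto (fun k => inner ℝ (hv.toLp _) ((hfL k).toLp (f k))) atTop
      (𝓝 (inner ℝ (hv.toLp _) Φ)) := tendsto_const_nhds.inner hΦ
  have h2 : ∀ k, inner ℝ (hv.toLp _) ((hfL k).toLp (f k)) = inner ℝ v (u (ρ k • y)) := fun k => by
    rw [← inner_ballPoissonIntegral (hfL k) hy v hv,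
      eq_ballPoissonIntegral_dilation hn hc hu (hρ0 k) (hρ1 k) hy]
  simp_rw [h2] at h1
  refine tendsto_nhds_unique (tendsto_const_nhds.inner ?_) h1
  have h3 : Tendsto (fun k => ρ k • y) atTop (𝓝 y) := by
    simpa using hρt.smul_const y
  exact ((hc.continuousAt (isOpen_ball.mem_nhds (mem_ball_zero_iff.2 hy))).tendsto).comp h3

end HardySpace

/-! ### Radial limits almost everywhere. -/

section Fatou

variable {n : ℕ} {F : Type*} [NormedAddCommGroup F]

/-- Lebesgue's differentiation theorem on the sphere. -/
theorem ae_forall_setLIntegral_closedBall_le {φ : sphere (0 : EuclideanSpace ℝ (Fin n)) 1 → F}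
    (hφ : Integrable φ (volume : Measure (EuclideanSpace ℝ (Fin n))).toSphere) :
    ∀ᵐ ζ ∂(volume : Measure (EuclideanSpace ℝ (Fin n))).toSphere, ∀ ε : ENNReal, ε ≠ 0 →
      ∃ r₀ > 0, ∀ r ∈ Icc (0 : ℝ) r₀,
        ∫⁻ η in closedBall ζ r, ‖φ η - φ ζ‖ₑ
          ∂(volume : Measure (EuclideanSpace ℝ (Fin n))).toSphere ≤
        ε * (volume : Measure (EuclideanSpace ℝ (Fin n))).toSphere (closedBall ζ r) := by
  have hemb : MeasurableEmbedding
      ((↑) : sphere (0 : EuclideanSpace ℝ (Fin n)) 1 → EuclideanSpace ℝ (Fin n)) :=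
    MeasurableEmbedding.subtype_coe isClosed_sphere.measurableSet
  set σ := (volume : Measure (EuclideanSpace ℝ (Fin n))).toSphere with hσ
  -- The differentiation theorem is applied in ℝⁿ to the image of the surface measure, so φ is
  -- extended by 0 off the sphere.
  set Φ : EuclideanSpace ℝ (Fin n) → F := Function.extend (↑) φ 0 with hΦ
  have hΦφ : ∀ ζ : sphere (0 : EuclideanSpace ℝ (Fin n)) 1, Φ ζ = φ ζ := fun ζ =>
    Subtype.val_injective.extend_apply _ _ _
  have hint : Integrable Φ (σ.map (↑)) := by
    rw [hemb.integrable_map_iff]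
    exact hφ.congr (Eventually.of_forall fun ζ => (hΦφ ζ).symm)
  have hae := (Besicovitch.vitaliFamily (σ.map ((↑) : sphere (0 : EuclideanSpace ℝ (Fin n)) 1 →
    EuclideanSpace ℝ (Fin n)))).ae_tendsto_lintegral_enorm_sub_div hint.locallyIntegrable
  filter_upwards [ae_of_ae_map measurable_subtype_coe.aemeasurable hae] with ζ hζ ε hε
  have h1 := (hζ.comp (Besicovitch.tendsto_filterAt _ (ζ : EuclideanSpace ℝ (Fin n)))).eventually
    (gt_mem_nhds (pos_iff_ne_zero.2 hε))
  obtain ⟨r₀, hr₀, h2⟩ := mem_nhdsGT_iff_exists_Ioc_subset.1 h1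
  refine ⟨r₀, hr₀, fun r hr => ?_⟩
  rcases hr.1.eq_or_lt with h0 | h0
  · rw [← h0, closedBall_zero, Measure.restrict_singleton, lintegral_smul_measure,
      lintegral_dirac]
    simp
  · have h3 : (∫⁻ y in closedBall (ζ : EuclideanSpace ℝ (Fin n)) r, ‖Φ y - Φ ζ‖ₑ ∂(σ.map (↑))) /
        (σ.map (↑)) (closedBall (ζ : EuclideanSpace ℝ (Fin n)) r) < ε := h2 ⟨h0, hr.2⟩
    rw [hemb.restrict_map, hemb.lintegral_map, hemb.map_apply] at h3
    have hpre : ((↑) : sphere (0 : EuclideanSpace ℝ (Fin n)) 1 → EuclideanSpace ℝ (Fin n)) ⁻¹'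
        closedBall (ζ : EuclideanSpace ℝ (Fin n)) r = closedBall ζ r := rfl
    rw [hpre] at h3
    simp only [hΦφ] at h3
    by_cases hz : σ (closedBall ζ r) = 0
    · rw [Measure.restrict_eq_zero.2 hz]; simp
    · exact (ENNReal.div_le_iff hz (measure_ne_top _ _)).1 h3.le

/-- Layer cake: within the ball of radius r₀, a superlevel set of a decreasing continuous radial
function is empty or a closed ball about x, and the hypothesis applies to each such ball. -/
theorem setLIntegral_radial_mul_le {X : Type*} [PseudoMetricSpace X] [MeasurableSpace X]
    [OpensMeasurableSpace X] {μ : Measure X} {g : X → ENNReal} (hg : AEMeasurable g μ) {x : X} {r₀ : ℝ}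
    {ε : ENNReal}
    (hball : ∀ r ∈ Icc (0 : ℝ) r₀, ∫⁻ y in closedBall x r, g y ∂μ ≤ ε * μ (closedBall x r))
    {k : ℝ → ℝ} (hk : Continuous k) (hanti : AntitoneOn k (Ici 0)) (hk0 : ∀ s, 0 ≤ k s) :
    ∫⁻ y in closedBall x r₀, ENNReal.ofReal (k (dist y x)) * g y ∂μ ≤
      ε * ∫⁻ y in closedBall x r₀, ENNReal.ofReal (k (dist y x)) ∂μ := by
  have hmeas : Measurable fun y => k (dist y x) := (hk.comp (continuous_id.dist continuous_const)).measurable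
  have hmeas' : Measurable fun y => ENNReal.ofReal (k (dist y x)) := hmeas.ennreal_ofReal
  have h1 : ∫⁻ y in closedBall x r₀, ENNReal.ofReal (k (dist y x)) * g y ∂μ =
      ∫⁻ y, ENNReal.ofReal (k (dist y x)) ∂((μ.restrict (closedBall x r₀)).withDensity g) := by
    rw [lintegral_withDensity_eq_lintegral_mul₀ hg.restrict hmeas'.aemeasurable]
    simp [mul_comm]
  rw [h1, lintegral_eq_lintegral_meas_le _ (Eventually.of_forall fun y => hk0 _) hmeas.aemeasurable,
    lintegral_eq_lintegral_meas_le _ (Eventually.of_forall fun y => hk0 _) hmeas.aemeasurable]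
  have hanti' : Antitone fun t : ℝ => (μ.restrict (closedBall x r₀)) {a | t ≤ k (dist a x)} :=
    fun s t hst => measure_mono fun a ha => hst.trans ha
  rw [← lintegral_const_mul _ hanti'.measurable]
  refine lintegral_mono fun t => ?_
  have hset : MeasurableSet {a | t ≤ k (dist a x)} := measurableSet_le measurable_const hmeas
  simp only
  rw [withDensity_apply _ hset, Measure.restrict_restrict hset, Measure.restrict_apply hset]
  set K := Icc (0 : ℝ) r₀ ∩ {s | t ≤ k s} with hK
  have hKc : IsCompact K := isCompact_Icc.inter_right (isClosed_le continuous_const hk)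
  rcases K.eq_empty_or_nonempty with hKe | hKn
  · have : {a | t ≤ k (dist a x)} ∩ closedBall x r₀ = ∅ := by
      refine eq_empty_of_forall_notMem fun a ha => ?_
      have : dist a x ∈ K := ⟨⟨dist_nonneg, ha.2⟩, ha.1⟩
      rw [hKe] at this
      exact this
    simp [this]
  · obtain ⟨s, hs, hsmax⟩ := hKc.exists_isGreatest hKn
    have : {a | t ≤ k (dist a x)} ∩ closedBall x r₀ = closedBall x s := by
      ext a
      constructor
      · exact fun ha => hsmax (show dist a x ∈ K from ⟨⟨dist_nonneg, ha.2⟩, ha.1⟩)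
      · intro ha
        have ha' : dist a x ≤ s := ha
        exact ⟨(show t ≤ k s from hs.2).trans (hanti dist_nonneg hs.1.1 ha'), ha'.trans hs.1.2⟩
    rw [this]
    exact hball s hs.1

variable [NormedSpace ℝ F] [CompleteSpace F]

/-- Fatou's theorem: the Poisson integral of an integrable function has radial limits almost
everywhere. -/
theorem ae_tendsto_ballPoissonIntegral (hn : 0 < n)
    {φ : sphere (0 : EuclideanSpace ℝ (Fin n)) 1 → F}
    (hφ : Integrable φ (volume : Measure (EuclideanSpace ℝ (Fin n))).toSphere) :
    ∀ᵐ (ζ : sphere (0 : EuclideanSpace ℝ (Fin n)) 1)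
      ∂(volume : Measure (EuclideanSpace ℝ (Fin n))).toSphere,
      Tendsto (fun ρ : ℝ => ballPoissonIntegral φ (ρ • (ζ : EuclideanSpace ℝ (Fin n))))
        (𝓝[<] 1) (𝓝 (φ ζ)) := by
  filter_upwards [ae_forall_setLIntegral_closedBall_le hφ] with ζ hζ
  set σ := (volume : Measure (EuclideanSpace ℝ (Fin n))).toSphere with hσ
  have hSpos : 0 < σ.real univ := toSphere_real_univ_pos hn
  have hgint : Integrable (fun η => φ η - φ ζ) σ := hφ.sub (integrable_const _)
  have hgm : AEMeasurable (fun η => ‖φ η - φ ζ‖ₑ) σ := hgint.1.enorm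
  have hgfin : ∫⁻ η, ‖φ η - φ ζ‖ₑ ∂σ ≠ ⊤ := hgint.2.ne
  have hζ1 : ‖(ζ : EuclideanSpace ℝ (Fin n))‖ = 1 := norm_eq_of_mem_sphere ζ
  rw [tendsto_iff_edist_tendsto_0, ENNReal.tendsto_nhds_zero]
  intro ε hε
  have hε2 : ε / 2 ≠ 0 := (ENNReal.half_pos hε.ne').ne'
  obtain ⟨r₀, hr₀, hball⟩ := hζ (ε / 2) hε2
  -- Outside the ball of radius r₀ about ζ, and for ρ > 1/2, the distance to ρζ is at least r₀/2;
  -- this bounds the kernel there.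
  have hfar : Tendsto (fun ρ : ℝ => ENNReal.ofReal ((σ.real univ)⁻¹ *
      ((1 - ρ ^ 2) / (r₀ / 2) ^ n)) * ∫⁻ η, ‖φ η - φ ζ‖ₑ ∂σ) (𝓝[<] 1) (𝓝 0) := by
    have hc : Continuous fun ρ : ℝ => (σ.real univ)⁻¹ * ((1 - ρ ^ 2) / (r₀ / 2) ^ n) := by fun_prop
    have h1 : Tendsto (fun ρ : ℝ => ENNReal.ofReal ((σ.real univ)⁻¹ *
      ((1 - ρ ^ 2) / (r₀ / 2) ^ n))) (𝓝[<] 1) (𝓝 0) := by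
      have := (ENNReal.continuous_ofReal.comp hc).tendsto 1
      refine tendsto_nhdsWithin_of_tendsto_nhds ?_
      rw [Function.comp_def] at this
      convert this using 2
      simp
    simpa using ENNReal.Tendsto.mul_const h1 (Or.inr hgfin)
  filter_upwards [hfar.eventually (ge_mem_nhds (pos_iff_ne_zero.2 hε2)),
    Ioo_mem_nhdsLT (show max (1 / 2) (1 - r₀ / 2) < 1 from
      max_lt (by norm_num) (by linarith))] with ρ hρfar hρ
  have hρ2 : 1 / 2 < ρ := (le_max_left _ _).trans_lt hρ.1
  have hρ0 : 0 < ρ := by linarith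
  have hρr : 1 - r₀ / 2 < ρ := (le_max_right _ _).trans_lt hρ.1
  have hρ1 : ρ < 1 := hρ.2
  have hlt : ‖ρ • (ζ : EuclideanSpace ℝ (Fin n))‖ < 1 := by rw [norm_smul_sphere hρ0.le]; exact hρ1
  have h1ρ : 0 < 1 - ρ ^ 2 := by nlinarith
  -- For unit vectors |ρζ - η|² = (1 - ρ)² + ρ|ζ - η|², so the kernel is a decreasing function of
  -- the chordal distance s.
  set k : ℝ → ℝ := fun s => (σ.real univ)⁻¹ *
    ((1 - ρ ^ 2) / Real.sqrt ((1 - ρ) ^ 2 + ρ * s ^ 2) ^ n) with hk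
  have hpos : ∀ s : ℝ, 0 < (1 - ρ) ^ 2 + ρ * s ^ 2 := fun s => by
    have : 0 < 1 - ρ := by linarith
    positivity
  have hkc : Continuous k := by
    refine continuous_const.mul (continuous_const.div (by fun_prop) fun s => ?_)
    exact (pow_pos (Real.sqrt_pos.2 (hpos s)) n).ne'
  have hk0 : ∀ s, 0 ≤ k s := fun s => by simp only [hk]; positivity
  have hanti : AntitoneOn k (Ici 0) := fun s hs t ht hst => by
    have hs' : (0 : ℝ) ≤ s := hs
    have := Real.sqrt_pos.2 (hpos s)
    simp only [hk]
    gcongr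
  have hkd : ∀ η : sphere (0 : EuclideanSpace ℝ (Fin n)) 1,
      ballKernel (ρ • (ζ : EuclideanSpace ℝ (Fin n))) η = k (dist η ζ) := by
    intro η
    have hη1 : ‖(η : EuclideanSpace ℝ (Fin n))‖ = 1 := norm_eq_of_mem_sphere η
    have hd : ‖ρ • (ζ : EuclideanSpace ℝ (Fin n)) - η‖ =
        Real.sqrt ((1 - ρ) ^ 2 + ρ * dist η ζ ^ 2) := by
      rw [← Real.sqrt_sq (norm_nonneg (ρ • (ζ : EuclideanSpace ℝ (Fin n)) - η))]
      congr 1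
      rw [Subtype.dist_eq, dist_eq_norm, norm_sub_sq_real, norm_sub_sq_real,
        inner_smul_left, norm_smul, hζ1, hη1, Real.norm_of_nonneg hρ0.le, real_inner_comm]
      simp only [conj_trivial]
      ring
    simp only [hk]
    rw [ballKernel, hd, norm_smul_sphere hρ0.le]
  have hKint := integrable_ballKernel (n := n) hlt
  have hone : ∫⁻ η : sphere (0 : EuclideanSpace ℝ (Fin n)) 1, ENNReal.ofReal (k (dist η ζ)) ∂σ = 1 := by
    simp_rw [← hkd]
    rw [← ofReal_integral_eq_lintegral_ofReal hKint
      (Eventually.of_forall fun η => ballKernel_nonneg hlt.le), integral_ballKernel hn hlt]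
    simp
  have hsub : ballPoissonIntegral φ (ρ • (ζ : EuclideanSpace ℝ (Fin n))) - φ ζ =
      ∫ η : sphere (0 : EuclideanSpace ℝ (Fin n)) 1,
        ballKernel (ρ • (ζ : EuclideanSpace ℝ (Fin n))) η • (φ η - φ ζ) ∂σ := by
    simp_rw [smul_sub]
    rw [integral_sub (integrable_ballKernel_smul hφ hlt)
      (integrable_ballKernel_smul (integrable_const _) hlt), integral_smul_const,
      integral_ballKernel hn hlt, one_smul]
    rfl
  rw [edist_eq_enorm_sub, hsub]
  calc _ ≤ ∫⁻ η : sphere (0 : EuclideanSpace ℝ (Fin n)) 1,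
        ‖ballKernel (ρ • (ζ : EuclideanSpace ℝ (Fin n))) η • (φ η - φ ζ)‖ₑ ∂σ :=
        enorm_integral_le_lintegral_enorm _
    _ = ∫⁻ η : sphere (0 : EuclideanSpace ℝ (Fin n)) 1,
        ENNReal.ofReal (k (dist η ζ)) * ‖φ η - φ ζ‖ₑ ∂σ := by
        refine lintegral_congr fun η => ?_
        rw [enorm_smul, hkd, Real.enorm_of_nonneg (hk0 _)]
    _ = (∫⁻ η in closedBall ζ r₀, ENNReal.ofReal (k (dist η ζ)) * ‖φ η - φ ζ‖ₑ ∂σ) +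
        ∫⁻ η in (closedBall ζ r₀)ᶜ, ENNReal.ofReal (k (dist η ζ)) * ‖φ η - φ ζ‖ₑ ∂σ :=
        (lintegral_add_compl _ measurableSet_closedBall).symm
    _ ≤ ε / 2 + ε / 2 := by
        gcongr
        · refine (setLIntegral_radial_mul_le hgm hball hkc hanti hk0).trans ?_
          refine (mul_le_mul_right (setLIntegral_le_lintegral _ _) (ε / 2)).trans ?_
          rw [hone, mul_one]
        · refine le_trans ?_ hρfar
          rw [← lintegral_const_mul' _ _ ENNReal.ofReal_ne_top]
          refine (setLIntegral_mono_ae' measurableSet_closedBall.compl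
            (Eventually.of_forall fun η hη => ?_)).trans (setLIntegral_le_lintegral _ _)
          have hd : r₀ < dist η ζ := by simpa using hη
          gcongr
          simp only [hk]
          gcongr
          refine Real.le_sqrt_of_sq_le ?_
          nlinarith [sq_nonneg (1 - ρ)]
    _ = ε := ENNReal.add_halves ε

end Fatou

/-! ### Inversions preserving the unit sphere and their Jacobian on it. -/

section Inversion

variable {n : ℕ} {b : EuclideanSpace ℝ (Fin n)}

/-- The inversion with center `b` that preserves the unit sphere. -/
noncomputable def unitInversion (b y : EuclideanSpace ℝ (Fin n)) : EuclideanSpace ℝ (Fin n) :=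
  EuclideanGeometry.inversion b (Real.sqrt (‖b‖ ^ 2 - 1)) y

theorem sqrt_norm_sq_sub_one_pos (hb : 1 < ‖b‖) : 0 < Real.sqrt (‖b‖ ^ 2 - 1) :=
  Real.sqrt_pos.2 (by nlinarith)

theorem sq_sqrt_norm_sq_sub_one (hb : 1 < ‖b‖) : Real.sqrt (‖b‖ ^ 2 - 1) ^ 2 = ‖b‖ ^ 2 - 1 :=
  Real.sq_sqrt (by nlinarith)

theorem unitInversion_eq (hb : 1 < ‖b‖) (y : EuclideanSpace ℝ (Fin n)) :
    unitInversion b y = ((‖b‖ ^ 2 - 1) / ‖y - b‖ ^ 2) • (y - b) + b := by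
  rw [unitInversion, EuclideanGeometry.inversion, div_pow, sq_sqrt_norm_sq_sub_one hb, dist_eq_norm]
  rfl

theorem unitInversion_unitInversion (hb : 1 < ‖b‖) (y : EuclideanSpace ℝ (Fin n)) :
    unitInversion b (unitInversion b y) = y :=
  EuclideanGeometry.inversion_inversion b (sqrt_norm_sq_sub_one_pos hb).ne' y

theorem norm_sub_pos_of_one_lt_norm (hb : 1 < ‖b‖) {y : EuclideanSpace ℝ (Fin n)} (hy : ‖y‖ ≤ 1) :
    0 < ‖y - b‖ := by
  have := norm_sub_norm_le b y
  rw [norm_sub_rev] at this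
  linarith

/-- The squared radius ‖b‖² - 1 makes the sphere of inversion orthogonal to the unit sphere. The
identity shows that ball and sphere are preserved, and gives the numerator of the transformed
Poisson kernel. -/
theorem one_sub_norm_unitInversion_sq (hb : 1 < ‖b‖) {y : EuclideanSpace ℝ (Fin n)}
    (hy : 0 < ‖y - b‖) : 1 - ‖unitInversion b y‖ ^ 2 =
      (‖b‖ ^ 2 - 1) / ‖y - b‖ ^ 2 * (1 - ‖y‖ ^ 2) := by
  have h1 : ‖y - b‖ ^ 2 = ‖y‖ ^ 2 - 2 * inner ℝ y b + ‖b‖ ^ 2 := norm_sub_sq_real y b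
  have h2 : (‖b‖ ^ 2 - 1) / ‖y - b‖ ^ 2 * ‖y - b‖ ^ 2 = ‖b‖ ^ 2 - 1 := by field_simp
  rw [unitInversion_eq hb, norm_add_sq_real, norm_smul, inner_smul_left, inner_sub_left,
    real_inner_self_eq_norm_sq, mul_pow, Real.norm_eq_abs, sq_abs]
  simp only [conj_trivial]
  generalize (‖b‖ ^ 2 - 1) / ‖y - b‖ ^ 2 = w at *
  rw [h1] at h2 ⊢
  linear_combination (1 - w) * h2

theorem norm_unitInversion_of_norm_eq_one (hb : 1 < ‖b‖) {y : EuclideanSpace ℝ (Fin n)}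
    (hy : ‖y‖ = 1) : ‖unitInversion b y‖ = 1 := by
  have h := one_sub_norm_unitInversion_sq hb (norm_sub_pos_of_one_lt_norm hb hy.le)
  rw [hy] at h
  have : ‖unitInversion b y‖ ^ 2 = 1 := by linarith
  nlinarith [norm_nonneg (unitInversion b y)]

theorem measurable_unitInversion (b : EuclideanSpace ℝ (Fin n)) : Measurable (unitInversion b) := by
  unfold unitInversion
  simp only [EuclideanGeometry.inversion_def]
  simp only [vsub_eq_sub, vadd_eq_add]
  fun_prop

/-- The same reflection occurs in the derivative of the inversion at ζ, so it can be factored out of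
the derivative of `coneInversion`. -/
theorem reflection_eq_unitInversion (hb : 1 < ‖b‖) {ζ : EuclideanSpace ℝ (Fin n)}
    (hζ : ‖ζ‖ = 1) : (Submodule.span ℝ {ζ - b})ᗮ.reflection ζ = unitInversion b ζ := by
  have hpos := norm_sub_pos_of_one_lt_norm hb hζ.le
  rw [Submodule.reflection_orthogonal_apply, Submodule.reflection_singleton_apply,
    unitInversion_eq hb, inner_sub_left, real_inner_self_eq_norm_sq, hζ]
  have h1 : ‖ζ - b‖ ^ 2 = ‖ζ‖ ^ 2 - 2 * inner ℝ ζ b + ‖b‖ ^ 2 := norm_sub_sq_real ζ b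
  have h2 : (‖b‖ ^ 2 - 1) / ‖ζ - b‖ ^ 2 - 1 = -2 * ((1 - inner ℝ ζ b) / ‖ζ - b‖ ^ 2) := by
    field_simp
    rw [h1, hζ]; ring
  have h3 : (‖b‖ ^ 2 - 1) / ‖ζ - b‖ ^ 2 = 1 - 2 * ((1 - inner ℝ ζ b) / ‖ζ - b‖ ^ 2) := by linarith
  rw [h3]
  simp only [RCLike.ofReal_real_eq_id, id, one_pow, real_inner_comm ζ b]
  module

theorem hasFDerivAt_norm {y : EuclideanSpace ℝ (Fin n)} (hy : y ≠ 0) :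
    HasFDerivAt (fun y : EuclideanSpace ℝ (Fin n) => ‖y‖) (‖y‖⁻¹ • innerSL ℝ y) y := by
  have h0 : 0 < ‖y‖ := norm_pos_iff.2 hy
  have h1 := (hasStrictFDerivAt_norm_sq y).hasFDerivAt.sqrt (by positivity)
  simp only [Real.sqrt_sq (norm_nonneg _)] at h1
  refine h1.congr_fderiv ?_
  ext v
  simp
  field_simp

theorem hasFDerivAt_inv_norm_smul {y : EuclideanSpace ℝ (Fin n)} (hy : y ≠ 0) :
    HasFDerivAt (fun y : EuclideanSpace ℝ (Fin n) => ‖y‖⁻¹ • y)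
      (‖y‖⁻¹ • (ContinuousLinearMap.id ℝ (EuclideanSpace ℝ (Fin n)) -
        (innerSL ℝ (‖y‖⁻¹ • y)).smulRight (‖y‖⁻¹ • y))) y := by
  have h0 : 0 < ‖y‖ := norm_pos_iff.2 hy
  have h1 := ((hasDerivAt_inv h0.ne').comp_hasFDerivAt y (hasFDerivAt_norm hy)).smul
    (hasFDerivAt_id (𝕜 := ℝ) y)
  refine h1.congr_fderiv ?_
  ext v
  simp [smul_smul]
  field_simp
  ring

/-- The degree one homogeneous extension of the inversion of the unit sphere. -/
noncomputable def coneInversion (b y : EuclideanSpace ℝ (Fin n)) : EuclideanSpace ℝ (Fin n) :=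
  ‖y‖ • unitInversion b (‖y‖⁻¹ • y)

theorem norm_inv_norm_smul {y : EuclideanSpace ℝ (Fin n)} (hy : y ≠ 0) : ‖‖y‖⁻¹ • y‖ = 1 := by
  have h0 : 0 < ‖y‖ := norm_pos_iff.2 hy
  rw [norm_smul, norm_inv, norm_norm, inv_mul_cancel₀ h0.ne']

theorem norm_coneInversion (hb : 1 < ‖b‖) (y : EuclideanSpace ℝ (Fin n)) :
    ‖coneInversion b y‖ = ‖y‖ := by
  rcases eq_or_ne y 0 with rfl | hy
  · simp [coneInversion]
  · rw [coneInversion, norm_smul, norm_unitInversion_of_norm_eq_one hb (norm_inv_norm_smul hy),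
      norm_norm, mul_one]

theorem inv_norm_smul_coneInversion (hb : 1 < ‖b‖) {y : EuclideanSpace ℝ (Fin n)} (hy : y ≠ 0) :
    ‖coneInversion b y‖⁻¹ • coneInversion b y = unitInversion b (‖y‖⁻¹ • y) := by
  have h0 : 0 < ‖y‖ := norm_pos_iff.2 hy
  rw [norm_coneInversion hb, coneInversion, smul_smul, inv_mul_cancel₀ h0.ne', one_smul]

theorem coneInversion_coneInversion (hb : 1 < ‖b‖) (y : EuclideanSpace ℝ (Fin n)) :
    coneInversion b (coneInversion b y) = y := by
  rcases eq_or_ne y 0 with rfl | hy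
  · simp [coneInversion]
  have h0 : 0 < ‖y‖ := norm_pos_iff.2 hy
  rw [coneInversion, inv_norm_smul_coneInversion hb hy, norm_coneInversion hb,
    unitInversion_unitInversion hb, smul_smul, mul_inv_cancel₀ h0.ne', one_smul]

/-- With ζ = ‖y‖⁻¹ • y, the derivative scales by w = (‖b‖² - 1) / ‖ζ - b‖² on the complement of ζ
and fixes ζ, and is then followed by the reflection of `reflection_eq_unitInversion`. -/
theorem hasFDerivAt_coneInversion (hb : 1 < ‖b‖) {y : EuclideanSpace ℝ (Fin n)} (hy : y ≠ 0) :
    HasFDerivAt (coneInversion b)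
      (((Submodule.span ℝ {‖y‖⁻¹ • y - b})ᗮ.reflection :
          EuclideanSpace ℝ (Fin n) →L[ℝ] EuclideanSpace ℝ (Fin n)) ∘L
        (((‖b‖ ^ 2 - 1) / ‖‖y‖⁻¹ • y - b‖ ^ 2) •
            ContinuousLinearMap.id ℝ (EuclideanSpace ℝ (Fin n)) +
          ((1 - (‖b‖ ^ 2 - 1) / ‖‖y‖⁻¹ • y - b‖ ^ 2) • innerSL ℝ (‖y‖⁻¹ • y)).smulRight
            (‖y‖⁻¹ • y))) y := by
  have h0 : 0 < ‖y‖ := norm_pos_iff.2 hy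
  have hζ := norm_inv_norm_smul hy
  have hne : ‖y‖⁻¹ • y ≠ b := fun h => by rw [h] at hζ; linarith
  have h1 := HasFDerivAt.comp (f := fun y : EuclideanSpace ℝ (Fin n) => ‖y‖⁻¹ • y) y
    (EuclideanGeometry.hasFDerivAt_inversion (R := Real.sqrt (‖b‖ ^ 2 - 1)) hne)
    (hasFDerivAt_inv_norm_smul hy)
  have h2 := (hasFDerivAt_norm hy).smul h1
  refine h2.congr_fderiv ?_
  have h3 := reflection_eq_unitInversion hb hζ
  have h4 : (Real.sqrt (‖b‖ ^ 2 - 1) / dist (‖y‖⁻¹ • y) b) ^ 2 =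
      (‖b‖ ^ 2 - 1) / ‖‖y‖⁻¹ • y - b‖ ^ 2 := by
    rw [div_pow, sq_sqrt_norm_sq_sub_one hb, dist_eq_norm]
  have h5 : innerSL ℝ y = ‖y‖ • innerSL ℝ (‖y‖⁻¹ • y) := by
    rw [← map_smul, smul_smul, mul_inv_cancel₀ h0.ne', one_smul]
  rw [h4, h5]
  ext1 v
  simp only [Function.comp_apply, add_apply, smul_apply,
    ContinuousLinearMap.comp_apply, ContinuousLinearMap.smulRight_apply,
    sub_apply, ContinuousLinearMap.id_apply]
  have h6 : EuclideanGeometry.inversion b (Real.sqrt (‖b‖ ^ 2 - 1)) (‖y‖⁻¹ • y) =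
    (Submodule.span ℝ {‖y‖⁻¹ • y - b})ᗮ.reflection (‖y‖⁻¹ • y) := h3.symm
  rw [h6]
  set w := (‖b‖ ^ 2 - 1) / ‖‖y‖⁻¹ • y - b‖ ^ 2
  set ρ := (Submodule.span ℝ {‖y‖⁻¹ • y - b})ᗮ.reflection
  set t := innerSL ℝ (‖y‖⁻¹ • y) v
  set ζ := ‖y‖⁻¹ • y
  have hcoe : ∀ z, (ρ : EuclideanSpace ℝ (Fin n) →L[ℝ] EuclideanSpace ℝ (Fin n)) z = ρ z :=
    fun z => rfl
  simp only [hcoe, map_add, map_smul, map_sub, smul_eq_mul, smul_sub, smul_smul]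
  have e1 : ‖y‖ * (w * ‖y‖⁻¹) = w := by field_simp
  have e2 : ‖y‖⁻¹ * (‖y‖ * t) = t := by field_simp
  have e3 : ‖y‖ * (w * (‖y‖⁻¹ * t)) = w * t := by field_simp
  simp only [e1, e2, e3]
  module

/-- The second factor has eigenvalue 1 on ζ and w on its orthogonal complement; it is w times a
transvection. A reflection is an involution, so its determinant is ±1. -/
theorem abs_det_coneInversion {ζ : EuclideanSpace ℝ (Fin n)} (hζ : ‖ζ‖ = 1) {w : ℝ} (hw : 0 < w)
    (hn : 0 < n) (K : Submodule ℝ (EuclideanSpace ℝ (Fin n))) :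
    |((K.reflection : EuclideanSpace ℝ (Fin n) →L[ℝ] EuclideanSpace ℝ (Fin n)) ∘L
        (w • ContinuousLinearMap.id ℝ (EuclideanSpace ℝ (Fin n)) +
          ((1 - w) • innerSL ℝ ζ).smulRight ζ)).det| = w ^ (n - 1) := by
  have h1 : |LinearMap.det (K.reflection.toLinearEquiv :
      EuclideanSpace ℝ (Fin n) →ₗ[ℝ] EuclideanSpace ℝ (Fin n))| = 1 := by
    have h : LinearMap.det ((K.reflection.toLinearEquiv :
        EuclideanSpace ℝ (Fin n) →ₗ[ℝ] EuclideanSpace ℝ (Fin n)) ∘ₗ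
          (K.reflection.toLinearEquiv :
            EuclideanSpace ℝ (Fin n) →ₗ[ℝ] EuclideanSpace ℝ (Fin n))) = 1 := by
      rw [← LinearMap.det_id (M := EuclideanSpace ℝ (Fin n)) (A := ℝ)]
      congr 1
      ext1 v
      simp
    rw [LinearMap.det_comp] at h
    have h' : (LinearMap.det (K.reflection.toLinearEquiv :
      EuclideanSpace ℝ (Fin n) →ₗ[ℝ] EuclideanSpace ℝ (Fin n))) ^ 2 = 1 := by rw [sq]; exact h
    rcases mul_self_eq_one_iff.mp ((sq _).symm.trans h') with h | h <;> simp [h]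
  have h2 : LinearMap.det (w • LinearMap.transvection (((1 - w) / w) • (innerSL ℝ ζ).toLinearMap) ζ)
      = w ^ (n - 1) := by
    rw [LinearMap.det_smul, LinearMap.transvection.det, finrank_euclideanSpace_fin]
    obtain ⟨m, rfl⟩ : ∃ m, n = m + 1 := ⟨n - 1, by omega⟩
    simp [hζ]
    field_simp
    ring
  have h3 : ((w • ContinuousLinearMap.id ℝ (EuclideanSpace ℝ (Fin n)) +
      ((1 - w) • innerSL ℝ ζ).smulRight ζ : EuclideanSpace ℝ (Fin n) →L[ℝ] EuclideanSpace ℝ (Fin n)) :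
        EuclideanSpace ℝ (Fin n) →ₗ[ℝ] EuclideanSpace ℝ (Fin n)) =
      w • LinearMap.transvection (((1 - w) / w) • (innerSL ℝ ζ).toLinearMap) ζ := by
    ext1 v
    simp [LinearMap.transvection.apply, smul_smul]
    congr 1
    field_simp
  rw [ContinuousLinearMap.det, ContinuousLinearMap.toLinearMap_comp, LinearMap.det_comp, h3, h2,
    abs_mul, abs_of_pos (pow_pos hw _)]
  exact (congrArg (· * w ^ (n - 1)) h1).trans (one_mul _)

/-- The Jacobian of the inversion of the unit sphere. -/
noncomputable def inversionJacobian (b ζ : EuclideanSpace ℝ (Fin n)) : ℝ :=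
  ((‖b‖ ^ 2 - 1) / ‖ζ - b‖ ^ 2) ^ (n - 1)

theorem measurable_inversionJacobian (b : EuclideanSpace ℝ (Fin n)) :
    Measurable (inversionJacobian b) := by
  unfold inversionJacobian
  fun_prop

/-- Both sides are integrals over the punctured ball via `map_coe_toSphere`. The norm-preserving
`coneInversion` maps that set bijectively to itself, so the change of variables takes place in ℝⁿ.
-/
theorem lintegral_toSphere_eq_lintegral_inversionJacobian_mul (hn : 0 < n) (hb : 1 < ‖b‖)
    {g : EuclideanSpace ℝ (Fin n) → ENNReal} (hg : Measurable g) :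
    ∫⁻ ζ : sphere (0 : EuclideanSpace ℝ (Fin n)) 1, g ζ
        ∂(volume : Measure (EuclideanSpace ℝ (Fin n))).toSphere =
      ∫⁻ ζ : sphere (0 : EuclideanSpace ℝ (Fin n)) 1,
        ENNReal.ofReal (inversionJacobian b ζ) * g (unitInversion b ζ)
          ∂(volume : Measure (EuclideanSpace ℝ (Fin n))).toSphere := by
  have key : ∀ h : EuclideanSpace ℝ (Fin n) → ENNReal, Measurable h →
      ∫⁻ ζ : sphere (0 : EuclideanSpace ℝ (Fin n)) 1, h ζ
        ∂(volume : Measure (EuclideanSpace ℝ (Fin n))).toSphere =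
      (n : ENNReal) * ∫⁻ y in ball (0 : EuclideanSpace ℝ (Fin n)) 1 \ {0}, h (‖y‖⁻¹ • y) := by
    intro h hh
    rw [← lintegral_map hh (measurable_subtype_coe), map_coe_toSphere, lintegral_smul_measure,
      lintegral_map hh (by fun_prop), smul_eq_mul]
  set U := ball (0 : EuclideanSpace ℝ (Fin n)) 1 \ {0} with hU
  have hUm : MeasurableSet U := measurableSet_ball.diff (measurableSet_singleton 0)
  have hmaps : MapsTo (coneInversion b) U U := by
    intro y hy
    simp only [hU, Set.mem_sdiff, mem_ball_zero_iff, mem_singleton_iff] at hy ⊢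
    rw [← norm_eq_zero, norm_coneInversion hb, norm_eq_zero]
    exact hy
  have himage : coneInversion b '' U = U :=
    hmaps.image_subset.antisymm fun y hy => ⟨_, hmaps hy, coneInversion_coneInversion hb y⟩
  have hmI := measurable_unitInversion b
  have hmJ := measurable_inversionJacobian b
  rw [key g hg, key (fun z => ENNReal.ofReal (inversionJacobian b z) * g (unitInversion b z))
    (by fun_prop)]
  congr 1
  conv_lhs => rw [← himage]
  rw [lintegral_image_eq_lintegral_abs_det_fderiv_mul volume hUm
    (fun y hy => (hasFDerivAt_coneInversion hb hy.2).hasFDerivWithinAt)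
    (fun y _ z _ h => by
      rw [← coneInversion_coneInversion hb y, h, coneInversion_coneInversion hb z])]
  refine setLIntegral_congr_fun hUm fun y hy => ?_
  have hζ := norm_inv_norm_smul hy.2
  have hpos := norm_sub_pos_of_one_lt_norm hb hζ.le
  have hw : 0 < (‖b‖ ^ 2 - 1) / ‖‖y‖⁻¹ • y - b‖ ^ 2 := div_pos (by nlinarith) (by positivity)
  rw [abs_det_coneInversion hζ hw hn, inv_norm_smul_coneInversion hb hy.2]
  rfl

/-- The inversion of the unit sphere with center `b`. -/
noncomputable def sphereInversion (hb : 1 < ‖b‖) :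
    sphere (0 : EuclideanSpace ℝ (Fin n)) 1 ≃ₜ sphere (0 : EuclideanSpace ℝ (Fin n)) 1 where
  toFun ζ := ⟨unitInversion b ζ, by
    rw [mem_sphere_zero_iff_norm, norm_unitInversion_of_norm_eq_one hb (norm_eq_of_mem_sphere ζ)]⟩
  invFun ζ := ⟨unitInversion b ζ, by
    rw [mem_sphere_zero_iff_norm, norm_unitInversion_of_norm_eq_one hb (norm_eq_of_mem_sphere ζ)]⟩
  left_inv ζ := Subtype.ext (unitInversion_unitInversion hb _)
  right_inv ζ := Subtype.ext (unitInversion_unitInversion hb _)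
  continuous_toFun := by
    refine Continuous.subtype_mk ?_ _
    simp only [unitInversion_eq hb]
    have : ∀ ζ : sphere (0 : EuclideanSpace ℝ (Fin n)) 1, ‖(ζ : EuclideanSpace ℝ (Fin n)) - b‖ ^ 2 ≠ 0 :=
      fun ζ => (pow_pos (norm_sub_pos_of_one_lt_norm hb (norm_eq_of_mem_sphere ζ).le) 2).ne'
    fun_prop (disch := assumption)
  continuous_invFun := by
    refine Continuous.subtype_mk ?_ _
    simp only [unitInversion_eq hb]
    have : ∀ ζ : sphere (0 : EuclideanSpace ℝ (Fin n)) 1, ‖(ζ : EuclideanSpace ℝ (Fin n)) - b‖ ^ 2 ≠ 0 :=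
      fun ζ => (pow_pos (norm_sub_pos_of_one_lt_norm hb (norm_eq_of_mem_sphere ζ).le) 2).ne'
    fun_prop (disch := assumption)

@[simp] theorem coe_sphereInversion (hb : 1 < ‖b‖) (ζ : sphere (0 : EuclideanSpace ℝ (Fin n)) 1) :
    (sphereInversion hb ζ : EuclideanSpace ℝ (Fin n)) = unitInversion b ζ := rfl

theorem sphereInversion_sphereInversion (hb : 1 < ‖b‖)
    (ζ : sphere (0 : EuclideanSpace ℝ (Fin n)) 1) :
    sphereInversion hb (sphereInversion hb ζ) = ζ :=
  Subtype.ext (unitInversion_unitInversion hb _)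

theorem inversionJacobian_nonneg (hb : 1 < ‖b‖) (ζ : EuclideanSpace ℝ (Fin n)) :
    0 ≤ inversionJacobian b ζ :=
  pow_nonneg (div_nonneg (by nlinarith) (by positivity)) _

theorem map_sphereInversion_toSphere (hn : 0 < n) (hb : 1 < ‖b‖) :
    (volume : Measure (EuclideanSpace ℝ (Fin n))).toSphere.map (sphereInversion hb) =
      (volume : Measure (EuclideanSpace ℝ (Fin n))).toSphere.withDensity
        (fun ζ => ENNReal.ofReal (inversionJacobian b ζ)) := by
  have hs := (sphereInversion hb).continuous.measurable
  have hmI := measurable_unitInversion b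
  have hmJ := measurable_inversionJacobian b
  ext A hA
  obtain ⟨A', hA', rfl⟩ := hA
  rw [withDensity_apply _ (measurable_subtype_coe hA'), Measure.map_apply hs
    (measurable_subtype_coe hA'), ← lintegral_indicator_one (hs (measurable_subtype_coe hA')),
    ← lintegral_indicator (measurable_subtype_coe hA')]
  -- Applied to the indicator composed with the inversion: on the other side the two inversions
  -- cancel and leave the Jacobian as density.
  have h := lintegral_toSphere_eq_lintegral_inversionJacobian_mul hn hb
    (g := fun z => A'.indicator 1 (unitInversion b z))
    ((measurable_one.indicator hA').comp hmI)
  refine Eq.trans ?_ (h.trans ?_)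
  · rfl
  · refine lintegral_congr fun ζ => ?_
    rw [unitInversion_unitInversion hb]
    by_cases hζ : (ζ : EuclideanSpace ℝ (Fin n)) ∈ A'
    · simp [hζ]
    · simp [hζ]

variable {G : Type*} [NormedAddCommGroup G]

theorem integral_comp_sphereInversion [NormedSpace ℝ G] (hn : 0 < n) (hb : 1 < ‖b‖)
    (h : sphere (0 : EuclideanSpace ℝ (Fin n)) 1 → G) :
    ∫ ζ, h (sphereInversion hb ζ) ∂(volume : Measure (EuclideanSpace ℝ (Fin n))).toSphere =
      ∫ ζ : sphere (0 : EuclideanSpace ℝ (Fin n)) 1, inversionJacobian b ζ • h ζ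
        ∂(volume : Measure (EuclideanSpace ℝ (Fin n))).toSphere := by
  have hmJ := measurable_inversionJacobian b
  rw [← (sphereInversion hb).measurableEmbedding.integral_map, map_sphereInversion_toSphere hn hb,
    integral_withDensity_eq_integral_toReal_smul (by fun_prop) (by simp)]
  simp only [ENNReal.toReal_ofReal (inversionJacobian_nonneg hb _)]

theorem integral_inversionJacobian_smul [NormedSpace ℝ G] (hn : 0 < n) (hb : 1 < ‖b‖)
    (h : sphere (0 : EuclideanSpace ℝ (Fin n)) 1 → G) :
    ∫ ζ : sphere (0 : EuclideanSpace ℝ (Fin n)) 1,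
        inversionJacobian b ζ • h (sphereInversion hb ζ)
          ∂(volume : Measure (EuclideanSpace ℝ (Fin n))).toSphere =
      ∫ ζ, h ζ ∂(volume : Measure (EuclideanSpace ℝ (Fin n))).toSphere := by
  rw [← integral_comp_sphereInversion hn hb (fun ζ => h (sphereInversion hb ζ))]
  simp only [sphereInversion_sphereInversion]

/-- The Jacobian is bounded because |ζ - b| ≥ |b| - 1. Hence composition with the inversion
preserves L^p and null sets. -/
theorem map_sphereInversion_le (hn : 0 < n) (hb : 1 < ‖b‖) :
    ∃ C : ENNReal, C ≠ ⊤ ∧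
      (volume : Measure (EuclideanSpace ℝ (Fin n))).toSphere.map (sphereInversion hb) ≤
        C • (volume : Measure (EuclideanSpace ℝ (Fin n))).toSphere := by
  refine ⟨ENNReal.ofReal (((‖b‖ ^ 2 - 1) / (‖b‖ - 1) ^ 2) ^ (n - 1)), ENNReal.ofReal_ne_top, ?_⟩
  rw [map_sphereInversion_toSphere hn hb, ← withDensity_const]
  refine withDensity_mono (ae_of_all _ fun ζ => ENNReal.ofReal_le_ofReal ?_)
  have h1 : ‖b‖ - 1 ≤ ‖(ζ : EuclideanSpace ℝ (Fin n)) - b‖ := by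
    have := norm_sub_norm_le b (ζ : EuclideanSpace ℝ (Fin n))
    rwa [norm_sub_rev, norm_eq_of_mem_sphere] at this
  have h2 : 0 < ‖b‖ - 1 := by linarith
  have h3 : 0 ≤ ‖b‖ ^ 2 - 1 := by nlinarith
  have h4 := norm_sub_pos_of_one_lt_norm hb (norm_eq_of_mem_sphere ζ).le
  unfold inversionJacobian
  gcongr

theorem MeasureTheory.MemLp.comp_sphereInversion (hn : 0 < n) (hb : 1 < ‖b‖)
    {p : ENNReal} {φ : sphere (0 : EuclideanSpace ℝ (Fin n)) 1 → G}
    (hφ : MemLp φ p (volume : Measure (EuclideanSpace ℝ (Fin n))).toSphere) :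
    MemLp (fun ζ => φ (sphereInversion hb ζ)) p
      (volume : Measure (EuclideanSpace ℝ (Fin n))).toSphere := by
  obtain ⟨C, hC, hle⟩ := map_sphereInversion_le hn hb
  exact (sphereInversion hb).measurableEmbedding.memLp_map_measure_iff.1
    ((hφ.smul_measure hC).mono_measure hle)

/-! ### Conformal covariance of the Poisson kernel and the Kelvin transform. -/

section Covariance

variable {a : EuclideanSpace ℝ (Fin n)}

/-- The conformal factor of the inversion `unitInversion a`. -/
noncomputable def inversionFactor (a y : EuclideanSpace ℝ (Fin n)) : ℝ :=
  Real.sqrt (‖a‖ ^ 2 - 1) / ‖y - a‖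

theorem inversionFactor_pos (ha : 1 < ‖a‖) {y : EuclideanSpace ℝ (Fin n)} (hy : ‖y‖ ≤ 1) :
    0 < inversionFactor a y :=
  div_pos (sqrt_norm_sq_sub_one_pos ha) (norm_sub_pos_of_one_lt_norm ha hy)

theorem inversionFactor_sq (ha : 1 < ‖a‖) (y : EuclideanSpace ℝ (Fin n)) :
    inversionFactor a y ^ 2 = (‖a‖ ^ 2 - 1) / ‖y - a‖ ^ 2 := by
  rw [inversionFactor, div_pow, sq_sqrt_norm_sq_sub_one ha]

/-- The exponent 2(n - 1) is split so that one factor is absorbed by the Poisson kernel and the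
other by the Kelvin transform. -/
theorem inversionJacobian_eq (hn : 2 ≤ n) (ha : 1 < ‖a‖) (ζ : EuclideanSpace ℝ (Fin n)) :
    inversionJacobian a ζ = inversionFactor a ζ ^ n * inversionFactor a ζ ^ (n - 2) := by
  rw [inversionJacobian, ← inversionFactor_sq ha, ← pow_mul, ← pow_add]
  congr 1
  omega

theorem norm_unitInversion_sub_unitInversion (ha : 1 < ‖a‖) {y z : EuclideanSpace ℝ (Fin n)}
    (hy : ‖y‖ ≤ 1) (hz : ‖z‖ ≤ 1) : ‖unitInversion a y - unitInversion a z‖ =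
      inversionFactor a y * inversionFactor a z * ‖y - z‖ := by
  have hy' := norm_sub_pos_of_one_lt_norm ha hy
  have hz' := norm_sub_pos_of_one_lt_norm ha hz
  rw [← dist_eq_norm, unitInversion, unitInversion, EuclideanGeometry.dist_inversion_inversion
    (fun h => by simp [h] at hy') (fun h => by simp [h] at hz')]
  simp only [dist_eq_norm, inversionFactor]
  field_simp

/-- Under the inversion 1 - |y|² acquires k(y)² and |y - ζ| acquires k(y) k(ζ), where k is
`inversionFactor`. -/
theorem ballKernel_unitInversion (hn : 2 ≤ n) (ha : 1 < ‖a‖) {y ζ : EuclideanSpace ℝ (Fin n)}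
    (hy : ‖y‖ < 1) (hζ : ‖ζ‖ = 1) :
    inversionFactor a y ^ (n - 2) * (inversionFactor a ζ ^ n *
      ballKernel (unitInversion a y) (unitInversion a ζ)) = ballKernel y ζ := by
  have h1 := inversionFactor_pos ha hy.le
  have h2 := inversionFactor_pos ha hζ.le
  have h3 := norm_sub_pos_of_norm_lt_one hy hζ
  rw [ballKernel, ballKernel, norm_unitInversion_sub_unitInversion ha hy.le hζ.le,
    one_sub_norm_unitInversion_sq ha (norm_sub_pos_of_one_lt_norm ha hy.le),
    ← inversionFactor_sq ha]
  obtain ⟨m, rfl⟩ : ∃ m, n = m + 2 := ⟨n - 2, by omega⟩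
  simp only [Nat.add_sub_cancel, mul_pow]
  field_simp
  ring

variable [NormedSpace ℝ G]

/-- The weighted composition with an inversion of the sphere which corresponds to the Kelvin
transform of harmonic functions. -/
noncomputable def sphereKelvin (ha : 1 < ‖a‖) (φ : sphere (0 : EuclideanSpace ℝ (Fin n)) 1 → G)
    (ζ : sphere (0 : EuclideanSpace ℝ (Fin n)) 1) : G :=
  inversionFactor a ζ ^ (n - 2) • φ (sphereInversion ha ζ)

theorem norm_unitInversion_lt_one (ha : 1 < ‖a‖) {y : EuclideanSpace ℝ (Fin n)} (hy : ‖y‖ < 1) :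
    ‖unitInversion a y‖ < 1 := by
  have h1 := norm_sub_pos_of_one_lt_norm ha hy.le
  have h := one_sub_norm_unitInversion_sq ha h1
  have : 0 < (‖a‖ ^ 2 - 1) / ‖y - a‖ ^ 2 * (1 - ‖y‖ ^ 2) :=
    mul_pos (div_pos (by nlinarith) (by positivity)) (by nlinarith [norm_nonneg y])
  nlinarith [norm_nonneg (unitInversion a y)]

/-- The Kelvin transform commutes with Poisson extension by change of variables on the sphere, so
its harmonicity needs no separate computation. -/
theorem ballPoissonIntegral_sphereKelvin (hn : 2 ≤ n) (ha : 1 < ‖a‖)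
    (φ : sphere (0 : EuclideanSpace ℝ (Fin n)) 1 → G) {y : EuclideanSpace ℝ (Fin n)}
    (hy : ‖y‖ < 1) : ballPoissonIntegral (sphereKelvin ha φ) y =
      inversionFactor a y ^ (n - 2) • ballPoissonIntegral φ (unitInversion a y) := by
  rw [ballPoissonIntegral, ballPoissonIntegral, ← integral_inversionJacobian_smul (by omega) ha
    (fun ζ => ballKernel (unitInversion a y) ζ • φ ζ), ← integral_smul]
  refine integral_congr_ae (ae_of_all _ fun ζ => ?_)
  dsimp only
  rw [sphereKelvin, coe_sphereInversion, inversionJacobian_eq hn ha, smul_smul, smul_smul, smul_smul,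
    ← ballKernel_unitInversion hn ha hy (norm_eq_of_mem_sphere ζ)]
  congr 1
  ring

theorem continuous_inversionFactor (ha : 1 < ‖a‖) : Continuous
    (fun ζ : sphere (0 : EuclideanSpace ℝ (Fin n)) 1 => inversionFactor a ζ) := by
  unfold inversionFactor
  have : ∀ ζ : sphere (0 : EuclideanSpace ℝ (Fin n)) 1, ‖(ζ : EuclideanSpace ℝ (Fin n)) - a‖ ≠ 0 :=
    fun ζ => (norm_sub_pos_of_one_lt_norm ha (norm_eq_of_mem_sphere ζ).le).ne'
  fun_prop (disch := assumption)

theorem MeasureTheory.MemLp.sphereKelvin (hn : 0 < n) (ha : 1 < ‖a‖)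
    {p : ENNReal} {φ : sphere (0 : EuclideanSpace ℝ (Fin n)) 1 → G}
    (hφ : MemLp φ p (volume : Measure (EuclideanSpace ℝ (Fin n))).toSphere) :
    MemLp (sphereKelvin ha φ) p (volume : Measure (EuclideanSpace ℝ (Fin n))).toSphere :=
  (hφ.comp_sphereInversion hn ha).smul
    (((continuous_inversionFactor ha).pow (n - 2)).memLp_toSphere ⊤)

end Covariance

end Inversion

/-! ### The pencil of correlated spheres and estimates for the exponent. -/

section ApollonianParameters

variable {A X r R X' R' : ℝ}

/-- The circles of an Apollonian pencil with center of inversion at distance `A` from the origin are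
the images of the concentric ones with radii `R = (1 - A * X) / r`. -/
theorem apollonian_parameters (hA : 1 < A) (hX : 0 ≤ X) (hX1 : X ≤ 1) (hr : 0 < r)
    (h : A * r ^ 2 = (1 - A * X) * (A - X)) (hR : R = (1 - A * X) / r) :
    0 < R ∧ R ≤ 1 ∧ X = A * (1 - R ^ 2) / (A ^ 2 - R ^ 2) ∧
      r = R * (A ^ 2 - 1) / (A ^ 2 - R ^ 2) := by
  have hAX : 0 < A - X := by linarith
  have h1 : 0 < 1 - A * X := by
    have : 0 < (1 - A * X) * (A - X) := h ▸ by positivity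
    exact pos_of_mul_pos_left this hAX.le
  have hRpos : 0 < R := hR ▸ div_pos h1 hr
  have hRr : R * r = 1 - A * X := by rw [hR]; field_simp
  -- Eliminating r leaves an equation linear in X, which yields the formulas for X and r in terms of
  -- R.
  have hR2 : R ^ 2 * (A - X) = A * (1 - A * X) := by
    have h2 : (1 - A * X) * (R ^ 2 * (A - X)) = (1 - A * X) * (A * (1 - A * X)) := by
      linear_combination (-R ^ 2) * h + A * (R * r + (1 - A * X)) * hRr
    exact mul_left_cancel₀ h1.ne' h2
  have hR1 : R ≤ 1 := by
    have h3 : R ^ 2 ≤ 1 := by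
      by_contra! hlt
      nlinarith [mul_pos (sub_pos.2 hlt) hAX, mul_nonneg hX (by nlinarith : 0 ≤ A ^ 2 - 1)]
    nlinarith
  have hden : 0 < A ^ 2 - R ^ 2 := by nlinarith
  have hXeq : X = A * (1 - R ^ 2) / (A ^ 2 - R ^ 2) := by
    rw [eq_div_iff hden.ne']
    linear_combination hR2
  refine ⟨hRpos, hR1, hXeq, ?_⟩
  have h4 : R * r = R * (R * (A ^ 2 - 1) / (A ^ 2 - R ^ 2)) := by
    rw [hRr, hXeq]
    field_simp
    ring
  exact mul_left_cancel₀ hRpos.ne' h4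

/-- The distance of the center from the origin is strictly decreasing in R. -/
theorem apollonian_radius_le (hA : 1 < A) (hR : 0 < R) (hR1 : R ≤ 1) (hR' : 0 < R')
    (hR1' : R' ≤ 1) (h : A * (1 - R' ^ 2) / (A ^ 2 - R' ^ 2) ≤ A * (1 - R ^ 2) / (A ^ 2 - R ^ 2)) :
    R ≤ R' := by
  rw [div_le_div_iff₀ (by nlinarith) (by nlinarith)] at h
  by_contra! hlt
  nlinarith [mul_pos (mul_pos (by linarith : 0 < A) (by nlinarith : 0 < A ^ 2 - 1))
    (by nlinarith : 0 < R ^ 2 - R' ^ 2)]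

/-- The difference of 1 - X² and R⁻¹r is an explicit nonnegative fraction. Taking logarithms bounds
-log R by the denominator of ω. -/
theorem inv_le_one_sub_sq_div (hA : 1 < A) (hR : 0 < R) (hR1 : R ≤ 1)
    (hX : X = A * (1 - R ^ 2) / (A ^ 2 - R ^ 2)) (hr : r = R * (A ^ 2 - 1) / (A ^ 2 - R ^ 2)) :
    R⁻¹ ≤ (1 - X ^ 2) / r := by
  have hA2 : 0 < A ^ 2 - 1 := by nlinarith
  have hR2 : 0 ≤ 1 - R ^ 2 := by nlinarith
  have hden : 0 < A ^ 2 - R ^ 2 := by linarith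
  have hrpos : 0 < r := hr ▸ by positivity
  rw [le_div_iff₀ hrpos, hr, hX, div_pow]
  have h1 : R⁻¹ * (R * (A ^ 2 - 1) / (A ^ 2 - R ^ 2)) = (A ^ 2 - 1) / (A ^ 2 - R ^ 2) := by
    field_simp
  have h2 : 1 - (A * (1 - R ^ 2)) ^ 2 / (A ^ 2 - R ^ 2) ^ 2 - (A ^ 2 - 1) / (A ^ 2 - R ^ 2) =
      (1 - R ^ 2) * R ^ 2 * (A ^ 2 - 1) / (A ^ 2 - R ^ 2) ^ 2 := by
    field_simp
    ring
  have h3 : 0 ≤ (1 - R ^ 2) * R ^ 2 * (A ^ 2 - 1) / (A ^ 2 - R ^ 2) ^ 2 := by positivity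
  rw [h1]
  linarith

/-- The numerator estimate for ω: 1 - X - r = (A - 1)(1 - R)/(A + R) ≤ (A - 1)/A, then X'²(A - 1)/A
≤ (1 - R'²)/2 ≤ -log R'. -/
theorem sq_mul_one_sub_sub_le_neg_log (hA : 1 < A) (hR : 0 < R) (hR1 : R ≤ 1)
    (hX : X = A * (1 - R ^ 2) / (A ^ 2 - R ^ 2)) (hr : r = R * (A ^ 2 - 1) / (A ^ 2 - R ^ 2))
    (hR' : 0 < R') (hR1' : R' ≤ 1) (hX' : X' = A * (1 - R' ^ 2) / (A ^ 2 - R' ^ 2)) :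
    X' ^ 2 * (1 - X - r) ≤ -Real.log R' := by
  have hA2 : 0 < A ^ 2 - 1 := by nlinarith
  have hR2 : 0 ≤ 1 - R ^ 2 := by nlinarith
  have hR2' : 0 ≤ 1 - R' ^ 2 := by nlinarith
  have hden : 0 < A ^ 2 - R ^ 2 := by linarith
  have hden' : 0 < A ^ 2 - R' ^ 2 := by linarith
  have h1 : 1 - X - r = (A - 1) * (1 - R) / (A + R) := by
    rw [hX, hr, show A ^ 2 - R ^ 2 = (A - R) * (A + R) by ring]
    have : 0 < A - R := by linarith
    field_simp
    ring
  have h2 : (A - 1) * (1 - R) / (A + R) ≤ (A - 1) / A := by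
    rw [div_le_div_iff₀ (by linarith) (by linarith)]
    nlinarith [mul_nonneg (by linarith : 0 ≤ A - 1) (by nlinarith : 0 ≤ R + A * R)]
  have h3 : X' ^ 2 * ((A - 1) / A) ≤ (1 - R' ^ 2) / 2 := by
    have e : X' ^ 2 * ((A - 1) / A) =
        (1 - R' ^ 2) * (A * (A - 1) * (1 - R' ^ 2) / (A ^ 2 - R' ^ 2) ^ 2) := by
      rw [hX']
      field_simp
    rw [e, show (1 - R' ^ 2) / 2 = (1 - R' ^ 2) * (1 / 2) by ring]
    refine mul_le_mul_of_nonneg_left ?_ hR2'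
    rw [div_le_div_iff₀ (by positivity) (by norm_num)]
    nlinarith [sq_nonneg ((A ^ 2 - 1) - (1 - R' ^ 2)),
      mul_nonneg (mul_nonneg (by linarith : 0 ≤ A - 1) (by linarith : 0 ≤ A + 2)) hR2']
  have h4 : Real.log (R' ^ 2) ≤ R' ^ 2 - 1 := Real.log_le_sub_one_of_pos (by positivity)
  rw [Real.log_pow] at h4
  push_cast at h4
  rw [h1]
  nlinarith [mul_le_mul_of_nonneg_left h2 (sq_nonneg X')]

/-- Geometric means of `p ≤ q` decrease in the weight of `p`. -/
theorem rpow_mul_rpow_one_sub_le {p q α β : ℝ} (hp : 0 ≤ p) (hpq : p ≤ q) (hβ : 0 < β)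
    (hβα : β ≤ α) : p ^ α * q ^ (1 - α) ≤ p ^ β * q ^ (1 - β) := by
  rcases hp.eq_or_lt with rfl | hp
  · rw [Real.zero_rpow (hβ.trans_le hβα).ne', Real.zero_rpow hβ.ne']
    simp
  have hq := hp.trans_le hpq
  have h : (p / q) ^ α ≤ (p / q) ^ β :=
    Real.rpow_le_rpow_of_exponent_ge (by positivity) ((div_le_one hq).2 hpq) hβα
  rw [Real.div_rpow hp.le hq.le, Real.div_rpow hp.le hq.le] at h
  rw [Real.rpow_sub hq, Real.rpow_sub hq, Real.rpow_one]
  calc p ^ α * (q / q ^ α) = q * (p ^ α / q ^ α) := by ring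
    _ ≤ q * (p ^ β / q ^ β) := mul_le_mul_of_nonneg_left h hq.le
    _ = p ^ β * (q / q ^ β) := by ring

end ApollonianParameters

/-! ### Existence, uniqueness and equations of the inversion center. -/

section InversionCenter

variable {n : ℕ} {a x x' : EuclideanSpace ℝ (Fin n)} {r r' : ℝ}

/-- The norm of a solves A² - cA + 1 = 0. The hypothesis r < 1 - |x| gives c > 2, so the roots are
real and distinct with product 1, and exactly one exceeds 1. -/
theorem existsUnique_isInversionCenter (hx : x ≠ 0) (hr : 0 < r) (hr1 : r < 1 - ‖x‖) :
    ∃! a : EuclideanSpace ℝ (Fin n), IsInversionCenter x r a := by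
  have hX : 0 < ‖x‖ := norm_pos_iff.2 hx
  set c := (1 + ‖x‖ ^ 2 - r ^ 2) / ‖x‖ with hc
  have hc2 : 2 < c := by
    rw [hc, lt_div_iff₀ hX]
    nlinarith
  have hsq : Real.sqrt (c ^ 2 - 4) ^ 2 = c ^ 2 - 4 := Real.sq_sqrt (by nlinarith)
  set t := Real.sqrt (c ^ 2 - 4) with ht
  have ht0 : 0 ≤ t := Real.sqrt_nonneg _
  clear_value t c
  have hA : 1 < (c + t) / 2 := by linarith
  have hnorm : ‖((c + t) / 2 * ‖x‖⁻¹) • x‖ = (c + t) / 2 := by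
    rw [norm_smul, Real.norm_of_nonneg (by positivity)]
    field_simp
  refine ⟨((c + t) / 2 * ‖x‖⁻¹) • x, ⟨by rwa [hnorm], by rw [hnorm], ?_⟩, ?_⟩
  · rw [hnorm, ← hc, div_eq_iff (by positivity)]
    linear_combination (1 / 4) * hsq
  · intro a ha
    have h1 := ha.one_lt_norm
    have h2 := ha.equation
    rw [← hc, div_eq_iff (by positivity)] at h2
    have h3 : (‖a‖ - (c + t) / 2) * (‖a‖ * ((c + t) / 2) - 1) = 0 := by
      linear_combination ((c + t) / 2) * h2 - ‖a‖ * hsq / 4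
    have h4 : ‖a‖ * ((c + t) / 2) - 1 ≠ 0 := by nlinarith
    have h5 : ‖a‖ = (c + t) / 2 := by
      have := (mul_eq_zero.1 h3).resolve_right h4
      linarith
    rw [ha.eq_smul, h5]

theorem IsInversionCenter.mul_radius_sq (ha : IsInversionCenter x r a) (hx : x ≠ 0) :
    ‖a‖ * r ^ 2 = (1 - ‖a‖ * ‖x‖) * (‖a‖ - ‖x‖) := by
  have hX : 0 < ‖x‖ := norm_pos_iff.2 hx
  have hA := ha.one_lt_norm
  have h := ha.equation
  rw [div_eq_div_iff (by positivity) (by positivity)] at h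
  linear_combination h

/-- Correlation says that x', r' satisfy the equation of x, r with the same a. After clearing
denominators this includes x' = 0. -/
theorem IsInversionCenter.mul_radius_sq_of_correlated (ha : IsInversionCenter x r a) (hx : x ≠ 0)
    (h : Correlated x r x' r') : ‖a‖ * r' ^ 2 = (1 - ‖a‖ * ‖x'‖) * (‖a‖ - ‖x'‖) := by
  have hX : 0 < ‖x‖ := norm_pos_iff.2 hx
  have hA := ha.one_lt_norm
  have h1 := ha.equation
  rw [div_eq_div_iff (by positivity) (by positivity)] at h1
  have h2 : ‖x‖ * (‖a‖ * r' ^ 2) = ‖x‖ * ((1 - ‖a‖ * ‖x'‖) * (‖a‖ - ‖x'‖)) := by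
    linear_combination ‖a‖ * h.correlation + ‖x'‖ * h1
  exact mul_left_cancel₀ hX.ne' h2

theorem IsInversionCenter.eq_norm_div_norm_smul (ha : IsInversionCenter x r a) (hx : x ≠ 0)
    (h : SameRay ℝ x x') : x' = (‖x'‖ / ‖a‖) • a := by
  have hX : 0 < ‖x‖ := norm_pos_iff.2 hx
  have hA := ha.one_lt_norm
  have h1 := h.norm_smul_eq
  have h2 : (‖x'‖ / ‖a‖) • a = (‖x'‖ / ‖a‖) • (‖a‖ * ‖x‖⁻¹) • x := congrArg _ ha.eq_smul
  rw [h2, div_eq_inv_mul, smul_smul, show ‖a‖⁻¹ * ‖x'‖ * (‖a‖ * ‖x‖⁻¹) = ‖x‖⁻¹ * ‖x'‖ by field_simp, mul_smul, ← h1,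
    smul_smul, inv_mul_cancel₀ hX.ne', one_smul]

end InversionCenter

/-! ### The weighted surface measure under inversion. -/

section WeightedIntegrals

variable {n : ℕ} {a x : EuclideanSpace ℝ (Fin n)} {r R : ℝ}

/-- The density of `weightedSurfaceMeasure`. -/
noncomputable def inversionWeight (a y : EuclideanSpace ℝ (Fin n)) : ℝ :=
  (‖y - a‖ ^ 2 + 1 - ‖y‖ ^ 2) / ‖y - a‖ ^ 4

theorem measurable_inversionWeight (a : EuclideanSpace ℝ (Fin n)) :
    Measurable (inversionWeight a) := by
  unfold inversionWeight
  fun_prop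

theorem inversionWeight_nonneg (a : EuclideanSpace ℝ (Fin n)) {y : EuclideanSpace ℝ (Fin n)}
    (hy : ‖y‖ ≤ 1) : 0 ≤ inversionWeight a y :=
  div_nonneg (by nlinarith [norm_nonneg y, sq_nonneg ‖y - a‖]) (by positivity)

theorem measurableEmbedding_add_smul_sphere (x : EuclideanSpace ℝ (Fin n)) (hr : 0 < r) :
    MeasurableEmbedding (fun ζ : sphere (0 : EuclideanSpace ℝ (Fin n)) 1 =>
      x + r • (ζ : EuclideanSpace ℝ (Fin n))) := by
  refine (Continuous.isClosedEmbedding (by fun_prop) fun ζ η h => ?_).measurableEmbedding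
  exact Subtype.ext (smul_right_injective _ hr.ne' (add_left_cancel h))

theorem integral_weightedSurfaceMeasure (a : EuclideanSpace ℝ (Fin n)) (hr : 0 < r)
    (hxr : ∀ ζ : sphere (0 : EuclideanSpace ℝ (Fin n)) 1,
      ‖x + r • (ζ : EuclideanSpace ℝ (Fin n))‖ ≤ 1) (g : EuclideanSpace ℝ (Fin n) → ℝ) :
    ∫ y, g y ∂(weightedSurfaceMeasure a x r) =
      r ^ (n - 1) * ∫ ζ : sphere (0 : EuclideanSpace ℝ (Fin n)) 1,
        inversionWeight a (x + r • (ζ : EuclideanSpace ℝ (Fin n))) *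
          g (x + r • (ζ : EuclideanSpace ℝ (Fin n)))
          ∂(volume : Measure (EuclideanSpace ℝ (Fin n))).toSphere := by
  have hm := measurable_inversionWeight a
  have hdef : weightedSurfaceMeasure a x r = (surfaceMeasure x r).withDensity
    (fun y => ENNReal.ofReal (inversionWeight a y)) := rfl
  rw [hdef, integral_withDensity_eq_integral_toReal_smul
    (f := fun y => ENNReal.ofReal (inversionWeight a y)) (by fun_prop) (by simp), surfaceMeasure,
    integral_smul_measure, (measurableEmbedding_add_smul_sphere x hr).integral_map,
    ENNReal.toReal_ofReal (by positivity), smul_eq_mul]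
  congr 1
  refine integral_congr_ae (ae_of_all _ fun ζ => ?_)
  dsimp only
  rw [ENNReal.toReal_ofReal (inversionWeight_nonneg a (hxr ζ)), smul_eq_mul]

theorem one_lt_norm_inv_smul (ha : 1 < ‖a‖) (hR : 0 < R) (hR1 : R ≤ 1) : 1 < ‖R⁻¹ • a‖ := by
  rw [norm_smul, norm_inv, Real.norm_of_nonneg hR.le, inv_mul_eq_div, lt_div_iff₀ hR]
  linarith

theorem norm_sub_inv_smul (hR : 0 < R) (ζ : EuclideanSpace ℝ (Fin n)) :
    ‖ζ - R⁻¹ • a‖ = R⁻¹ * ‖R • ζ - a‖ := by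
  rw [show ζ - R⁻¹ • a = R⁻¹ • (R • ζ - a) by
    rw [smul_sub, smul_smul, inv_mul_cancel₀ hR.ne', one_smul], norm_smul, norm_inv,
    Real.norm_of_nonneg hR.le]

/-- Inversion at a maps the sphere of radius R about 0 to a sphere of the pencil. In unit-sphere
coordinates this map is the inversion with center R⁻¹ • a, whose Jacobian is known. -/
theorem unitInversion_smul_eq (ha : 1 < ‖a‖) (hR : 0 < R) (hR1 : R ≤ 1)
    {ζ : EuclideanSpace ℝ (Fin n)} (hζ : ‖ζ‖ = 1) :
    ((1 - R ^ 2) / (‖a‖ ^ 2 - R ^ 2)) • a +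
      (R * (‖a‖ ^ 2 - 1) / (‖a‖ ^ 2 - R ^ 2)) • unitInversion (R⁻¹ • a) ζ =
        unitInversion a (R • ζ) := by
  have hden : 0 < ‖a‖ ^ 2 - R ^ 2 := by nlinarith
  have hRζ : ‖R • ζ‖ ≤ 1 := by rwa [norm_smul, hζ, mul_one, Real.norm_of_nonneg hR.le]
  have hpos := norm_sub_pos_of_one_lt_norm ha hRζ
  rw [unitInversion_eq (one_lt_norm_inv_smul ha hR hR1), unitInversion_eq ha, norm_sub_inv_smul hR,
    norm_smul, norm_inv, Real.norm_of_nonneg hR.le]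
  generalize ‖R • ζ - a‖ = D at *
  generalize ‖a‖ = A at *
  have e1 : ((R⁻¹ * A) ^ 2 - 1) / (R⁻¹ * D) ^ 2 = (A ^ 2 - R ^ 2) / D ^ 2 := by
    field_simp
  have e2 : R * (A ^ 2 - 1) / (A ^ 2 - R ^ 2) * ((A ^ 2 - R ^ 2) / D ^ 2) =
      R * ((A ^ 2 - 1) / D ^ 2) := by
    field_simp
  rw [e1, smul_add, smul_smul, e2]
  generalize (A ^ 2 - 1) / D ^ 2 = w
  have e3 : (1 - R ^ 2) / (A ^ 2 - R ^ 2) = 1 - (R * (A ^ 2 - 1) / (A ^ 2 - R ^ 2)) * R⁻¹ := by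
    field_simp
    ring
  have e4 : (R * w) • (ζ - R⁻¹ • a) = w • (R • ζ - a) := by
    rw [show ζ - R⁻¹ • a = R⁻¹ • (R • ζ - a) by
      rw [smul_sub, smul_smul, inv_mul_cancel₀ hR.ne', one_smul], smul_smul]
    congr 1
    field_simp
  rw [e3, e4, smul_smul]
  module

/-- On |y| = R only |y - a|² varies. Multiplied by the Jacobian, which is proportional to |y -
a|^(-2(n-1)), it leaves the squared Kelvin factor, and this is the reason for the weight. -/
theorem inversionWeight_unitInversion (ha : 1 < ‖a‖) {y : EuclideanSpace ℝ (Fin n)}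
    (hy : ‖y‖ ≤ 1) : inversionWeight a (unitInversion a y) =
      (‖a‖ ^ 2 - ‖y‖ ^ 2) * ‖y - a‖ ^ 2 / (‖a‖ ^ 2 - 1) ^ 3 := by
  have hpos := norm_sub_pos_of_one_lt_norm ha hy
  have hA : 0 < ‖a‖ ^ 2 - 1 := by nlinarith
  have h1 : ‖unitInversion a y - a‖ = (‖a‖ ^ 2 - 1) / ‖y - a‖ := by
    rw [unitInversion_eq ha, add_sub_cancel_right, norm_smul, Real.norm_of_nonneg (by positivity)]
    field_simp
  have h2 : ‖unitInversion a y - a‖ ^ 2 + 1 - ‖unitInversion a y‖ ^ 2 =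
      (‖a‖ ^ 2 - 1) * (‖a‖ ^ 2 - ‖y‖ ^ 2) / ‖y - a‖ ^ 2 := by
    rw [add_sub_assoc, one_sub_norm_unitInversion_sq ha hpos, h1]
    field_simp
    ring
  rw [inversionWeight, h2, h1]
  field_simp

/-- Inversion with center `a` turns the weighted integral over a sphere of the Apollonian pencil
into an integral over a sphere centered at the origin. -/
theorem mul_integral_weightedSurfaceMeasure (hn : 2 ≤ n) (ha : 1 < ‖a‖) (hR : 0 < R) (hR1 : R ≤ 1)
    (hx : x = ((1 - R ^ 2) / (‖a‖ ^ 2 - R ^ 2)) • a)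
    (hr : r = R * (‖a‖ ^ 2 - 1) / (‖a‖ ^ 2 - R ^ 2)) (g : EuclideanSpace ℝ (Fin n) → ℝ) :
    r * ∫ y, g y ∂(weightedSurfaceMeasure a x r) =
      R ^ n / (‖a‖ ^ 2 - 1) * ∫ ζ : sphere (0 : EuclideanSpace ℝ (Fin n)) 1,
        (inversionFactor a (R • (ζ : EuclideanSpace ℝ (Fin n))) ^ (n - 2)) ^ 2 *
          g (unitInversion a (R • (ζ : EuclideanSpace ℝ (Fin n))))
          ∂(volume : Measure (EuclideanSpace ℝ (Fin n))).toSphere := by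
  have hA : 0 < ‖a‖ ^ 2 - 1 := by nlinarith
  have hden : 0 < ‖a‖ ^ 2 - R ^ 2 := by nlinarith
  have hrpos : 0 < r := hr ▸ by positivity
  have hb := one_lt_norm_inv_smul ha hR hR1
  have hle : ∀ ζ : sphere (0 : EuclideanSpace ℝ (Fin n)) 1,
      ‖R • (ζ : EuclideanSpace ℝ (Fin n))‖ ≤ 1 := fun ζ => by rwa [norm_smul_sphere hR.le]
  have hpt : ∀ ζ : sphere (0 : EuclideanSpace ℝ (Fin n)) 1,
      x + r • unitInversion (R⁻¹ • a) ζ = unitInversion a (R • (ζ : EuclideanSpace ℝ (Fin n))) :=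
    fun ζ => by rw [hx, hr, unitInversion_smul_eq ha hR hR1 (norm_eq_of_mem_sphere ζ)]
  have hxr : ∀ ζ : sphere (0 : EuclideanSpace ℝ (Fin n)) 1,
      ‖x + r • (ζ : EuclideanSpace ℝ (Fin n))‖ ≤ 1 := fun ζ => by
    rw [← sphereInversion_sphereInversion hb ζ, coe_sphereInversion, hpt]
    rw [← sub_nonneg]
    set y := R • (sphereInversion hb ζ : EuclideanSpace ℝ (Fin n)) with hy
    have h1 := one_sub_norm_unitInversion_sq ha (norm_sub_pos_of_one_lt_norm ha (hle _) : 0 < ‖y - a‖)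
    have h2 : 0 ≤ (‖a‖ ^ 2 - 1) / ‖y - a‖ ^ 2 * (1 - ‖y‖ ^ 2) :=
      mul_nonneg (by positivity) (by nlinarith [hle (sphereInversion hb ζ), norm_nonneg y])
    nlinarith [norm_nonneg (unitInversion a y)]
  -- The unit sphere is reparametrized by the inversion with center R⁻¹ • a, and the outer r joins
  -- r^(n-1) to give r^n.
  rw [integral_weightedSurfaceMeasure a hrpos hxr,
    ← integral_inversionJacobian_smul (by omega) hb, ← mul_assoc, ← pow_succ',
    Nat.sub_add_cancel (by omega), ← integral_const_mul, ← integral_const_mul]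
  refine integral_congr_ae (ae_of_all _ fun ζ => ?_)
  dsimp only
  rw [coe_sphereInversion, hpt, inversionWeight_unitInversion ha (hle ζ), ← pow_mul, mul_comm (n - 2),
    pow_mul, inversionFactor_sq ha, inversionJacobian, norm_sub_inv_smul hR, norm_smul_sphere hR.le,
    norm_smul, norm_inv, Real.norm_of_nonneg hR.le, hr, smul_eq_mul]
  have hD := norm_sub_pos_of_one_lt_norm ha (hle ζ)
  generalize ‖R • (ζ : EuclideanSpace ℝ (Fin n)) - a‖ = D at *
  generalize g _ = t
  clear hpt hxr hle hx
  generalize ‖a‖ = A at *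
  have e1 : ((R⁻¹ * A) ^ 2 - 1) / (R⁻¹ * D) ^ 2 = (A ^ 2 - R ^ 2) / D ^ 2 := by
    field_simp
  rw [e1]
  obtain ⟨m, rfl⟩ : ∃ m, n = m + 2 := ⟨n - 2, by omega⟩
  simp only [Nat.add_sub_cancel, show m + 2 - 1 = m + 1 from rfl, div_pow, mul_pow]
  field_simp
  ring

end WeightedIntegrals

/-! ### Weighted integrals of functions in h² as square means of the Kelvin transform. -/

section HarmonicHardyTwo

variable {n : ℕ} {f : EuclideanSpace ℝ (Fin n) → ℂ}

theorem MemHarmonicHardyTwo.exists_eq_ballPoissonIntegral (hn : 0 < n)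
    (hf : MemHarmonicHardyTwo f) :
    ∃ φ : sphere (0 : EuclideanSpace ℝ (Fin n)) 1 → ℂ,
      MemLp φ 2 (volume : Measure (EuclideanSpace ℝ (Fin n))).toSphere ∧
      (∀ y : EuclideanSpace ℝ (Fin n), ‖y‖ < 1 → f y = ballPoissonIntegral φ y) ∧
      ∀ᵐ (ζ : sphere (0 : EuclideanSpace ℝ (Fin n)) 1)
        ∂(volume : Measure (EuclideanSpace ℝ (Fin n))).toSphere,
        Tendsto (fun ρ : ℝ => f (ρ • (ζ : EuclideanSpace ℝ (Fin n)))) (𝓝[<] 1) (𝓝 (φ ζ)) := by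
  obtain ⟨hh, C, hC⟩ := hf
  obtain ⟨φ, hφ, hfφ⟩ := _root_.exists_eq_ballPoissonIntegral hn
    (fun y hy => (hh y hy).1.continuousAt.continuousWithinAt)
    (fun y hy => HasLineLaplacian.of_harmonicAt (hh y hy)) hC
  refine ⟨φ, hφ, hfφ, ?_⟩
  filter_upwards [ae_tendsto_ballPoissonIntegral hn (hφ.integrable (by norm_num))] with ζ hζ
  refine hζ.congr' ?_
  filter_upwards [Ioo_mem_nhdsLT (zero_lt_one (α := ℝ))] with ρ hρ
  rw [hfφ _ (by rw [norm_smul_sphere hρ.1.le]; exact hρ.2)]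

theorem boundaryExtension_of_norm_lt_one {y : EuclideanSpace ℝ (Fin n)} (hy : ‖y‖ < 1) :
    boundaryExtension f y = f y := if_pos hy

theorem boundaryExtension_eq_of_tendsto {y : EuclideanSpace ℝ (Fin n)} (hy : ‖y‖ = 1) {c : ℂ}
    (h : Tendsto (fun ρ : ℝ => f (ρ • y)) (𝓝[<] 1) (𝓝 c)) : boundaryExtension f y = c := by
  rw [boundaryExtension, if_neg (by simp [hy]), h.limUnder_eq]

theorem surfaceMeasure_zero_one : surfaceMeasure (0 : EuclideanSpace ℝ (Fin n)) 1 =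
    (volume : Measure (EuclideanSpace ℝ (Fin n))).toSphere.map Subtype.val := by
  simp [surfaceMeasure]

theorem ae_surfaceMeasure_zero_one_iff {p : EuclideanSpace ℝ (Fin n) → Prop} :
    (∀ᵐ y ∂(surfaceMeasure (0 : EuclideanSpace ℝ (Fin n)) 1), p y) ↔
      ∀ᵐ (ζ : sphere (0 : EuclideanSpace ℝ (Fin n)) 1)
        ∂(volume : Measure (EuclideanSpace ℝ (Fin n))).toSphere, p ζ := by
  rw [surfaceMeasure_zero_one,
    (MeasurableEmbedding.subtype_coe isClosed_sphere.measurableSet).ae_map_iff]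

variable {φ : sphere (0 : EuclideanSpace ℝ (Fin n)) 1 → ℂ} {a : EuclideanSpace ℝ (Fin n)}

theorem integrable_norm_boundaryExtension_sq (ha : 1 < ‖a‖)
    (hφ : MemLp φ 2 (volume : Measure (EuclideanSpace ℝ (Fin n))).toSphere)
    (hφf : ∀ᵐ (ζ : sphere (0 : EuclideanSpace ℝ (Fin n)) 1)
      ∂(volume : Measure (EuclideanSpace ℝ (Fin n))).toSphere, boundaryExtension f ζ = φ ζ) :
    Integrable (fun y => ‖boundaryExtension f y‖ ^ 2) (weightedSurfaceMeasure a 0 1) := by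
  have hm := measurable_inversionWeight a
  have hemb := MeasurableEmbedding.subtype_coe
    (isClosed_sphere (x := (0 : EuclideanSpace ℝ (Fin n))) (ε := 1)).measurableSet
  have hint : Integrable (fun y => ‖boundaryExtension f y‖ ^ 2)
      (surfaceMeasure (0 : EuclideanSpace ℝ (Fin n)) 1) := by
    rw [surfaceMeasure_zero_one, hemb.integrable_map_iff]
    refine hφ.norm.integrable_sq.congr ?_
    filter_upwards [hφf] with ζ hζ
    simp [hζ]
  refine (hint.smul_measure (c := ENNReal.ofReal (1 / (‖a‖ - 1) ^ 2))
    ENNReal.ofReal_ne_top).mono_measure ?_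
  rw [weightedSurfaceMeasure, ← withDensity_const]
  refine withDensity_mono (ae_surfaceMeasure_zero_one_iff.2 (ae_of_all _ fun ζ =>
    ENNReal.ofReal_le_ofReal ?_))
  have hpos := norm_sub_pos_of_one_lt_norm ha (norm_eq_of_mem_sphere ζ).le
  have h1 : ‖a‖ - 1 ≤ ‖(ζ : EuclideanSpace ℝ (Fin n)) - a‖ := by
    have := norm_sub_norm_le a (ζ : EuclideanSpace ℝ (Fin n))
    rwa [norm_sub_rev, norm_eq_of_mem_sphere] at this
  have h2 : 0 < ‖a‖ - 1 := by linarith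
  rw [norm_eq_of_mem_sphere ζ, show ∀ D : ℝ, (D ^ 2 + 1 - 1 ^ 2) = D ^ 2 by intro D; ring]
  calc ‖(ζ : EuclideanSpace ℝ (Fin n)) - a‖ ^ 2 / ‖(ζ : EuclideanSpace ℝ (Fin n)) - a‖ ^ 4
      = 1 / ‖(ζ : EuclideanSpace ℝ (Fin n)) - a‖ ^ 2 := by field_simp
    _ ≤ 1 / (‖a‖ - 1) ^ 2 := by gcongr

theorem mul_weightedSphereIntegral_eq (hn : 2 ≤ n) (ha : 1 < ‖a‖) {x : EuclideanSpace ℝ (Fin n)}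
    {r R : ℝ} (hR : 0 < R) (hR1 : R < 1)
    (hx : x = ((1 - R ^ 2) / (‖a‖ ^ 2 - R ^ 2)) • a)
    (hr : r = R * (‖a‖ ^ 2 - 1) / (‖a‖ ^ 2 - R ^ 2))
    (hfφ : ∀ y : EuclideanSpace ℝ (Fin n), ‖y‖ < 1 → f y = ballPoissonIntegral φ y) :
    r * weightedSphereIntegral f a x r = R ^ n / (‖a‖ ^ 2 - 1) *
      ∫ ζ, ‖poissonDilation R (sphereKelvin ha φ) ζ‖ ^ 2
        ∂(volume : Measure (EuclideanSpace ℝ (Fin n))).toSphere := by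
  rw [weightedSphereIntegral, mul_integral_weightedSurfaceMeasure hn ha hR hR1.le hx hr]
  congr 1
  refine integral_congr_ae (ae_of_all _ fun ζ => ?_)
  have hlt : ‖R • (ζ : EuclideanSpace ℝ (Fin n))‖ < 1 := by rwa [norm_smul_sphere hR.le]
  have hlt' := norm_unitInversion_lt_one ha hlt
  dsimp only
  rw [poissonDilation, ballPoissonIntegral_sphereKelvin hn ha φ hlt,
    boundaryExtension_of_norm_lt_one hlt', hfφ _ hlt', norm_smul, mul_pow, Real.norm_eq_abs, sq_abs]

theorem weightedSphereIntegral_zero_one_eq (hn : 2 ≤ n) (ha : 1 < ‖a‖)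
    (hφf : ∀ᵐ (ζ : sphere (0 : EuclideanSpace ℝ (Fin n)) 1)
      ∂(volume : Measure (EuclideanSpace ℝ (Fin n))).toSphere, boundaryExtension f ζ = φ ζ) :
    weightedSphereIntegral f a 0 1 = 1 / (‖a‖ ^ 2 - 1) *
      ∫ ζ, ‖sphereKelvin ha φ ζ‖ ^ 2 ∂(volume : Measure (EuclideanSpace ℝ (Fin n))).toSphere := by
  have hA : 0 < ‖a‖ ^ 2 - 1 := by nlinarith
  have h := mul_integral_weightedSurfaceMeasure (x := (0 : EuclideanSpace ℝ (Fin n))) (r := 1)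
    (R := 1) hn ha one_pos le_rfl (by simp) (by field_simp) (fun y => ‖boundaryExtension f y‖ ^ 2)
  rw [weightedSphereIntegral, ← one_mul (∫ y, _ ∂(weightedSurfaceMeasure a 0 1)), h, one_pow]
  congr 1
  -- The radial limits are known only almost everywhere, and the inversion pulls null sets back to
  -- null sets.
  have hs : ∀ᵐ (ζ : sphere (0 : EuclideanSpace ℝ (Fin n)) 1)
      ∂(volume : Measure (EuclideanSpace ℝ (Fin n))).toSphere,
      boundaryExtension f (sphereInversion ha ζ) = φ (sphereInversion ha ζ) := by
    obtain ⟨C, hC, hle⟩ := map_sphereInversion_le (n := n) (by omega) ha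
    rw [← (sphereInversion ha).measurableEmbedding.ae_map_iff
      (p := fun ζ => boundaryExtension f ζ = φ ζ)]
    exact (Measure.absolutelyContinuous_of_le_smul hle).ae_le hφf
  refine integral_congr_ae ?_
  filter_upwards [hs] with ζ hζ
  rw [sphereKelvin, ← hζ, coe_sphereInversion, one_smul, norm_smul, mul_pow, Real.norm_eq_abs, sq_abs]

end HarmonicHardyTwo

/-! ### Assembly of the three-spheres inequality. -/

/-- The constant c is harmless because the exponents α and 1 - α add up to 1, and R^n turns into
(R^α)^n. -/
theorem mul_rpow_le_of_le_rpow {c P Q M₁ M₂ α R : ℝ} {n : ℕ} (hc : 0 ≤ c) (hR : 0 < R)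
    (hM₁ : 0 ≤ M₁) (hM₂ : 0 ≤ M₂) (h : P ≤ M₁ ^ α * M₂ ^ (1 - α)) (hQ : Q = (R ^ α) ^ n * c * P) :
    Q ≤ (R ^ n * c * M₁) ^ α * (c * M₂) ^ (1 - α) := by
  rcases hc.eq_or_lt with rfl | hc
  · rw [hQ]
    simp only [mul_zero, zero_mul]
    positivity
  have hcc : c ^ α * c ^ (1 - α) = c := by
    rw [← Real.rpow_add hc, add_sub_cancel, Real.rpow_one]
  have hRn : (R ^ n) ^ α = (R ^ α) ^ n := by
    rw [← Real.rpow_natCast, ← Real.rpow_natCast, ← Real.rpow_mul hR.le, ← Real.rpow_mul hR.le,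
      mul_comm]
  rw [Real.mul_rpow (by positivity) hM₁, Real.mul_rpow (by positivity) hc.le,
    Real.mul_rpow hc.le hM₂, hRn, hQ]
  calc (R ^ α) ^ n * c * P ≤ (R ^ α) ^ n * c * (M₁ ^ α * M₂ ^ (1 - α)) := by gcongr
    _ = (R ^ α) ^ n * (c ^ α * c ^ (1 - α)) * (M₁ ^ α * M₂ ^ (1 - α)) := by rw [hcc]
    _ = _ := by ring

theorem threeSpheresInequality_of_rpow {n : ℕ} (hn : 2 ≤ n) {a x x' : EuclideanSpace ℝ (Fin n)}
    {r r' R α β : ℝ} (ha : 1 < ‖a‖) (hR : 0 < R) (hR1 : R < 1) (hα : α ≤ 1)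
    (hβ : β ∈ Ioc 0 α) (hx : x = ((1 - R ^ 2) / (‖a‖ ^ 2 - R ^ 2)) • a)
    (hr : r = R * (‖a‖ ^ 2 - 1) / (‖a‖ ^ 2 - R ^ 2))
    (hx' : x' = ((1 - (R ^ α) ^ 2) / (‖a‖ ^ 2 - (R ^ α) ^ 2)) • a)
    (hr' : r' = R ^ α * (‖a‖ ^ 2 - 1) / (‖a‖ ^ 2 - (R ^ α) ^ 2))
    {f : EuclideanSpace ℝ (Fin n) → ℂ} {φ : sphere (0 : EuclideanSpace ℝ (Fin n)) 1 → ℂ}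
    (hφ : MemLp φ 2 (volume : Measure (EuclideanSpace ℝ (Fin n))).toSphere)
    (hfφ : ∀ y : EuclideanSpace ℝ (Fin n), ‖y‖ < 1 → f y = ballPoissonIntegral φ y)
    (hφf : ∀ᵐ (ζ : sphere (0 : EuclideanSpace ℝ (Fin n)) 1)
      ∂(volume : Measure (EuclideanSpace ℝ (Fin n))).toSphere, boundaryExtension f ζ = φ ζ) :
    ThreeSpheresInequality f a x r x' r' β := by
  have hα0 : 0 < α := hβ.1.trans_le hβ.2
  have hA : 0 < ‖a‖ ^ 2 - 1 := by nlinarith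
  have hψ := hφ.sphereKelvin (by omega) ha
  have hM0 : 0 ≤ ∫ ζ, ‖poissonDilation R (sphereKelvin ha φ) ζ‖ ^ 2
    ∂(volume : Measure (EuclideanSpace ℝ (Fin n))).toSphere :=
    integral_nonneg fun _ => by positivity
  have hM1 : 0 ≤ ∫ ζ, ‖sphereKelvin ha φ ζ‖ ^ 2
    ∂(volume : Measure (EuclideanSpace ℝ (Fin n))).toSphere :=
    integral_nonneg fun _ => by positivity
  have hle := integral_norm_poissonDilation_sq_le (by omega) hψ hR.le hR1
  have hlog := integral_norm_poissonDilation_sq_le_rpow (by omega) hψ hR hR1 hα0 hα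
  have e := mul_weightedSphereIntegral_eq hn ha hR hR1 hx hr hfφ
  have e' := mul_weightedSphereIntegral_eq hn ha (Real.rpow_pos_of_pos hR α)
    (Real.rpow_lt_one hR.le hR1 hα0) hx' hr' hfφ
  have e1 := weightedSphereIntegral_zero_one_eq hn ha hφf
  rw [ThreeSpheresInequality, e, e1, div_eq_mul_one_div]
  rw [div_eq_mul_one_div] at e'
  -- The inequality with exponent α comes first; the smaller β is allowed because R^n M(R) ≤ M(1).
  refine (mul_rpow_le_of_le_rpow (by positivity) hR hM0 hM1 hlog e').trans
    (rpow_mul_rpow_one_sub_le (by positivity) ?_ hβ.1 hβ.2)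
  exact mul_le_mul (mul_le_of_le_one_left (by positivity) (pow_le_one₀ hR.le hR1.le)) hle hM0
    (by positivity)

theorem theorem1 (n : ℕ) (hn : 2 ≤ n)
    (x : EuclideanSpace ℝ (Fin n)) (r : ℝ) (x' : EuclideanSpace ℝ (Fin n)) (r' : ℝ)
    (hcorr : Correlated x r x' r') (hx : x ≠ 0) (hr : 0 < r) (hr1 : r < 1 - ‖x‖)
    (hle : ‖x'‖ ≤ ‖x‖) :
    (∃! a : EuclideanSpace ℝ (Fin n), IsInversionCenter x r a) ∧
    ∀ a : EuclideanSpace ℝ (Fin n), IsInversionCenter x r a →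
      (∃! α : ℝ, IsThreeSpheresExponent a x r x' r' α) ∧
      ∀ α : ℝ, IsThreeSpheresExponent a x r x' r' α →
        (x' ≠ 0 → ‖x'‖ ^ 2 * ((1 - ‖x‖ - r) / Real.log ((1 - ‖x‖ ^ 2) / r)) ∈ Set.Ioc 0 α) ∧
        ∀ f : EuclideanSpace ℝ (Fin n) → ℂ, MemHarmonicHardyTwo f →
          (∀ᵐ ζ ∂(surfaceMeasure (0 : EuclideanSpace ℝ (Fin n)) 1),
            Tendsto (fun ρ : ℝ => f (ρ • ζ)) (𝓝[<] 1) (𝓝 (boundaryExtension f ζ))) ∧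
          Integrable (fun y => ‖boundaryExtension f y‖ ^ 2) (weightedSurfaceMeasure a 0 1) ∧
          (∀ β ∈ Set.Ioc 0 α, ThreeSpheresInequality f a x r x' r' β) ∧
          ThreeSpheresInequality f a x r x' r'
            (‖x'‖ ^ 2 * ((1 - ‖x‖ - r) / Real.log ((1 - ‖x‖ ^ 2) / r))) := by
  refine ⟨existsUnique_isInversionCenter hx hr hr1, fun a ha => ?_⟩
  have hA := ha.one_lt_norm
  have hX : 0 < ‖x‖ := norm_pos_iff.2 hx
  have hX1 : ‖x‖ ≤ 1 := by linarith
  unfold IsThreeSpheresExponent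
  obtain ⟨R, hRdef⟩ : ∃ R, R = (1 - ‖a‖ * ‖x‖) / r := ⟨_, rfl⟩
  obtain ⟨R', hRdef'⟩ : ∃ R', R' = (1 - ‖a‖ * ‖x'‖) / r' := ⟨_, rfl⟩
  obtain ⟨hR, hR1, hXR, hrR⟩ := apollonian_parameters hA hX.le hX1 hr (ha.mul_radius_sq hx) hRdef
  obtain ⟨hR', hR1', hXR', hrR'⟩ := apollonian_parameters hA (norm_nonneg x') (hle.trans hX1)
    hcorr.radius_pos' (ha.mul_radius_sq_of_correlated hx hcorr) hRdef'
  have hRR' : R ≤ R' := apollonian_radius_le hA hR hR1 hR' hR1' (hXR' ▸ hXR ▸ hle)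
  have hRlt : R < 1 := hR1.lt_of_ne fun h => hX.ne' (by rw [hXR, h]; simp)
  have hlogR : Real.log R < 0 := Real.log_neg hR hRlt
  have hcenter : ∀ {y : EuclideanSpace ℝ (Fin n)} {S : ℝ}, SameRay ℝ x y →
      ‖y‖ = ‖a‖ * (1 - S ^ 2) / (‖a‖ ^ 2 - S ^ 2) →
      y = ((1 - S ^ 2) / (‖a‖ ^ 2 - S ^ 2)) • a := fun {y S} hy h => by
    conv_lhs => rw [ha.eq_norm_div_norm_smul hx hy, h]
    congr 1
    field_simp
  rw [← hRdef, ← hRdef']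
  -- The equation for the exponent is R' = R^α with 0 < R < 1, where R < 1 comes from x ≠ 0.
  refine ⟨⟨Real.log R' / Real.log R, ?_, fun α hα => ?_⟩, fun α hα => ?_⟩
  · dsimp only
    rw [Real.rpow_def_of_pos hR, mul_div_cancel₀ _ hlogR.ne, Real.exp_log hR']
  · rw [hα, Real.log_rpow hR, mul_div_cancel_right₀ _ hlogR.ne]
  have hlogα : Real.log R' = α * Real.log R := by rw [hα, Real.log_rpow hR]
  have hα1 : α ≤ 1 := by
    have := Real.log_le_log hR hRR'
    nlinarith
  have hbound : -Real.log R ≤ Real.log ((1 - ‖x‖ ^ 2) / r) := by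
    rw [← Real.log_inv]
    exact Real.log_le_log (by positivity) (inv_le_one_sub_sq_div hA hR hR1 hXR hrR)
  have hmem : x' ≠ 0 →
      ‖x'‖ ^ 2 * ((1 - ‖x‖ - r) / Real.log ((1 - ‖x‖ ^ 2) / r)) ∈ Set.Ioc 0 α := fun hx' => by
    have hX' : 0 < ‖x'‖ := norm_pos_iff.2 hx'
    have hnum : 0 < 1 - ‖x‖ - r := by linarith
    have hlog0 : 0 < Real.log ((1 - ‖x‖ ^ 2) / r) := by linarith
    refine ⟨by positivity, ?_⟩
    -- The chain is |x'|²(1 - |x| - r) ≤ -log R' = α(-log R) ≤ α log((1 - |x|²)/r).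
    have hkey := sq_mul_one_sub_sub_le_neg_log hA hR hR1 hXR hrR hR' hR1' hXR'
    rw [← mul_div_assoc, div_le_iff₀ hlog0]
    have hα0 : 0 ≤ α := by
      by_contra! hneg
      nlinarith [Real.log_nonpos hR'.le hR1', mul_pos_of_neg_of_neg hneg hlogR]
    nlinarith [mul_le_mul_of_nonneg_left hbound hα0]
  refine ⟨hmem, fun f hf => ?_⟩
  obtain ⟨φ, hφ, hfφ, hlim⟩ := hf.exists_eq_ballPoissonIntegral (by omega)
  have hφf : ∀ᵐ (ζ : sphere (0 : EuclideanSpace ℝ (Fin n)) 1)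
      ∂(volume : Measure (EuclideanSpace ℝ (Fin n))).toSphere, boundaryExtension f ζ = φ ζ := by
    filter_upwards [hlim] with ζ hζ
    exact boundaryExtension_eq_of_tendsto (norm_eq_of_mem_sphere ζ) hζ
  have hineq : ∀ β ∈ Set.Ioc 0 α, ThreeSpheresInequality f a x r x' r' β := fun β hβ =>
    threeSpheresInequality_of_rpow hn hA hR hRlt hα1 hβ (hcenter SameRay.rfl hXR) hrR
      (hcenter hcorr.codirected (hα ▸ hXR')) (hα ▸ hrR') hφ hfφ hφf
  refine ⟨ae_surfaceMeasure_zero_one_iff.2 ?_, integrable_norm_boundaryExtension_sq hA hφ hφf,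
    hineq, ?_⟩
  · filter_upwards [hlim, hφf] with ζ hζ hζ'
    rwa [hζ']
  -- For x' = 0 one gets R' = r' = 1 and ω = 0. Both sides are then the integral over the unit
  -- sphere, since p^0 = 1 for every real p.
  · rcases eq_or_ne x' 0 with rfl | hx'
    · have h1 : R' ^ 2 = 1 := by
        rw [norm_zero, eq_comm, div_eq_zero_iff] at hXR'
        rcases hXR' with h | h <;> nlinarith
      have hr1' : r' = 1 := by
        rw [hrR', h1, show R' = 1 by nlinarith]
        have : ‖a‖ ^ 2 - 1 ≠ 0 := by nlinarith
        field_simp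
      simp [ThreeSpheresInequality, hr1']
    · exact hineq _ (hmem hx')
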